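/- Let $n\ge 1$, $\alpha\in(0,1)$, $T>0$, and write $H=L^2(\mathbb R^n)$ with norm $\|\cdot\|$ and inner product $(\cdot,\cdot)$ (real-valued functions), $(-\Delta)^s u=\mathcal F^{-1}(|\xi|^{2s}\mathcal F u)$, where $\mathcal F$ is the (unitary, angular-frequency) Fourier transform, and $V=H^\alpha(\mathbb R^n)=\{u\in H:(-\Delta)^{\alpha/2}u\in L^2(\mathbb R^n)\}$ with $\|u\|_V^2=\|u\|^2+\|(-\Delta)^{\alpha/2}u\|^2$. Let $l^2$ be the space of square summable real sequences. **Drift.** Let $p>2$, $\lambda_1,\lambda_2>0$, and let $F:\mathbb R\times\mathbb R^n\times\mathbb R\to\mathbb R$ be continuous such that for all $t,u,u_1,u_2\in\mathbb R$ and $x\in\mathbb R^n$ $$F(t,x,u)u\ge\lambda_1|u|^p-\psi_1(t,x),\qquad |F(t,x,u)|\le\psi_2(t,x)|u|^{p-1}+\psi_3(t,x),$$ $$(F(t,x,u_1)-F(t,x,u_2))(u_1-u_2)\ge\lambda_2(|u_1|^{p-2}u_1-|u_2|^{p-2}u_2)(u_1-u_2)-\psi_4(t,x)|u_1-u_2|^2,$$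 where $\psi_1\in L^1_{loc}(\mathbb R,L^1(\mathbb R^n))$, $\psi_2,\psi_4\in L^\infty_{loc}(\mathbb R,L^\infty(\mathbb R^n))$ and $\psi_3\in L^{p/(p-1)}_{loc}(\mathbb R,L^{p/(p-1)}(\mathbb R^n))$. **Diffusion.** Let $\sigma(t,x,u)=\sigma_1(t,x)+\kappa(x)\sigma_2(t,x,u)\in l^2$, where $\kappa\in L^2(\mathbb R^n)\cap L^\infty(\mathbb R^n)$, $\sigma_1\in L^\infty_{loc}(\mathbb R,L^2(\mathbb R^n,l^2))$, and $\sigma_2=\{\sigma_{2,k}\}_{k\ge1}$ with measurable $\sigma_{2,k}:\mathbb R\times\mathbb R^n\times\mathbb R\to\mathbb R$. Let $q\in[2,1+\frac p2]$ and let $\alpha_k,\beta_k,\gamma_k>0$ satisfy $\sum_k(\alpha_k+\beta_k+\gamma_k)<\infty$ and, for all $k$, $t,u,u_1,u_2\in\mathbb R$ and $x\in\mathbb R^n$, $$|\sigma_{2,k}(t,x,u_1)-\sigma_{2,k}(t,x,u_2)|^2\le\alpha_k(1+|u_1|^{q-2}+|u_2|^{q-2})|u_1-u_2|^2,\qquad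 |\sigma_{2,k}(t,x,u)|^2\le\beta_k+\gamma_k|u|^q.$$ For $u\in L^p(\mathbb R^n)$ and $w=\{w_k\}\in l^2$ put $(\sigma(t,u)w)(x)=\sum_k(\sigma_{1,k}(t,x)+\kappa(x)\sigma_{2,k}(t,x,u(x)))w_k$. **Controlled equation.** Let $g\in L^2_{loc}(\mathbb R,H)$ and $u_0\in H$. For $v\in L^2(0,T;l^2)$, a solution $u_v$ of $$\frac{du_v}{dt}+(-\Delta)^\alpha u_v+F(t,\cdot,u_v)=g(t)+\sigma(t,u_v)v(t),\qquad u_v(0)=u_0,$$ on $[0,T]$ is a function $u_v\in C([0,T],H)\cap L^2(0,T;V)\cap L^p(0,T;L^p(\mathbb R^n))$ such that for all $t\in[0,T]$ and $\xi\in V\cap L^p(\mathbb R^n)$ $$(u_v(t),\xi)+\int_0^t((-\Delta)^{\alpha/2}u_v,(-\Delta)^{\alpha/2}\xi)\,ds+\int_0^t\!\int_{\mathbb R^n}F(s,x,u_v)\,\xi\,dx\,ds=(u_0,\xi)+\int_0^t(g,\xi)\,ds+\int_0^t(\sigma(s,u_v)v,\xi)\,ds.$$ **Claim.** Suppose $v_j\to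 v$ weakly in $L^2(0,T;l^2)$, and let $u_{v_j}$ and $u_v$ be solutions with controls $v_j$ and $v$, respectively, and the same initial value $u_0$. Then $u_{v_j}\to u_v$ strongly in $C([0,T],H)\cap L^2(0,T;V)\cap L^p(0,T;L^p(\mathbb R^n))$. -/

import Mathlib

open MeasureTheory Set Filter Topology
open scoped ENNReal FourierTransform

noncomputable section

namespace FracRD

/-- The Euclidean space `ℝⁿ`. -/
abbrev E (n : ℕ) := EuclideanSpace ℝ (Fin n)

/-- The space `H = L²(ℝⁿ)` of real-valued functions. -/
abbrev H (n : ℕ) := Lp ℝ 2 (volume : Measure (E n))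

/-- The complex space `L²(ℝⁿ; ℂ)`, on which the Fourier transform acts. -/
abbrev HC (n : ℕ) := Lp ℂ 2 (volume : Measure (E n))

/-- The space `l²` of square summable real sequences. -/
abbrev SeqL2 := lp (fun _ : ℕ => ℝ) 2

/-- The space `L²(ℝⁿ; l²)`. -/
abbrev HSeq (n : ℕ) := Lp SeqL2 2 (volume : Measure (E n))

/-- The space of controls `L²(0,T; l²)`. -/
abbrev Control (T : ℝ) := Lp SeqL2 2 (volume.restrict (Icc (0 : ℝ) T))

/-- A real-valued `L²` function seen as a complex-valued one. -/
def complexify {n : ℕ} (u : H n) : HC n := Complex.ofRealCLM.compLp u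

/-- The Fourier side of `(-Δ)^s f`. Mathlib's Fourier transform has the kernel
`exp (-2πi⟪x, ξ⟫)`, so the symbol of `(-Δ)^s` (which is `|ξ|^{2s}` for the kernel
`exp (-i⟪x, ξ⟫)`) is `(2π|ξ|)^{2s}`. -/
def fracLapFourier {n : ℕ} (s : ℝ) (f : HC n) (ξ : E n) : ℂ :=
  (((2 * Real.pi * ‖ξ‖) ^ (2 * s) : ℝ) : ℂ) * (𝓕 f : HC n) ξ

open Classical in
/-- The fractional Laplacian `(-Δ)^s f = 𝓕⁻¹ (|ξ|^{2s} 𝓕 f)` on its domain in `L²`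
(and `0` outside the domain). -/
def fracLap {n : ℕ} (s : ℝ) (f : HC n) : HC n :=
  if h : MemLp (fracLapFourier s f) 2 (volume : Measure (E n)) then
    (𝓕⁻ (h.toLp (fracLapFourier s f)) : HC n)
  else 0

/-- Membership in `V = H^α(ℝⁿ)`, that is `(-Δ)^{α/2} u ∈ L²(ℝⁿ)`. -/
def MemV {n : ℕ} (α : ℝ) (u : H n) : Prop :=
  MemLp (fracLapFourier (α / 2) (complexify u)) 2 (volume : Measure (E n))

/-- The bilinear form `((-Δ)^{α/2} u, (-Δ)^{α/2} w)` for `u, w ∈ V`. -/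
def fracForm {n : ℕ} (α : ℝ) (u w : H n) : ℝ :=
  (inner ℂ (fracLap (α / 2) (complexify u)) (fracLap (α / 2) (complexify w))).re

/-- The squared norm `‖u‖_V² = ‖u‖² + ‖(-Δ)^{α/2} u‖²`, with the value `∞` for `u ∉ V`;
see `sqNormV_eq`. -/
def sqNormV {n : ℕ} (α : ℝ) (u : H n) : ℝ≥0∞ :=
  ‖u‖ₑ ^ 2 + (eLpNorm (fracLapFourier (α / 2) (complexify u)) 2 (volume : Measure (E n))) ^ 2

theorem sqNormV_eq {n : ℕ} {α : ℝ} {u : H n} (hu : MemV α u) :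
    sqNormV α u = ENNReal.ofReal (‖u‖ ^ 2 + ‖fracLap (α / 2) (complexify u)‖ ^ 2) := by
  have hu' : MemLp (fracLapFourier (α / 2) (complexify u)) 2 (volume : Measure (E n)) := hu
  have h2 : ‖fracLap (α / 2) (complexify u)‖
      = ‖hu'.toLp (fracLapFourier (α / 2) (complexify u))‖ := by
    rw [fracLap, dif_pos hu', ← Lp.norm_fourier_eq, FourierTransform.fourier_fourierInv_eq]
  rw [h2, Lp.norm_toLp, ENNReal.ofReal_add (by positivity) (by positivity),
    ENNReal.ofReal_pow (by positivity), ENNReal.ofReal_pow (by positivity),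
    ENNReal.ofReal_toReal hu'.eLpNorm_ne_top, ofReal_norm]
  rfl

/-- `ψ ∈ L^r_loc(ℝ; L^r(ℝⁿ))`: the function `(t, x) ↦ ψ t x` is in `L^r` on every strip
`[a, b] × ℝⁿ`. -/
def LocMemLp {n : ℕ} (r : ℝ≥0∞) (ψ : ℝ → E n → ℝ) : Prop :=
  ∀ a b : ℝ, MemLp (fun z : ℝ × E n => ψ z.1 z.2) r
    ((volume.restrict (Icc a b)).prod (volume : Measure (E n)))

/-- The assumptions on the nonlinear drift `F`. -/
structure DriftAssumptions {n : ℕ} (p lam₁ lam₂ : ℝ) (ψ₁ ψ₂ ψ₃ ψ₄ : ℝ → E n → ℝ)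
    (F : ℝ → E n → ℝ → ℝ) : Prop where
  two_lt_p : 2 < p
  lam₁_pos : 0 < lam₁
  lam₂_pos : 0 < lam₂
  mem_ψ₁ : LocMemLp 1 ψ₁
  mem_ψ₂ : LocMemLp ∞ ψ₂
  mem_ψ₃ : LocMemLp (ENNReal.ofReal (p / (p - 1))) ψ₃
  mem_ψ₄ : LocMemLp ∞ ψ₄
  continuous_F : Continuous fun z : ℝ × E n × ℝ => F z.1 z.2.1 z.2.2
  dissipative : ∀ t x u, F t x u * u ≥ lam₁ * |u| ^ p - ψ₁ t x
  growth : ∀ t x u, |F t x u| ≤ ψ₂ t x * |u| ^ (p - 1) + ψ₃ t x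
  monotone : ∀ t x u₁ u₂, (F t x u₁ - F t x u₂) * (u₁ - u₂) ≥
    lam₂ * ((|u₁| ^ (p - 2) * u₁ - |u₂| ^ (p - 2) * u₂) * (u₁ - u₂)) - ψ₄ t x * |u₁ - u₂| ^ 2

/-- The assumptions on the diffusion coefficient `σ = σ₁ + κ σ₂`, where
`a k`, `b k`, `c k` are the constants `α_k`, `β_k`, `γ_k` of the growth conditions. -/
structure NoiseAssumptions {n : ℕ} (p q : ℝ) (κ : E n → ℝ) (σ₁ : ℝ → HSeq n)
    (σ₂ : ℕ → ℝ → E n → ℝ → ℝ) (a b c : ℕ → ℝ) : Prop where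
  two_le_q : 2 ≤ q
  q_le : q ≤ 1 + p / 2
  κ_mem_two : MemLp κ 2 (volume : Measure (E n))
  κ_mem_top : MemLp κ ∞ (volume : Measure (E n))
  mem_σ₁ : ∀ r s : ℝ, MemLp σ₁ ∞ (volume.restrict (Icc r s))
  measurable_σ₂ : ∀ k, Measurable fun z : ℝ × E n × ℝ => σ₂ k z.1 z.2.1 z.2.2
  a_pos : ∀ k, 0 < a k
  b_pos : ∀ k, 0 < b k
  c_pos : ∀ k, 0 < c k
  summable_abc : Summable fun k => a k + b k + c k
  lipschitz : ∀ k t x u₁ u₂, |σ₂ k t x u₁ - σ₂ k t x u₂| ^ 2 ≤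
    a k * (1 + |u₁| ^ (q - 2) + |u₂| ^ (q - 2)) * |u₁ - u₂| ^ 2
  growth : ∀ k t x u, |σ₂ k t x u| ^ 2 ≤ b k + c k * |u| ^ q

/-- The function `x ↦ (σ(t, u) w)(x) = ∑ₖ (σ_{1,k}(t, x) + κ(x) σ_{2,k}(t, x, u(x))) wₖ`
for `w ∈ l²`. -/
def diffusion {n : ℕ} (κ : E n → ℝ) (σ₁ : ℝ → HSeq n) (σ₂ : ℕ → ℝ → E n → ℝ → ℝ)
    (t : ℝ) (u : H n) (w : SeqL2) (x : E n) : ℝ :=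
  ∑' k : ℕ, ((σ₁ t x : SeqL2) k + κ x * σ₂ k t x (u x)) * w k

/-- `u` is a solution on `[0, T]` of the controlled equation
`du/dt + (-Δ)^α u + F(t, ·, u) = g + σ(t, u) v`, `u(0) = u₀`: it belongs to
`C([0,T], H) ∩ L²(0,T; V) ∩ L^p(0,T; L^p(ℝⁿ))`, and the integrated equation holds in
`(V ∩ L^p(ℝⁿ))*` for all `t ∈ [0, T]`, that is, when paired with any `ξ ∈ V ∩ L^p(ℝⁿ)`.

Only the values of `u` on `[0, T]` matter. No measurability of `u` into `V` and `L^p` has to be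
required: `V` and `L^p ∩ H` are separable, and continuity into `H` implies it. -/
structure IsSolution {n : ℕ} (α p T : ℝ) (F : ℝ → E n → ℝ → ℝ) (g : ℝ → H n)
    (κ : E n → ℝ) (σ₁ : ℝ → HSeq n) (σ₂ : ℕ → ℝ → E n → ℝ → ℝ)
    (u₀ : H n) (v : Control T) (u : ℝ → H n) : Prop where
  continuousOn : ContinuousOn u (Icc 0 T)
  ae_memV : ∀ᵐ t ∂(volume.restrict (Icc 0 T)), MemV α (u t)
  lintegral_V : ∫⁻ t in Icc 0 T, sqNormV α (u t) < ∞
  ae_memLp : ∀ᵐ t ∂(volume.restrict (Icc 0 T)),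
    MemLp (u t) (ENNReal.ofReal p) (volume : Measure (E n))
  lintegral_Lp : ∫⁻ t in Icc 0 T,
    (eLpNorm (u t) (ENNReal.ofReal p) (volume : Measure (E n))) ^ p < ∞
  equation : ∀ t ∈ Icc (0 : ℝ) T, ∀ ξ : H n, MemV α ξ →
    MemLp ξ (ENNReal.ofReal p) (volume : Measure (E n)) →
    inner ℝ (u t) ξ + (∫ s in (0 : ℝ)..t, fracForm α (u s) ξ)
        + (∫ s in (0 : ℝ)..t, ∫ x, F s x (u s x) * ξ x)
      = inner ℝ u₀ ξ + (∫ s in (0 : ℝ)..t, inner ℝ (g s) ξ)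
        + (∫ s in (0 : ℝ)..t, ∫ x, diffusion κ σ₁ σ₂ s (u s) (v s) x * ξ x)

/-- Strong convergence `uⱼ → u` in `C([0,T], H) ∩ L²(0,T; V) ∩ L^p(0,T; L^p(ℝⁿ))`. -/
structure StrongConvergence {n : ℕ} (α p T : ℝ) (uu : ℕ → ℝ → H n) (u : ℝ → H n) : Prop where
  uniform : TendstoUniformlyOn uu u atTop (Icc 0 T)
  in_V : Tendsto (fun j => ∫⁻ t in Icc 0 T, sqNormV α (uu j t - u t)) atTop (𝓝 0)
  in_Lp : Tendsto (fun j => ∫⁻ t in Icc 0 T,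
    (eLpNorm (uu j t - u t : H n) (ENNReal.ofReal p) (volume : Measure (E n))) ^ p) atTop (𝓝 0)

end FracRD

end

/-! Write `w = uⱼ - u`. In the equation for `w` the terms `g` and `u₀` cancel, and the energy
inequality bounds `‖w(t)‖²` plus the dissipation by the pairing of `w` with the noise difference,
which is split as `(σ(uⱼ) - σ(u)) vⱼ + σ(u) (vⱼ - v)`. Since `q ≤ p`, the Lipschitz weight of the
first part is dominated by `1 + |uⱼ|^{p-2} + |u|^{p-2}`. The strong monotonicity of the drift
therefore absorbs it, up to `C (1 + ‖vⱼ‖²) ‖w‖²` (`exists_inner_noise_sub_le`,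
`exists_basic_inequality`). This last term is harmless by Grönwall, because weakly convergent
controls are bounded. Everything is thereby reduced to the convergence of `Rⱼ(t) = ∫₀ᵗ (σ(u)(vⱼ -
v), uⱼ - u) ds` to zero, uniformly in `t` (`exists_stability`).

No compact embedding of `V` into `H` is used. The function `σ(u)` does not depend on `j` and lies in
`L²(0,T; L²(ℝⁿ; l²))`, so it is approximated by finite sums of products `1_A(s) 1_D(x) c`. Against
such a product the integral becomes `∫ 1_A (c, vⱼ - v) (1_D, uⱼ - u) ds`: a weakly null factor times
a bounded factor that is equicontinuous in time, uniformly in `j`. Such integrals tend to zero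
(`tendsto_integral_mul_equicont`, `tendsto_integral_inner_tensor`). Equicontinuity is read off from
the equation (`equicontSeq_inner_solution`); it relies on `q < p`, which makes `∫ ‖σ(uⱼ)‖² ds`
uniformly small on short intervals. The same estimate makes the `Rⱼ` equicontinuous, so pointwise
convergence in `t` becomes uniform.

The uniform bounds on the `uⱼ` come from the stability estimate itself, with `u` as the reference
solution (`exists_apriori_bound`).

The energy inequality is proved without time derivatives in a dual space: the increment `w(τ) - w(τ
- h)` is tested with `w(τ)`, integrated over `τ` and divided by `h`, and the limit `h → 0` uses
continuity of translations in `L^r` (`le_of_increment_le`, `energy_ineq`). This needs jointly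
measurable versions of `u` and of the Fourier side of `(-Δ)^{α/2} u`, which `Repr` provides. -/

noncomputable section

namespace FracRD

/-! ### Measurable families of `Lp` functions and jointly measurable functions -/

section Versions

variable {Ω X F : Type*} [MeasurableSpace Ω] [MeasurableSpace X] {μ : Measure X}
  [NormedAddCommGroup F] {p : ℝ≥0∞} [Fact (1 ≤ p)]

/-- A map into a separable metric space whose distances to all points are measurable is a
pointwise limit of measurable maps with values in a dense sequence. -/
theorem exists_measurable_index {Y : Type*} [PseudoMetricSpace Y] [TopologicalSpace.SeparableSpace Y] [Nonempty Y]
    {u : Ω → Y} (hu : ∀ c, Measurable fun s => dist (u s) c) {ε : ℝ} (hε : 0 < ε) :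
    ∃ N : Ω → ℕ, Measurable N ∧ ∀ s, dist (u s) (TopologicalSpace.denseSeq Y (N s)) < ε := by
  classical
  have hex : ∀ s, ∃ n, dist (u s) (TopologicalSpace.denseSeq Y n) < ε := fun s => by
    obtain ⟨n, hn⟩ := (TopologicalSpace.denseRange_denseSeq Y).exists_dist_lt (u s) hε
    exact ⟨n, hn⟩
  refine ⟨fun s => Nat.find (hex s), measurable_find hex fun k => ?_, fun s => Nat.find_spec (hex s)⟩
  exact measurableSet_lt (hu _) measurable_const

theorem stronglyMeasurable_of_measurable_dist {Y : Type*} [PseudoMetricSpace Y] [TopologicalSpace.SeparableSpace Y]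
    [Nonempty Y] {u : Ω → Y} (hu : ∀ c, Measurable fun s => dist (u s) c) :
    StronglyMeasurable u := by
  choose N hN hd using fun k : ℕ => exists_measurable_index hu (ε := 1 / ((k : ℝ) + 1)) (by positivity)
  refine stronglyMeasurable_of_tendsto (u := atTop) (f := fun k s => TopologicalSpace.denseSeq Y (N k s))
    (fun k => ?_) ?_
  · exact (StronglyMeasurable.of_discrete (f := TopologicalSpace.denseSeq Y)).comp_measurable (hN k)
  · rw [tendsto_pi_nhds]
    intro s
    rw [tendsto_iff_dist_tendsto_zero]
    refine squeeze_zero (fun _ => dist_nonneg) (fun k => ?_) tendsto_one_div_add_atTop_nhds_zero_nat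
    rw [dist_comm]; exact (hd k s).le

/-- A measurable family of elements of `Lp` has a jointly measurable version. -/
theorem exists_measurable_version [CompleteSpace F] [MeasurableSpace F] [BorelSpace F]
    [SecondCountableTopology F] [TopologicalSpace.SeparableSpace (Lp F p μ)]
    {u : Ω → Lp F p μ} (hu : StronglyMeasurable u) :
    ∃ U : Ω × X → F, Measurable U ∧ ∀ s, (fun x => U (s, x)) =ᵐ[μ] u s := by
  have hd : ∀ c, Measurable fun s => dist (u s) c := fun c =>
    (hu.dist stronglyMeasurable_const).measurable
  choose N hN hNd using fun k : ℕ => exists_measurable_index hd (ε := (1 / 4 : ℝ) ^ k) (by positivity)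
  -- Only countably many representatives occur, one for each member of the dense sequence, so joint
  -- measurability is automatic.
  let g : ℕ → Ω × X → F := fun k z => TopologicalSpace.denseSeq (Lp F p μ) (N k z.1) z.2
  have hg : ∀ k, Measurable (g k) := fun k => by
    have h1 : Measurable fun z : ℕ × X => TopologicalSpace.denseSeq (Lp F p μ) z.1 z.2 :=
      measurable_from_prod_countable_right fun n =>
        (Lp.stronglyMeasurable (TopologicalSpace.denseSeq (Lp F p μ) n)).measurable
    exact h1.comp (((hN k).comp measurable_fst).prodMk measurable_snd)
  refine ⟨fun z => limUnder atTop fun k => g k z,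
    (StronglyMeasurable.limUnder fun k => (hg k).stronglyMeasurable).measurable, fun s => ?_⟩
  have hlim : Tendsto (fun k => TopologicalSpace.denseSeq (Lp F p μ) (N k s)) atTop (𝓝 (u s)) := by
    rw [tendsto_iff_dist_tendsto_zero]
    refine squeeze_zero (fun _ => dist_nonneg) (fun k => ?_)
      (tendsto_pow_atTop_nhds_zero_of_lt_one (by norm_num : (0 : ℝ) ≤ 1 / 4) (by norm_num))
    rw [dist_comm]; exact (hNd k s).le
  -- The geometric rate gives a.e. convergence of the whole sequence, so one limit formula serves
  -- all `s`; a subsequence converging a.e. could depend on `s` and serves only to identify the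
  -- limit.
  have hae : ∀ᵐ x ∂μ, ∃ l : F, Tendsto (fun k => g k (s, x)) atTop (𝓝 l) := by
    refine Lp.ae_tendsto_of_cauchy_eLpNorm (p := p) (B := fun k => ENNReal.ofReal (3 * (1 / 4 : ℝ) ^ k))
      (fun k => (Lp.aestronglyMeasurable (TopologicalSpace.denseSeq (Lp F p μ) (N k s)))) Fact.out ?_ fun K n m hn hm => ?_
    · rw [← ENNReal.ofReal_tsum_of_nonneg (fun _ => by positivity)
        ((summable_geometric_of_lt_one (by norm_num) (by norm_num)).mul_left 3)]
      exact ENNReal.ofReal_ne_top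
    · have h1 : eLpNorm ((fun x => g n (s, x)) - fun x => g m (s, x)) p μ
          = edist (TopologicalSpace.denseSeq (Lp F p μ) (N n s)) (TopologicalSpace.denseSeq (Lp F p μ) (N m s)) := by
        rw [Lp.edist_def]
      rw [h1, edist_dist]
      refine ENNReal.ofReal_lt_ofReal_iff (by positivity) |>.2 ?_
      have a1 := hNd n s
      have a2 := hNd m s
      have b1 : (1 / 4 : ℝ) ^ n ≤ (1 / 4) ^ K := pow_le_pow_of_le_one (by norm_num) (by norm_num) hn
      have b2 : (1 / 4 : ℝ) ^ m ≤ (1 / 4) ^ K := pow_le_pow_of_le_one (by norm_num) (by norm_num) hm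
      have b3 : (0 : ℝ) < (1 / 4) ^ K := by positivity
      have := dist_triangle_left (TopologicalSpace.denseSeq (Lp F p μ) (N n s)) (TopologicalSpace.denseSeq (Lp F p μ) (N m s)) (u s)
      linarith
  obtain ⟨ns, hns, hae2⟩ := (tendstoInMeasure_of_tendsto_Lp hlim).exists_seq_tendsto_ae
  filter_upwards [hae, hae2] with x ⟨l, hl⟩ h2
  rw [hl.limUnder_eq]
  exact tendsto_nhds_unique (hl.comp hns.tendsto_atTop) h2

/-- A jointly measurable function with sections in `Lp` defines a measurable map into `Lp`. -/
theorem stronglyMeasurable_toLp [SFinite μ] [TopologicalSpace.SeparableSpace (Lp F p μ)]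
    (hp : p ≠ ∞) {f : Ω → X → F} (hf : StronglyMeasurable (Function.uncurry f)) (hfp : ∀ s, MemLp (f s) p μ) :
    StronglyMeasurable fun s => (hfp s).toLp (f s) := by
  have hp0 : p ≠ 0 := (zero_lt_one.trans_le (Fact.out : 1 ≤ p)).ne'
  refine stronglyMeasurable_of_measurable_dist fun c => ?_
  have h1 : ∀ s, dist ((hfp s).toLp (f s)) c
      = ((∫⁻ x, ‖f s x - c x‖ₑ ^ p.toReal ∂μ) ^ (1 / p.toReal)).toReal := fun s => by
    rw [Lp.dist_def, ← eLpNorm_eq_lintegral_rpow_enorm_toReal hp0 hp]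
    congr 1
    refine eLpNorm_congr_ae ?_
    filter_upwards [(hfp s).coeFn_toLp] with x hx
    simp [hx]
  simp_rw [h1]
  refine Measurable.ennreal_toReal (Measurable.pow_const ?_ _)
  refine Measurable.lintegral_prod_right' (f := fun z : Ω × X => ‖f z.1 z.2 - c z.2‖ₑ ^ p.toReal) ?_
  refine Measurable.pow_const (StronglyMeasurable.enorm ?_) _
  exact hf.sub ((Lp.stronglyMeasurable c).comp_measurable measurable_snd)

end Versions

/-- Needed to apply the version results to functions with values in `l²`: the countably many unit
sequences have dense span. -/
instance : TopologicalSpace.SeparableSpace SeqL2 := by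
  have h1 : TopologicalSpace.IsSeparable
      (Submodule.span ℝ (range fun k : ℕ => (lp.single 2 k (1 : ℝ) : SeqL2)) : Set SeqL2) :=
    ((countable_range _).isSeparable).span
  have h2 : Dense (Submodule.span ℝ (range fun k : ℕ => (lp.single 2 k (1 : ℝ) : SeqL2)) : Set SeqL2) := by
    intro f
    have hf := (lp.hasSum_single (p := 2) (by norm_num) f).tendsto_sum_nat
    refine mem_closure_of_tendsto hf (Eventually.of_forall fun N => ?_)
    refine Submodule.sum_mem _ fun k _ => ?_
    have : (lp.single 2 k (f k) : SeqL2) = f k • lp.single 2 k (1 : ℝ) := by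
      rw [← lp.single_smul]; simp
    rw [this]
    exact Submodule.smul_mem _ _ (Submodule.subset_span ⟨k, rfl⟩)
  have h3 := h1.closure
  rw [h2.closure_eq] at h3
  exact TopologicalSpace.isSeparable_univ_iff.1 h3

end FracRD

namespace FracRD

/-! ### Continuity of time translations in `Lp` -/

section Translation

variable {X 𝕜 : Type*} [NormedAddCommGroup X] [NormedSpace ℝ X] [FiniteDimensional ℝ X]
  [MeasureSpace X] [(volume : Measure X).IsAddHaarMeasure] [RCLike 𝕜]

theorem measurePreserving_translate (r : ℝ) :
    MeasurePreserving (fun z : ℝ × X => (z.1 - r, z.2)) := by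
  have := (measurePreserving_sub_right (volume : Measure ℝ) r).prod
    (MeasurePreserving.id (volume : Measure X))
  exact this

/-- Composition with a continuous family of measure-preserving maps is continuous in `Lp` for finite
exponents; stated for general `G` to cover translations of `ℝ` and of the first coordinate of `ℝ ×
X` at once. -/
theorem tendsto_eLpNorm_comp_sub {Y F : Type*} [TopologicalSpace Y] [R1Space Y] [MeasurableSpace Y]
    [BorelSpace Y] {μ : Measure Y} [IsLocallyFiniteMeasure μ] [μ.InnerRegularCompactLTTop]
    [NormedAddCommGroup F] {G : ℝ → C(Y, Y)} (hG : Continuous G)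
    (hμ : ∀ r, MeasurePreserving (G r) μ μ) (hG0 : ∀ y, G 0 y = y)
    {f : Y → F} {P : ℝ≥0∞} [Fact (1 ≤ P)] (hP : P ≠ ∞) (hf : MemLp f P μ) :
    Tendsto (fun r : ℝ => eLpNorm (fun z => f (G r z) - f z) P μ) (𝓝 0) (𝓝 0) := by
  have h1 : Continuous fun r => Lp.compMeasurePreserving (G r) (hμ r) (hf.toLp f) :=
    Continuous.compMeasurePreservingLp continuous_const hG hμ hP
  have h2 := h1.tendsto 0
  rw [tendsto_iff_edist_tendsto_0] at h2
  refine h2.congr fun r => ?_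
  rw [Lp.edist_def]
  refine eLpNorm_congr_ae ?_
  have e1 : ∀ r, Lp.compMeasurePreserving (G r) (hμ r) (hf.toLp f) =ᵐ[μ] fun z => f (G r z) :=
    fun r => (Lp.coeFn_compMeasurePreserving _ _).trans
      ((hμ r).quasiMeasurePreserving.ae_eq_comp hf.coeFn_toLp)
  filter_upwards [e1 r, e1 0] with z h1 h2
  simp only [Pi.sub_apply, h1, h2, hG0]

theorem tendsto_eLpNorm_translate_sub_real {F : Type*} [NormedAddCommGroup F]
    {f : ℝ → F} {P : ℝ≥0∞} [Fact (1 ≤ P)] (hP : P ≠ ∞) (hf : MemLp f P) :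
    Tendsto (fun r : ℝ => eLpNorm (fun s => f (s - r) - f s) P) (𝓝 0) (𝓝 0) := by
  let G : ℝ → C(ℝ, ℝ) := fun r => ⟨fun s => s - r, by fun_prop⟩
  refine tendsto_eLpNorm_comp_sub (G := G) (ContinuousMap.continuous_of_continuous_uncurry _ (by
    simp only [G, Function.uncurry_def, ContinuousMap.coe_mk]; fun_prop))
    (fun r => measurePreserving_sub_right volume r) (fun y => sub_zero y) hP hf

variable [BorelSpace X]

theorem tendsto_eLpNorm_translate_sub {f : ℝ × X → 𝕜} {P : ℝ≥0∞} [Fact (1 ≤ P)] (hP : P ≠ ∞)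
    (hf : MemLp f P) :
    Tendsto (fun r : ℝ => eLpNorm (fun z : ℝ × X => f (z.1 - r, z.2) - f z) P) (𝓝 0) (𝓝 0) := by
  let G : ℝ → C(ℝ × X, ℝ × X) := fun r => ⟨fun z => (z.1 - r, z.2), by fun_prop⟩
  refine tendsto_eLpNorm_comp_sub (G := G) (ContinuousMap.continuous_of_continuous_uncurry _ (by
    simp only [G, Function.uncurry_def, ContinuousMap.coe_mk]; fun_prop))
    (fun r => measurePreserving_translate r) (fun y => by simp [G]) hP hf

/-- Pairing a function with the time translates of another one: integrability, and continuity
with respect to the translation. -/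
theorem translation_pairing {f g : ℝ × X → 𝕜} {P Q : ℝ≥0∞} [Fact (1 ≤ P)] [P.HolderTriple Q 1]
    (hP : P ≠ ∞) (hfm : Measurable f) (hgm : Measurable g) (hf : MemLp f P) (hg : MemLp g Q)
    (A : Set ℝ) :
    Integrable (fun z : ℝ × ℝ => ∫ x, f (z.1 - z.2, x) * g (z.1, x))
      ((volume.restrict A).prod (volume.restrict (Icc (0 : ℝ) 1))) ∧
    (∀ r, IntegrableOn (fun τ => ∫ x, f (τ - r, x) * g (τ, x)) A) ∧
    Tendsto (fun r => ∫ τ in A, ∫ x, f (τ - r, x) * g (τ, x)) (𝓝 0)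
      (𝓝 (∫ τ in A, ∫ x, f (τ, x) * g (τ, x))) := by
  have hle : (volume.restrict A).prod (volume : Measure X) ≤ (volume : Measure (ℝ × X)) := by
    rw [Measure.volume_eq_prod]
    exact Measure.prod_mono Measure.restrict_le_self le_rfl
  have hfr : ∀ r, MemLp (fun z : ℝ × X => f (z.1 - r, z.2)) P := fun r =>
    hf.comp_measurePreserving (measurePreserving_translate r)
  have hint : ∀ r, Integrable (fun z : ℝ × X => f (z.1 - r, z.2) * g z)
      ((volume.restrict A).prod volume) := fun r =>
    (MemLp.integrable_mul (hfr r) hg).mono_measure hle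
  refine ⟨?_, fun r => (hint r).integral_prod_left, ?_⟩
  · refine ⟨?_, ?_⟩
    · refine StronglyMeasurable.aestronglyMeasurable ?_
      refine StronglyMeasurable.integral_prod_right
        (f := fun (z : ℝ × ℝ) (x : X) => f (z.1 - z.2, x) * g (z.1, x)) ?_
      refine Measurable.stronglyMeasurable ?_
      simp only [Function.uncurry_def]
      exact (hfm.comp (by fun_prop)).mul (hgm.comp (by fun_prop))
    · have hm : Measurable fun w : (ℝ × ℝ) × X => ‖f (w.1.1 - w.1.2, w.2) * g (w.1.1, w.2)‖ₑ :=
        ((hfm.comp (by fun_prop)).mul (hgm.comp (by fun_prop))).enorm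
      obtain ⟨C, hC⟩ : ∃ C, C = eLpNorm f P * eLpNorm g Q := ⟨_, rfl⟩
      have hfin : C < ∞ := hC ▸
        ENNReal.mul_lt_top hf.eLpNorm_lt_top hg.eLpNorm_lt_top
      -- Hölder, with a bound independent of `r` because translations preserve the norm of `f`;
      -- integrating it over `r` in `[0, 1]` gives joint integrability.
      have hbound : ∀ r, ∫⁻ τ in A, ∫⁻ x, ‖f (τ - r, x) * g (τ, x)‖ₑ
          ≤ C := fun r => by
        rw [hC, ← lintegral_prod (μ := volume.restrict A) (ν := (volume : Measure X))
          (fun z : ℝ × X => ‖f (z.1 - r, z.2) * g z‖ₑ) (by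
            exact ((hfm.comp (by fun_prop)).mul hgm).enorm.aemeasurable)]
        refine (lintegral_mono' hle le_rfl).trans ?_
        rw [← eLpNorm_one_eq_lintegral_enorm]
        refine (eLpNorm_smul_le_mul_eLpNorm (p := P) (q := Q) (r := 1) hg.1 (hfr r).1).trans ?_
        gcongr
        exact (eLpNorm_comp_measurePreserving hf.1 (measurePreserving_translate r)).le
      rw [hasFiniteIntegral_iff_enorm]
      calc ∫⁻ z, ‖∫ x, f (z.1 - z.2, x) * g (z.1, x)‖ₑ
            ∂((volume.restrict A).prod (volume.restrict (Icc (0 : ℝ) 1)))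
          ≤ ∫⁻ z, (∫⁻ x, ‖f (z.1 - z.2, x) * g (z.1, x)‖ₑ)
            ∂((volume.restrict A).prod (volume.restrict (Icc (0 : ℝ) 1))) :=
            lintegral_mono fun z => enorm_integral_le_lintegral_enorm _
        _ = ∫⁻ r in Icc (0 : ℝ) 1, ∫⁻ τ in A, ∫⁻ x, ‖f (τ - r, x) * g (τ, x)‖ₑ := by
            rw [lintegral_prod_symm]
            exact hm.lintegral_prod_right'.aemeasurable
        _ ≤ ∫⁻ _ in Icc (0 : ℝ) 1, C := by
            refine lintegral_mono ?_
            intro r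
            exact hbound r
        _ < ∞ := by
            rw [lintegral_const]
            exact ENNReal.mul_lt_top hfin (by simp)
  · have e : ∀ r, ∫ τ in A, ∫ x, f (τ - r, x) * g (τ, x)
        = ∫ z, f (z.1 - r, z.2) * g z ∂((volume.restrict A).prod volume) := fun r => by
      rw [integral_prod _ (hint r)]
    have e0 : ∫ τ in A, ∫ x, f (τ, x) * g (τ, x)
        = ∫ z, f (z.1 - 0, z.2) * g z ∂((volume.restrict A).prod volume) := by
      rw [← e 0]; simp
    rw [e0]
    simp_rw [e]
    rw [tendsto_iff_edist_tendsto_0]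
    have hT := ENNReal.Tendsto.mul_const (tendsto_eLpNorm_translate_sub hP hf)
      (Or.inr hg.eLpNorm_ne_top)
    rw [zero_mul] at hT
    refine tendsto_of_tendsto_of_tendsto_of_le_of_le tendsto_const_nhds hT (fun _ => bot_le)
      fun r => ?_
    simp only [edist_eq_enorm_sub]
    rw [← integral_sub (hint r) (hint 0)]
    refine (enorm_integral_le_lintegral_enorm _).trans ((lintegral_mono' hle le_rfl).trans ?_)
    have e2 : (fun z : ℝ × X => f (z.1 - r, z.2) * g z - f (z.1 - 0, z.2) * g z)
        = (fun z : ℝ × X => f (z.1 - r, z.2) - f z) • g := by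
      funext z; simp [sub_mul]
    rw [← eLpNorm_one_eq_lintegral_enorm, e2]
    exact eLpNorm_smul_le_mul_eLpNorm (p := P) (q := Q) (r := 1) hg.1 ((hfr r).1.sub hf.1)

end Translation

/-! ### From increments to an integrated inequality; Grönwall -/

/-- Integrating an increment inequality `φ τ - φ (τ - h) ≤ 2 ∫₀ʰ K(τ, r) dr` in `τ` and letting
`h → 0`. -/
theorem le_of_increment_le {φ : ℝ → ℝ} {K : ℝ → ℝ → ℝ} {t J₀ : ℝ} (ht : 0 ≤ t)
    (hφ : Continuous φ) (hφ0 : ∀ s ≤ 0, φ s = 0)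
    (hK : Integrable (Function.uncurry K)
      ((volume.restrict (Icc 0 t)).prod (volume.restrict (Icc 0 1))))
    (hJ : Tendsto (fun r => ∫ τ in Icc 0 t, K τ r) (𝓝[>] 0) (𝓝 J₀))
    (hinc : ∀ h ∈ Ioc (0 : ℝ) 1, ∀ᵐ τ ∂(volume.restrict (Icc 0 t)),
      φ τ - φ (τ - h) ≤ 2 * ∫ r in (0 : ℝ)..h, K τ r) :
    φ t ≤ 2 * J₀ := by
  have key : ∀ ε > 0, φ t - ε ≤ 2 * (J₀ + ε) := by
    intro ε hε
    have h1 : ∀ᶠ r in 𝓝[>] (0 : ℝ), ∫ τ in Icc 0 t, K τ r < J₀ + ε :=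
      hJ.eventually_lt_const (by linarith)
    obtain ⟨h₁, hh₁, hh₁'⟩ := mem_nhdsGT_iff_exists_Ioo_subset.1 h1
    obtain ⟨h₂, hh₂, hh₂'⟩ := Metric.continuousAt_iff.1 (hφ.continuousAt (x := t)) ε hε
    have hh₁0 : (0 : ℝ) < h₁ := hh₁
    set h := min (min (h₁ / 2) (h₂ / 2)) 1 with hh
    have hpos : 0 < h := by positivity
    have hle1 : h ≤ 1 := min_le_right _ _
    have hlt1 : h < h₁ := lt_of_le_of_lt ((min_le_left _ _).trans (min_le_left _ _)) (by linarith)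
    have hlt2 : h < h₂ := lt_of_le_of_lt ((min_le_left _ _).trans (min_le_right _ _)) (by linarith)
    have hKh : Integrable (Function.uncurry K)
        ((volume.restrict (Icc 0 t)).prod (volume.restrict (Ioc 0 h))) :=
      hK.mono_measure (Measure.prod_mono le_rfl
        (Measure.restrict_mono (show Ioc 0 h ⊆ Icc 0 1 from fun x hx => ⟨hx.1.le, hx.2.trans hle1⟩) le_rfl))
    have hI := hKh.integral_prod_left
    have hφi : ∀ a b, IntervalIntegrable φ volume a b := fun a b => hφ.intervalIntegrable a b
    have hφs : IntervalIntegrable (fun τ => φ (τ - h)) volume 0 t :=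
      (hφ.comp (continuous_sub_right h)).intervalIntegrable _ _
    -- The integral telescopes to two end intervals of length `h`, and the one at the origin
    -- vanishes because `φ` is zero at nonpositive times.
    have e1 : ∫ τ in Icc 0 t, (φ τ - φ (τ - h)) = ∫ s in (t - h)..t, φ s := by
      rw [integral_Icc_eq_integral_Ioc, ← intervalIntegral.integral_of_le ht,
        intervalIntegral.integral_sub (hφi _ _) hφs,
        intervalIntegral.integral_comp_sub_right]
      have z : ∫ s in (0 - h)..0, φ s = 0 := by
        rw [intervalIntegral.integral_congr (g := fun _ => (0 : ℝ))]
        · simp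
        · intro s hs
          rw [uIcc_of_le (by linarith)] at hs
          exact hφ0 s hs.2
      have a1 := intervalIntegral.integral_add_adjacent_intervals (hφi (0 - h) 0) (hφi 0 t)
      have a2 := intervalIntegral.integral_add_adjacent_intervals (hφi (0 - h) (t - h)) (hφi (t - h) t)
      linarith
    have e2 : h * (φ t - ε) ≤ ∫ s in (t - h)..t, φ s := by
      have : ∫ s in (t - h)..t, (φ t - ε) = h * (φ t - ε) := by simp [mul_sub]
      rw [← this]
      refine intervalIntegral.integral_mono_on (by linarith) (by simp) (hφi _ _) fun s hs => ?_
      have := hh₂' (x := s) (by rw [Real.dist_eq, abs_lt]; constructor <;> linarith [hs.1, hs.2])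
      rw [Real.dist_eq, abs_lt] at this
      linarith [this.1]
    have e3 : ∫ τ in Icc 0 t, (φ τ - φ (τ - h))
        ≤ ∫ τ in Icc 0 t, 2 * ∫ r in Ioc 0 h, K τ r := by
      refine integral_mono_ae ?_ (hI.const_mul 2) ?_
      · exact ((hφ.sub (hφ.comp (continuous_sub_right h))).continuousOn).integrableOn_compact
          isCompact_Icc
      · filter_upwards [hinc h ⟨hpos, hle1⟩] with τ hτ
        rw [intervalIntegral.integral_of_le hpos.le] at hτ
        exact hτ
    -- After Fubini the inner integral over `τ` is close to `J₀` for every `r < h`; both sides then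
    -- carry a factor `h`, which cancels.
    have e4 : ∫ τ in Icc 0 t, 2 * ∫ r in Ioc 0 h, K τ r
        = 2 * ∫ r in Ioc 0 h, ∫ τ in Icc 0 t, K τ r := by
      rw [integral_const_mul, integral_integral_swap hKh]
    have e5 : ∫ r in Ioc 0 h, ∫ τ in Icc 0 t, K τ r ≤ ∫ r in Ioc 0 h, (J₀ + ε) := by
      refine setIntegral_mono_on hKh.integral_prod_right (by simp) measurableSet_Ioc fun r hr => ?_
      exact le_of_lt (hh₁' (show r ∈ Ioo 0 h₁ from ⟨hr.1, hr.2.trans_lt hlt1⟩))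
    have e6 : ∫ r in Ioc 0 h, (J₀ + ε) = h * (J₀ + ε) := by
      simp [hpos.le]
    have : h * (φ t - ε) ≤ h * (2 * (J₀ + ε)) := by linarith
    exact le_of_mul_le_mul_left this hpos
  refine le_of_forall_pos_le_add fun ε hε => ?_
  have := key (ε / 3) (by positivity)
  linarith

/-- Grönwall's inequality with an integrable coefficient; the constant depends only on the
integral of the coefficient. -/
theorem gronwall_induction {T : ℝ} {φ b : ℝ → ℝ} {ρ : ℝ} (hρ : 0 ≤ ρ)
    (hφ : ContinuousOn φ (Icc 0 T)) (hφ0 : ∀ t ∈ Icc 0 T, 0 ≤ φ t)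
    (hb : IntegrableOn b (Icc 0 T)) (hb0 : ∀ t, 0 ≤ b t)
    (h : ∀ t ∈ Icc 0 T, φ t ≤ ρ + ∫ s in Icc 0 t, b s * φ s) (k : ℕ) :
    ∀ t ∈ Icc 0 T, ∫ s in Icc 0 t, b s ≤ k / 2 → φ t ≤ (2 * (k + 1)) ^ k * ρ := by
  have hsub : ∀ t ∈ Icc 0 T, Icc 0 t ⊆ Icc 0 T := fun t ht => Icc_subset_Icc_right ht.2
  have hbφ : IntegrableOn (fun s => b s * φ s) (Icc 0 T) :=
    hb.mul_continuousOn hφ isCompact_Icc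
  have hmono : ∀ s t, s ∈ Icc 0 T → t ∈ Icc 0 T → s ≤ t →
      ∫ r in Icc 0 s, b r ≤ ∫ r in Icc 0 t, b r := fun s t hs ht hst =>
    setIntegral_mono_set (hb.mono_set (hsub t ht)) (Eventually.of_forall hb0)
      (Icc_subset_Icc_right hst).eventuallyLE
  induction k with
  | zero =>
    intro t ht hB
    have hz : ∫ s in Icc 0 t, b s = 0 :=
      le_antisymm (by simpa using hB) (integral_nonneg hb0)
    have hz' := (setIntegral_eq_zero_iff_of_nonneg_ae (Eventually.of_forall hb0)
      (hb.mono_set (hsub t ht))).1 hz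
    have : ∫ s in Icc 0 t, b s * φ s = 0 := by
      rw [integral_eq_zero_of_ae]
      filter_upwards [hz'] with s hs
      simp [hs]
    have := h t ht
    simp; linarith
  | succ k ih =>
    intro t ht hB
    -- At a maximum point `t₀` the final stretch `(τ, t₀]`, on which `b` has mass at most `1/2`,
    -- contributes at most `φ t₀ / 2` and is absorbed; on `[0, τ]` the induction hypothesis applies.
    obtain ⟨t₀, ht₀, hmax⟩ := (isCompact_Icc (a := (0 : ℝ)) (b := t)).exists_isMaxOn
      (nonempty_Icc.2 ht.1) (hφ.mono (hsub t ht))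
    have ht₀' : t₀ ∈ Icc 0 T := hsub t ht ht₀
    have hB₀ : ∫ s in Icc 0 t₀, b s ≤ (k + 1) / 2 :=
      (hmono t₀ t ht₀' ht ht₀.2).trans (by exact_mod_cast hB)
    set C : ℝ := (2 * (k + 1)) ^ k * ρ with hC
    have hC0 : 0 ≤ C := by positivity
    set B : ℝ → ℝ := fun s => ∫ r in Icc 0 s, b r with hBdef
    have hBcont : ContinuousOn B (Icc 0 T) := by
      have := intervalIntegral.continuousOn_primitive_Icc (μ := volume) (f := b) (a := 0) (b := T)
        hb
      exact this
    have hbt := hb.mono_set (hsub t₀ ht₀')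
    -- the last time at which the primitive of `b` is at most `k / 2`
    have hex : ∃ τ ∈ Icc 0 t₀, B τ ≤ k / 2 ∧ B t₀ - B τ ≤ 1 / 2 := by
      by_cases hc : B t₀ ≤ k / 2
      · exact ⟨t₀, ⟨ht₀.1, le_rfl⟩, hc, by norm_num⟩
      · have hB0 : B 0 = 0 := by simp [hBdef]
        have hmem : (k / 2 : ℝ) ∈ Icc (B 0) (B t₀) := ⟨by rw [hB0]; positivity, (not_le.1 hc).le⟩
        obtain ⟨τ, hτ, hτ'⟩ := intermediate_value_Icc ht₀.1 (hBcont.mono (hsub t₀ ht₀')) hmem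
        refine ⟨τ, hτ, hτ'.le, ?_⟩
        rw [hτ']
        have : B t₀ ≤ (k + 1) / 2 := hB₀
        linarith
    obtain ⟨τ, hτ, hτ1, hτ2⟩ := hex
    have hsplit : ∀ f : ℝ → ℝ, IntegrableOn f (Icc 0 t₀) →
        ∫ s in Icc 0 t₀, f s = (∫ s in Icc 0 τ, f s) + ∫ s in Ioc τ t₀, f s := fun f hf => by
      rw [← setIntegral_union _ measurableSet_Ioc
        (hf.mono_set (Icc_subset_Icc_right hτ.2))
        (hf.mono_set fun x hx => ⟨hτ.1.trans hx.1.le, hx.2⟩),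
        Icc_union_Ioc_eq_Icc hτ.1 hτ.2]
      exact Set.disjoint_left.2 fun x hx hx' => absurd hx.2 (not_le.2 hx'.1)
    have hbφt := hbφ.mono_set (hsub t₀ ht₀')
    have i1 : ∫ s in Icc 0 τ, b s * φ s ≤ ∫ s in Icc 0 τ, b s * C := by
      refine setIntegral_mono_on (hbφt.mono_set (Icc_subset_Icc_right hτ.2))
        ((hbt.mono_set (Icc_subset_Icc_right hτ.2)).mul_const _) measurableSet_Icc fun s hs => ?_
      have hs' : s ∈ Icc 0 T := hsub t₀ ht₀' ⟨hs.1, hs.2.trans hτ.2⟩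
      exact mul_le_mul_of_nonneg_left (ih s hs'
        ((hmono s τ hs' (hsub t₀ ht₀' hτ) hs.2).trans hτ1)) (hb0 s)
    have i2 : ∫ s in Ioc τ t₀, b s * φ s ≤ ∫ s in Ioc τ t₀, b s * φ t₀ := by
      have hss : Ioc τ t₀ ⊆ Icc 0 t₀ := fun x hx => ⟨hτ.1.trans hx.1.le, hx.2⟩
      refine setIntegral_mono_on (hbφt.mono_set hss) ((hbt.mono_set hss).mul_const _)
        measurableSet_Ioc fun s hs => ?_
      exact mul_le_mul_of_nonneg_left (hmax ⟨(hss hs).1, hs.2.trans ht₀.2⟩) (hb0 s)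
    rw [integral_mul_const] at i1 i2
    have hs1 := hsplit _ hbφt
    have hs2 := hsplit _ hbt
    have hM := h t₀ ht₀'
    have hφt₀ := hφ0 t₀ ht₀'
    have hBτ : B τ = ∫ s in Icc 0 τ, b s := rfl
    have hBt : B t₀ = ∫ s in Icc 0 t₀, b s := rfl
    have j1 : (∫ s in Icc 0 τ, b s) * C ≤ k / 2 * C := by gcongr
    have j2 : (∫ s in Ioc τ t₀, b s) * φ t₀ ≤ 1 / 2 * φ t₀ := by
      refine mul_le_mul_of_nonneg_right ?_ hφt₀
      linarith
    have hfin : φ t₀ ≤ 2 * ρ + k * C := by linarith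
    have hpow : ρ ≤ C ∨ k = 0 := by
      by_cases hk : k = 0
      · exact Or.inr hk
      · left
        have : (1 : ℝ) ≤ (2 * (k + 1)) ^ k := one_le_pow₀ (by have : (0 : ℝ) ≤ k := k.cast_nonneg
                                                              linarith)
        nlinarith
    have hρC : ρ ≤ C := by
      rcases hpow with h | h
      · exact h
      · simp [hC, h]
    have hk0 : (0 : ℝ) ≤ k := k.cast_nonneg
    have hlast : (2 * ((k : ℝ) + 1)) * C ≤ (2 * ((k + 1 : ℕ) + 1)) ^ (k + 1) * ρ := by
      have : (2 * ((k : ℝ) + 1)) * C = (2 * (k + 1)) ^ (k + 1) * ρ := by rw [hC]; ring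
      rw [this]
      push_cast
      gcongr
      linarith
    calc φ t ≤ φ t₀ := hmax ⟨ht.1, le_rfl⟩
      _ ≤ 2 * ρ + k * C := hfin
      _ ≤ 2 * (k + 1) * C := by nlinarith
      _ ≤ _ := hlast

theorem gronwall_integrable {T B : ℝ} : ∃ C : ℝ, 0 ≤ C ∧ ∀ (φ b : ℝ → ℝ) (ρ : ℝ), 0 ≤ ρ →
    ContinuousOn φ (Icc 0 T) → (∀ t ∈ Icc 0 T, 0 ≤ φ t) → IntegrableOn b (Icc 0 T) →
    (∀ t, 0 ≤ b t) → ∫ s in Icc 0 T, b s ≤ B →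
    (∀ t ∈ Icc 0 T, φ t ≤ ρ + ∫ s in Icc 0 t, b s * φ s) → ∀ t ∈ Icc 0 T, φ t ≤ C * ρ := by
  obtain ⟨k, hk⟩ := exists_nat_ge (2 * B)
  refine ⟨(2 * (k + 1)) ^ k, by positivity, fun φ b ρ hρ hφ hφ0 hb hb0 hB h t ht => ?_⟩
  refine gronwall_induction hρ hφ hφ0 hb hb0 h k t ht ?_
  have := setIntegral_mono_set hb (Eventually.of_forall hb0)
    (Icc_subset_Icc_right ht.2 : Icc 0 t ⊆ Icc 0 T).eventuallyLE
  linarith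

end FracRD

namespace FracRD

/-! ### Scalar inequalities for powers -/

section Scalar

/-- Strong monotonicity of `u ↦ |u|^{p-2} u`. -/
theorem rpow_mul_self_monotone {p : ℝ} (hp : 2 < p) (a b : ℝ) :
    1 / 2 * ((|a| ^ (p - 2) + |b| ^ (p - 2)) * |a - b| ^ 2)
      ≤ (|a| ^ (p - 2) * a - |b| ^ (p - 2) * b) * (a - b) := by
  -- The right-hand side of the goal exceeds the left by exactly half of this product, whose two
  -- factors have the same sign.
  have hmono : 0 ≤ (|a| ^ (p - 2) - |b| ^ (p - 2)) * (|a| ^ 2 - |b| ^ 2) := by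
    rcases le_total |a| |b| with h | h
    · have h1 : |a| ^ (p - 2) ≤ |b| ^ (p - 2) := Real.rpow_le_rpow (abs_nonneg _) h (by linarith)
      have h2 : |a| ^ 2 ≤ |b| ^ 2 := by gcongr
      nlinarith
    · have h1 : |b| ^ (p - 2) ≤ |a| ^ (p - 2) := Real.rpow_le_rpow (abs_nonneg _) h (by linarith)
      have h2 : |b| ^ 2 ≤ |a| ^ 2 := by gcongr
      nlinarith
  rw [sq_abs] at *
  rw [sq_abs] at hmono
  nlinarith

/-- Split according to `|u| ≥ N` or `|u| ≤ N`. When `q < p` the coefficient of `|u|^p` tends to zero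
as `N → ∞`, which later gives uniform integrability of the noise in time. -/
theorem abs_rpow_le_rpow_add_sq {p q N : ℝ} (hq : 2 ≤ q) (hqp : q ≤ p) (hN : 0 < N) (u : ℝ) :
    |u| ^ q ≤ N ^ (q - p) * |u| ^ p + N ^ (q - 2) * |u| ^ 2 := by
  rcases eq_or_lt_of_le (abs_nonneg u) with h0 | h0
  · rw [← h0, Real.zero_rpow (by linarith), Real.zero_rpow (by linarith)]; simp
  rcases le_total N |u| with h | h
  · have h1 : |u| ^ q = |u| ^ (q - p) * |u| ^ p := by rw [← Real.rpow_add h0]; ring_nf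
    have h2 : |u| ^ (q - p) ≤ N ^ (q - p) :=
      Real.rpow_le_rpow_of_nonpos hN h (by linarith)
    have h3 : 0 ≤ N ^ (q - 2) * |u| ^ 2 := by positivity
    have h4 : |u| ^ (q - p) * |u| ^ p ≤ N ^ (q - p) * |u| ^ p := by gcongr
    linarith
  · have h1 : |u| ^ q = |u| ^ (q - 2) * |u| ^ 2 := by
      rw [← Real.rpow_natCast, ← Real.rpow_add h0]; norm_num
    have h2 : |u| ^ (q - 2) ≤ N ^ (q - 2) := Real.rpow_le_rpow h0.le h (by linarith)
    have h3 : 0 ≤ N ^ (q - p) * |u| ^ p := by positivity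
    have h4 : |u| ^ (q - 2) * |u| ^ 2 ≤ N ^ (q - 2) * |u| ^ 2 := by gcongr
    linarith

theorem rpow_le_one_add_rpow {r s x : ℝ} (hx : 0 ≤ x) (hr : 0 ≤ r) (hrs : r ≤ s) :
    x ^ r ≤ 1 + x ^ s := by
  rcases le_total x 1 with h | h
  · have := Real.rpow_le_one hx h hr
    have := Real.rpow_nonneg hx s
    linarith
  · have := Real.rpow_le_rpow_of_exponent_le h hrs
    linarith

theorem abs_sub_rpow_le {r : ℝ} (hr : 0 ≤ r) (a b : ℝ) :
    |a - b| ^ r ≤ 2 ^ r * (|a| ^ r + |b| ^ r) := by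
  have h0 := abs_sub a b
  have ha := Real.rpow_nonneg (abs_nonneg a) r
  have hb := Real.rpow_nonneg (abs_nonneg b) r
  rcases le_total |a| |b| with h | h
  · calc |a - b| ^ r ≤ (2 * |b|) ^ r :=
          Real.rpow_le_rpow (abs_nonneg _) (by linarith) hr
      _ = 2 ^ r * |b| ^ r := Real.mul_rpow (by norm_num) (abs_nonneg _)
      _ ≤ _ := by gcongr; linarith
  · calc |a - b| ^ r ≤ (2 * |a|) ^ r :=
          Real.rpow_le_rpow (abs_nonneg _) (by linarith) hr
      _ = 2 ^ r * |a| ^ r := Real.mul_rpow (by norm_num) (abs_nonneg _)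
      _ ≤ _ := by gcongr; linarith

theorem abs_rpow_eq_mul_sq {p : ℝ} (hp : 2 < p) (a : ℝ) : |a| ^ p = |a| ^ (p - 2) * |a| ^ 2 := by
  rcases eq_or_lt_of_le (abs_nonneg a) with h0 | h0
  · rw [← h0, Real.zero_rpow (by linarith)]; simp
  · rw [← Real.rpow_natCast, ← Real.rpow_add h0]; norm_num

/-- The weighted quadratic expression produced by monotonicity controls the `L^p` distance;
`weight_le` conversely makes its integral finite for `L^p` functions. -/
theorem abs_sub_rpow_le_weight {p : ℝ} (hp : 2 < p) (a b : ℝ) :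
    |a - b| ^ p ≤ 2 ^ (p - 2) * ((|a| ^ (p - 2) + |b| ^ (p - 2)) * |a - b| ^ 2) := by
  rw [abs_rpow_eq_mul_sq hp, ← mul_assoc]
  have := abs_sub_rpow_le (r := p - 2) (by linarith) a b
  gcongr

theorem weight_le {p : ℝ} (hp : 2 < p) (a b : ℝ) :
    (|a| ^ (p - 2) + |b| ^ (p - 2)) * |a - b| ^ 2 ≤ 8 * (|a| ^ p + |b| ^ p) := by
  have h0 := abs_sub a b
  have ha := Real.rpow_nonneg (abs_nonneg a) p
  have hb := Real.rpow_nonneg (abs_nonneg b) p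
  have key : ∀ x y : ℝ, |x| ≤ |y| → |x - y| ≤ |x| + |y| →
      (|x| ^ (p - 2) + |y| ^ (p - 2)) * |x - y| ^ 2 ≤ 8 * |y| ^ p := fun x y h h' => by
    rw [abs_rpow_eq_mul_sq hp y]
    have h1 : |x| ^ (p - 2) ≤ |y| ^ (p - 2) := Real.rpow_le_rpow (abs_nonneg _) h (by linarith)
    have h2 : |x - y| ^ 2 ≤ (2 * |y|) ^ 2 := by
      have : |x - y| ≤ 2 * |y| := by linarith
      gcongr
    have h3 := Real.rpow_nonneg (abs_nonneg y) (p - 2)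
    calc (|x| ^ (p - 2) + |y| ^ (p - 2)) * |x - y| ^ 2
        ≤ (|y| ^ (p - 2) + |y| ^ (p - 2)) * (2 * |y|) ^ 2 := by gcongr
      _ = _ := by ring
  rcases le_total |a| |b| with h | h
  · have := key a b h h0
    linarith
  · have := key b a h (abs_sub b a)
    rw [abs_sub_comm b a] at this
    linarith

/-- Young's inequality with a parameter. -/
theorem abs_mul_le_rpow {p q δ : ℝ} (hpq : p.HolderConjugate q) (hδ : 0 < δ) (x y : ℝ) :
    |x * y| ≤ δ ^ p * |x| ^ p + δ⁻¹ ^ q * |y| ^ q := by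
  have h := Real.young_inequality (δ * |x|) (δ⁻¹ * |y|) hpq
  have e : δ * |x| * (δ⁻¹ * |y|) = |x * y| := by rw [abs_mul]; field_simp
  rw [e, abs_of_nonneg (show 0 ≤ δ * |x| by positivity),
    abs_of_nonneg (show 0 ≤ δ⁻¹ * |y| by positivity),
    Real.mul_rpow hδ.le (abs_nonneg _), Real.mul_rpow (by positivity) (abs_nonneg _)] at h
  refine h.trans (add_le_add (div_le_self (by positivity) hpq.lt.le)
    (div_le_self (by positivity) hpq.symm.lt.le))

end Scalar

/-- Weakly convergent sequences are bounded. -/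
theorem exists_norm_le_of_weak {Y : Type*} [NormedAddCommGroup Y] [NormedSpace ℝ Y]
    {x : ℕ → Y} {x₀ : Y} (h : ∀ φ : Y →L[ℝ] ℝ, Tendsto (fun j => φ (x j)) atTop (𝓝 (φ x₀))) :
    ∃ M : ℝ, 0 ≤ M ∧ ∀ j, ‖x j‖ ≤ M := by
  -- Uniform boundedness in the bidual, into which `Y` embeds isometrically; completeness is needed
  -- only for the dual, so `Y` itself need not be complete.
  obtain ⟨C, hC⟩ := banach_steinhaus
    (g := fun j => (NormedSpace.inclusionInDoubleDualLi ℝ (x j) : (Y →L[ℝ] ℝ) →L[ℝ] ℝ)) (by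
      intro φ
      obtain ⟨C, hC⟩ := (h φ).norm.bddAbove_range
      exact ⟨C, fun j => hC ⟨j, rfl⟩⟩)
  have hC' : ∀ j, ‖x j‖ ≤ C := fun j => by
    have := hC j
    rwa [LinearIsometry.norm_map] at this
  exact ⟨C, (norm_nonneg _).trans (hC' 0), hC'⟩

/-! ### The space `V` on the Fourier side -/

section Fourier

variable {n : ℕ}

/-- The symbol of `(-Δ)^s`. -/
def symbol (n : ℕ) (s : ℝ) (ξ : E n) : ℝ := (2 * Real.pi * ‖ξ‖) ^ (2 * s)

theorem measurable_symbol (s : ℝ) : Measurable (symbol n s) :=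
  Measurable.pow_const (by fun_prop) _

theorem aestronglyMeasurable_fracLapFourier (s : ℝ) (f : HC n) :
    AEStronglyMeasurable (fracLapFourier s f) volume :=
  (Complex.measurable_ofReal.comp (measurable_symbol s)).aestronglyMeasurable.mul
    (Lp.aestronglyMeasurable _)

theorem complexify_sub (u w : H n) : complexify (u - w) = complexify u - complexify w :=
  map_sub (Complex.ofRealCLM.compLpL (p := 2) (μ := (volume : Measure (E n)))) u w

theorem continuous_complexify : Continuous (complexify : H n → HC n) :=
  (Complex.ofRealCLM.compLpL (p := 2) (μ := (volume : Measure (E n)))).continuous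

theorem fracLapFourier_sub (s : ℝ) (u w : H n) :
    fracLapFourier s (complexify (u - w)) =ᵐ[volume]
      fun ξ => fracLapFourier s (complexify u) ξ - fracLapFourier s (complexify w) ξ := by
  have h : (𝓕 (complexify (u - w)) : HC n) = 𝓕 (complexify u) - 𝓕 (complexify w) := by
    rw [complexify_sub]
    exact map_sub (Lp.fourierTransformₗᵢ (E n) ℂ) _ _
  have h2 := Lp.coeFn_sub (𝓕 (complexify u) : HC n) (𝓕 (complexify w))
  rw [← h] at h2
  filter_upwards [h2] with ξ hξ
  simp only [fracLapFourier, hξ, Pi.sub_apply, mul_sub]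

theorem memV_sub {α : ℝ} {u w : H n} (hu : MemV α u) (hw : MemV α w) : MemV α (u - w) :=
  (MemLp.sub hu hw).ae_eq (fracLapFourier_sub (α / 2) u w).symm

/-- Plancherel. The form is thereby a pairing of measurable functions of the frequency, so the
energy argument never has to invert the Fourier transform. -/
theorem fracForm_eq {α : ℝ} {u w : H n} (hu : MemV α u) (hw : MemV α w) :
    fracForm α u w = (∫ ξ, starRingEnd ℂ (fracLapFourier (α / 2) (complexify u) ξ)
      * fracLapFourier (α / 2) (complexify w) ξ).re := by
  have hu' : MemLp (fracLapFourier (α / 2) (complexify u)) 2 (volume : Measure (E n)) := hu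
  have hw' : MemLp (fracLapFourier (α / 2) (complexify w)) 2 (volume : Measure (E n)) := hw
  have h1 : inner ℂ (fracLap (α / 2) (complexify u)) (fracLap (α / 2) (complexify w))
      = inner ℂ (hu'.toLp _) (hw'.toLp _) := by
    rw [fracLap, dif_pos hu', fracLap, dif_pos hw', ← Lp.inner_fourier_eq,
      FourierTransform.fourier_fourierInv_eq, FourierTransform.fourier_fourierInv_eq]
  rw [fracForm, h1, L2.inner_def]
  congr 1
  refine integral_congr_ae ?_
  filter_upwards [hu'.coeFn_toLp, hw'.coeFn_toLp] with ξ h1 h2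
  rw [h1, h2, RCLike.inner_apply, mul_comm]

/-- The symbol `(2π|ξ|)^α` is not smooth at the origin, so it is only compared with the polynomial
`1 + |ξ|²`, multiplication by which preserves Schwartz functions. -/
theorem memV_toLp_schwartz {α : ℝ} (hα : α ∈ Ioo (0 : ℝ) 1) (f : SchwartzMap (E n) ℝ) :
    MemV α (f.toLp 2 : H n) := by
  let fc : SchwartzMap (E n) ℂ := SchwartzMap.postcompCLM (𝕜 := ℝ) Complex.ofRealCLM f
  have h1 : complexify (f.toLp 2 : H n) = fc.toLp 2 := by
    refine Lp.ext ?_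
    refine (Complex.ofRealCLM.coeFn_compLp' _).trans ?_
    filter_upwards [f.coeFn_toLp 2, fc.coeFn_toLp 2] with x h1 h2
    rw [h1, h2]; rfl
  unfold MemV
  rw [h1]
  have h2 := (𝓕 fc).coeFn_toLp 2
  have hg : Function.HasTemperateGrowth (fun ξ : E n => 1 + ‖ξ‖ ^ 2) :=
    (Function.HasTemperateGrowth.const 1).add (Function.hasTemperateGrowth_norm_sq _)
  let G : SchwartzMap (E n) ℂ := SchwartzMap.smulLeftCLM ℂ (fun ξ : E n => 1 + ‖ξ‖ ^ 2) (𝓕 fc)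
  refine MemLp.of_le_mul (c := 1 + 2 * Real.pi) (G.memLp 2)
    (aestronglyMeasurable_fracLapFourier _ _) ?_
  rw [← SchwartzMap.toLp_fourier_eq] at h2
  filter_upwards [h2] with ξ hξ
  rw [SchwartzMap.smulLeftCLM_apply_apply hg, norm_smul]
  simp only [fracLapFourier, hξ, norm_mul, Complex.norm_real]
  rw [← mul_assoc]
  refine mul_le_mul_of_nonneg_right ?_ (norm_nonneg _)
  have hpi := Real.pi_pos
  have hx : 0 ≤ 2 * Real.pi * ‖ξ‖ := by positivity
  rw [Real.norm_of_nonneg (by positivity), Real.norm_of_nonneg (by positivity)]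
  have h3 := rpow_le_one_add_rpow (r := 2 * (α / 2)) (s := 1) hx (by linarith [hα.1]) (by linarith [hα.2])
  rw [Real.rpow_one] at h3
  have h4 : ‖ξ‖ ≤ 1 + ‖ξ‖ ^ 2 := by nlinarith [norm_nonneg ξ, sq_nonneg (‖ξ‖ - 1)]
  have h5 : 2 * Real.pi * ‖ξ‖ ≤ 2 * Real.pi * (1 + ‖ξ‖ ^ 2) := by gcongr
  nlinarith [sq_nonneg ‖ξ‖]

/-- `V ∩ L^p` is dense in `H`. -/
theorem dense_memV_memLp {α : ℝ} (hα : α ∈ Ioo (0 : ℝ) 1) (p : ℝ≥0∞) :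
    Dense {ξ : H n | MemV α ξ ∧ MemLp ξ p (volume : Measure (E n))} := by
  have h := SchwartzMap.denseRange_toLpCLM (E := E n) (F := ℝ) (p := 2) (by norm_num)
    (μ := volume)
  refine Dense.mono ?_ h
  rintro _ ⟨f, rfl⟩
  refine ⟨memV_toLp_schwartz hα f, ?_⟩
  exact (f.memLp p).ae_eq (f.coeFn_toLp 2).symm

end Fourier

end FracRD

namespace FracRD

instance fact_two_ne_top : Fact ((2 : ℝ≥0∞) ≠ ∞) := ⟨by norm_num⟩

variable {n : ℕ}

/-! ### Elementary tensors in `L²(ℝⁿ; l²)` -/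

section Tensor

/-- The function `x ↦ ξ x • w` of `L²(ℝⁿ; l²)`, as a continuous bilinear map. -/
def tensor (n : ℕ) : H n →L[ℝ] SeqL2 →L[ℝ] HSeq n :=
  LinearMap.mkContinuous₂
    (LinearMap.mk₂ ℝ
      (fun (ξ : H n) (w : SeqL2) => (ContinuousLinearMap.toSpanSingleton ℝ w).compLp ξ)
      (fun ξ ξ' w => map_add ((ContinuousLinearMap.toSpanSingleton ℝ w).compLpL 2 volume) ξ ξ')
      (fun c ξ w => map_smul ((ContinuousLinearMap.toSpanSingleton ℝ w).compLpL 2 volume) c ξ)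
      (fun ξ w w' => by
        rw [ContinuousLinearMap.toSpanSingleton_add, ContinuousLinearMap.add_compLp])
      (fun c ξ w => by
        rw [ContinuousLinearMap.toSpanSingleton_smul, ContinuousLinearMap.smul_compLp]))
    1 (fun ξ w => by
      rw [one_mul, mul_comm]
      refine (ContinuousLinearMap.norm_compLp_le _ _).trans ?_
      rw [ContinuousLinearMap.norm_toSpanSingleton])

theorem coeFn_tensor (ξ : H n) (w : SeqL2) : tensor n ξ w =ᵐ[volume] fun x => ξ x • w := by
  refine (ContinuousLinearMap.coeFn_compLp' (ContinuousLinearMap.toSpanSingleton ℝ w) ξ).trans ?_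
  exact Eventually.of_forall fun x => rfl

theorem norm_tensor_le (ξ : H n) (w : SeqL2) : ‖tensor n ξ w‖ ≤ ‖ξ‖ * ‖w‖ := by
  rw [mul_comm]
  refine (ContinuousLinearMap.norm_compLp_le (ContinuousLinearMap.toSpanSingleton ℝ w) ξ).trans ?_
  rw [ContinuousLinearMap.norm_toSpanSingleton]

theorem abs_inner_tensor_le (S : HSeq n) (ξ : H n) (w : SeqL2) :
    |inner ℝ S (tensor n ξ w)| ≤ ‖S‖ * (‖ξ‖ * ‖w‖) :=
  (abs_real_inner_le_norm _ _).trans (mul_le_mul_of_nonneg_left (norm_tensor_le _ _) (norm_nonneg _))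

end Tensor

/-! ### The diffusion coefficient as a Hilbert–Schmidt operator -/

section Noise

open Classical in
/-- The sequence `{σ_{2,k}(t, x, y)}_k` as an element of `l²`. -/
def noiseSeq (σ₂ : ℕ → ℝ → E n → ℝ → ℝ) (t : ℝ) (x : E n) (y : ℝ) : SeqL2 :=
  if h : Memℓp (fun k => σ₂ k t x y) 2 then ⟨fun k => σ₂ k t x y, h⟩ else 0

open Classical in
/-- The Hilbert–Schmidt operator `σ(t, u)`, as an element of `L²(ℝⁿ; l²)`. -/
def noise (κ : E n → ℝ) (σ₁ : ℝ → HSeq n) (σ₂ : ℕ → ℝ → E n → ℝ → ℝ) (t : ℝ) (u : H n) : HSeq n :=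
  σ₁ t + if h : MemLp (fun x => κ x • noiseSeq σ₂ t x (u x)) 2 (volume : Measure (E n)) then
    h.toLp _ else 0

variable {p q : ℝ} {κ : E n → ℝ} {σ₁ : ℝ → HSeq n} {σ₂ : ℕ → ℝ → E n → ℝ → ℝ} {a b c : ℕ → ℝ}

theorem norm_sq_seq (w : SeqL2) : ‖w‖ ^ 2 = ∑' k, |w k| ^ 2 := by
  have := lp.norm_rpow_eq_tsum (p := 2) (by norm_num) w
  simpa using this

theorem memℓp_two_iff {f : ℕ → ℝ} : Memℓp f 2 ↔ Summable fun k => |f k| ^ 2 := by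
  rw [memℓp_gen_iff (by norm_num)]
  simp

namespace NoiseAssumptions

variable (hσ : NoiseAssumptions p q κ σ₁ σ₂ a b c)

include hσ

theorem summable_a : Summable a :=
  Summable.of_nonneg_of_le (fun k => (hσ.a_pos k).le)
    (fun k => by have := hσ.b_pos k; have := hσ.c_pos k; linarith) hσ.summable_abc

theorem summable_b : Summable b :=
  Summable.of_nonneg_of_le (fun k => (hσ.b_pos k).le)
    (fun k => by have := hσ.a_pos k; have := hσ.c_pos k; linarith) hσ.summable_abc

theorem summable_c : Summable c :=
  Summable.of_nonneg_of_le (fun k => (hσ.c_pos k).le)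
    (fun k => by have := hσ.a_pos k; have := hσ.b_pos k; linarith) hσ.summable_abc

theorem memℓp (t : ℝ) (x : E n) (y : ℝ) : Memℓp (fun k => σ₂ k t x y) 2 := by
  rw [memℓp_two_iff]
  exact Summable.of_nonneg_of_le (fun k => by positivity) (fun k => hσ.growth k t x y)
    (hσ.summable_b.add (hσ.summable_c.mul_right _))

theorem noiseSeq_apply (t : ℝ) (x : E n) (y : ℝ) (k : ℕ) :
    noiseSeq σ₂ t x y k = σ₂ k t x y := by
  rw [noiseSeq, dif_pos (hσ.memℓp t x y)]

theorem norm_noiseSeq_sq_le (t : ℝ) (x : E n) (y : ℝ) :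
    ‖noiseSeq σ₂ t x y‖ ^ 2 ≤ (∑' k, b k) + (∑' k, c k) * |y| ^ q := by
  have hs := hσ.summable_b.add (hσ.summable_c.mul_right (|y| ^ q))
  rw [norm_sq_seq, ← tsum_mul_right, ← hσ.summable_b.tsum_add (hσ.summable_c.mul_right _)]
  simp_rw [hσ.noiseSeq_apply]
  exact Summable.tsum_le_tsum (fun k => hσ.growth k t x y)
    (memℓp_two_iff.1 (hσ.memℓp t x y)) hs

theorem norm_noiseSeq_sub_sq_le (t : ℝ) (x : E n) (y z : ℝ) :
    ‖noiseSeq σ₂ t x y - noiseSeq σ₂ t x z‖ ^ 2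
      ≤ (∑' k, a k) * ((1 + |y| ^ (q - 2) + |z| ^ (q - 2)) * |y - z| ^ 2) := by
  have hs := memℓp_two_iff.1 (noiseSeq σ₂ t x y - noiseSeq σ₂ t x z).2
  rw [norm_sq_seq, ← tsum_mul_right]
  refine Summable.tsum_le_tsum (fun k => ?_) hs (hσ.summable_a.mul_right _)
  rw [lp.coeFn_sub, Pi.sub_apply, hσ.noiseSeq_apply, hσ.noiseSeq_apply, ← mul_assoc]
  exact hσ.lipschitz k t x y z

theorem stronglyMeasurable_noiseSeq :
    StronglyMeasurable fun z : ℝ × E n × ℝ => noiseSeq σ₂ z.1 z.2.1 z.2.2 := by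
  refine stronglyMeasurable_of_tendsto (u := atTop)
    (f := fun N z => ∑ k ∈ Finset.range N, (lp.single 2 k (σ₂ k z.1 z.2.1 z.2.2) : SeqL2))
    (fun N => ?_) ?_
  · refine Finset.stronglyMeasurable_fun_sum _ fun k _ => ?_
    have : (fun z : ℝ × E n × ℝ => (lp.single 2 k (σ₂ k z.1 z.2.1 z.2.2) : SeqL2))
        = fun z => σ₂ k z.1 z.2.1 z.2.2 • (lp.single 2 k (1 : ℝ) : SeqL2) := by
      funext z
      rw [← lp.single_smul]; simp
    rw [this]
    exact (hσ.measurable_σ₂ k).stronglyMeasurable.smul_const _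
  · rw [tendsto_pi_nhds]
    intro z
    have := (lp.hasSum_single (p := 2) (by norm_num)
      (noiseSeq σ₂ z.1 z.2.1 z.2.2)).tendsto_sum_nat
    simpa only [hσ.noiseSeq_apply] using this

theorem exists_bound_κ : ∃ K : ℝ, 0 ≤ K ∧ ∀ᵐ x, |κ x| ≤ K := by
  refine ⟨(eLpNorm κ ∞ volume).toReal, ENNReal.toReal_nonneg, ?_⟩
  filter_upwards [ae_le_eLpNormEssSup (f := κ) (μ := volume)] with x hx
  rw [← eLpNorm_exponent_top] at hx
  have := ENNReal.toReal_mono hσ.κ_mem_top.eLpNorm_ne_top hx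
  simpa using this

theorem aestronglyMeasurable_smul_noiseSeq (t : ℝ) {f : E n → ℝ}
    (hf : AEStronglyMeasurable f volume) :
    AEStronglyMeasurable (fun x => κ x • noiseSeq σ₂ t x (f x)) volume := by
  refine hσ.κ_mem_two.1.smul ?_
  obtain ⟨f', hf', hff⟩ := hf
  refine ⟨fun x => noiseSeq σ₂ t x (f' x), ?_, ?_⟩
  · have h : Measurable fun x : E n => ((t, x, f' x) : ℝ × E n × ℝ) :=
      measurable_const.prodMk (measurable_id.prodMk hf'.measurable)
    exact StronglyMeasurable.comp_measurable
      (f := fun z : ℝ × E n × ℝ => noiseSeq σ₂ z.1 z.2.1 z.2.2)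
      (g := fun x : E n => ((t, x, f' x) : ℝ × E n × ℝ)) hσ.stronglyMeasurable_noiseSeq h
  · filter_upwards [hff] with x hx
    rw [hx]

theorem q_le_p (hp : 2 < p) : q ≤ p := by linarith [hσ.q_le]

/-- The bound on the Hilbert–Schmidt norm of `κ σ₂(t, u)`. -/
theorem exists_smul_noiseSeq_bound (hp : 2 < p) : ∃ K : ℝ, 0 ≤ K ∧ ∀ (t : ℝ) (f : E n → ℝ),
    MemLp f 2 volume → Integrable (fun x => |f x| ^ p) →
    MemLp (fun x => κ x • noiseSeq σ₂ t x (f x)) 2 volume ∧ ∀ N > 0,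
      ∫ x, ‖κ x • noiseSeq σ₂ t x (f x)‖ ^ 2
        ≤ K * (1 + N ^ (q - p) * (∫ x, |f x| ^ p) + N ^ (q - 2) * ∫ x, |f x| ^ 2) := by
  obtain ⟨K, hK0, hK⟩ := hσ.exists_bound_κ
  have hB : 0 ≤ ∑' k, b k := tsum_nonneg fun k => (hσ.b_pos k).le
  have hC : 0 ≤ ∑' k, c k := tsum_nonneg fun k => (hσ.c_pos k).le
  have hκ2 : Integrable fun x => κ x ^ 2 := hσ.κ_mem_two.integrable_sq
  have hκi : 0 ≤ ∫ x, κ x ^ 2 := integral_nonneg fun x => sq_nonneg _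
  refine ⟨(∑' k, b k) * (∫ x, κ x ^ 2) + K ^ 2 * ∑' k, c k, by positivity, fun t f hf hfp => ?_⟩
  have hf2 : Integrable fun x => |f x| ^ 2 := by simpa using hf.integrable_sq
  -- The square integrability of `κ` pays for the constant part of the growth bound, and its
  -- boundedness for the part in `|f|^q`.
  have hpt : ∀ N > 0, ∀ᵐ x, ‖κ x • noiseSeq σ₂ t x (f x)‖ ^ 2
      ≤ (∑' k, b k) * κ x ^ 2
        + (K ^ 2 * ∑' k, c k) * (N ^ (q - p) * |f x| ^ p + N ^ (q - 2) * |f x| ^ 2) := by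
    intro N hN
    filter_upwards [hK] with x hx
    have h1 := hσ.norm_noiseSeq_sq_le t x (f x)
    have h2 := abs_rpow_le_rpow_add_sq hσ.two_le_q (hσ.q_le_p hp) hN (f x)
    have h3 : |κ x| ^ 2 ≤ K ^ 2 := by gcongr
    rw [norm_smul, mul_pow, Real.norm_eq_abs]
    calc |κ x| ^ 2 * ‖noiseSeq σ₂ t x (f x)‖ ^ 2
        ≤ |κ x| ^ 2 * ((∑' k, b k) + (∑' k, c k) * |f x| ^ q) := by gcongr
      _ = (∑' k, b k) * κ x ^ 2 + |κ x| ^ 2 * (∑' k, c k) * |f x| ^ q := by rw [sq_abs]; ring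
      _ ≤ (∑' k, b k) * κ x ^ 2 + K ^ 2 * (∑' k, c k) *
          (N ^ (q - p) * |f x| ^ p + N ^ (q - 2) * |f x| ^ 2) := by
        gcongr
  have hint : ∀ N : ℝ, Integrable fun x => (∑' k, b k) * κ x ^ 2
        + (K ^ 2 * ∑' k, c k) * (N ^ (q - p) * |f x| ^ p + N ^ (q - 2) * |f x| ^ 2) := fun N =>
    (hκ2.const_mul _).add (((hfp.const_mul _).add (hf2.const_mul _)).const_mul _)
  have hm := hσ.aestronglyMeasurable_smul_noiseSeq t hf.1
  have hsq : Integrable fun x => ‖κ x • noiseSeq σ₂ t x (f x)‖ ^ 2 := by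
    refine (hint 1).mono' (hm.norm.pow 2) ?_
    filter_upwards [hpt 1 one_pos] with x hx
    rwa [Real.norm_of_nonneg (by positivity)]
  refine ⟨(memLp_two_iff_integrable_sq_norm hm).2 hsq, fun N hN => ?_⟩
  refine (integral_mono_ae hsq (hint N) (hpt N hN)).trans ?_
  have hi1 : Integrable fun x => N ^ (q - p) * |f x| ^ p + N ^ (q - 2) * |f x| ^ 2 :=
    (hfp.const_mul _).add (hf2.const_mul _)
  rw [integral_add (hκ2.const_mul _) (hi1.const_mul _),
    integral_const_mul, integral_const_mul, integral_add (hfp.const_mul _) (hf2.const_mul _),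
    integral_const_mul, integral_const_mul]
  have i1 : 0 ≤ ∫ x, |f x| ^ p := integral_nonneg fun x => by positivity
  have i2 : 0 ≤ ∫ x, |f x| ^ 2 := integral_nonneg fun x => by positivity
  have j1 : 0 ≤ N ^ (q - p) * ∫ x, |f x| ^ p := by positivity
  have j2 : 0 ≤ N ^ (q - 2) * ∫ x, |f x| ^ 2 := by positivity
  have j3 : 0 ≤ (∑' k, b k) * (∫ x, κ x ^ 2) := by positivity
  have j4 : 0 ≤ K ^ 2 * ∑' k, c k := by positivity
  nlinarith

theorem memLp_smul_noiseSeq (hp : 2 < p) (t : ℝ) {u : H n} (hu : MemLp u (ENNReal.ofReal p) volume) :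
    MemLp (fun x => κ x • noiseSeq σ₂ t x (u x)) 2 volume := by
  obtain ⟨K, -, hK⟩ := hσ.exists_smul_noiseSeq_bound hp
  refine (hK t u (Lp.memLp u) ?_).1
  have := hu.integrable_norm_rpow (by simp; linarith) ENNReal.ofReal_ne_top
  rwa [ENNReal.toReal_ofReal (by linarith)] at this

theorem coeFn_noise (hp : 2 < p) (t : ℝ) {u : H n} (hu : MemLp u (ENNReal.ofReal p) volume) :
    noise κ σ₁ σ₂ t u =ᵐ[volume] fun x => σ₁ t x + κ x • noiseSeq σ₂ t x (u x) := by
  have h := hσ.memLp_smul_noiseSeq hp t hu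
  rw [noise, dif_pos h]
  filter_upwards [Lp.coeFn_add (σ₁ t) (h.toLp _), h.coeFn_toLp] with x h1 h2
  rw [h1, Pi.add_apply, h2]

/-- Translates the weak formulation into Hilbert space language: `(σ(t,u) w, ξ)` is the inner
product of `σ(t,u)` with `ξ ⊗ w`, which separates the state from the control and the test function.
-/
theorem integral_diffusion_mul (hp : 2 < p) (t : ℝ) {u : H n}
    (hu : MemLp u (ENNReal.ofReal p) volume) (w : SeqL2) (ξ : H n) :
    ∫ x, diffusion κ σ₁ σ₂ t u w x * ξ x = inner ℝ (noise κ σ₁ σ₂ t u) (tensor n ξ w) := by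
  rw [L2.inner_def]
  refine integral_congr_ae ?_
  filter_upwards [hσ.coeFn_noise hp t hu, coeFn_tensor ξ w] with x h1 h2
  rw [h1, h2, inner_smul_right, mul_comm, lp.inner_eq_tsum]
  congr 1
  refine tsum_congr fun k => ?_
  rw [lp.coeFn_add, Pi.add_apply, lp.coeFn_smul, Pi.smul_apply, hσ.noiseSeq_apply]
  simp [mul_comm]

theorem exists_norm_noise_sq_le (hp : 2 < p) : ∃ K : ℝ, 0 ≤ K ∧ ∀ (t : ℝ) (u : H n),
    MemLp u (ENNReal.ofReal p) volume → ∀ N > 0,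
      ‖noise κ σ₁ σ₂ t u‖ ^ 2
        ≤ 2 * ‖σ₁ t‖ ^ 2 + K * (1 + N ^ (q - p) * (∫ x, |u x| ^ p) + N ^ (q - 2) * ‖u‖ ^ 2) := by
  obtain ⟨K, hK0, hK⟩ := hσ.exists_smul_noiseSeq_bound hp
  refine ⟨2 * K, by positivity, fun t u hu N hN => ?_⟩
  have h := hσ.memLp_smul_noiseSeq hp t hu
  have hup : Integrable fun x => |u x| ^ p := by
    have := hu.integrable_norm_rpow (by simp; linarith) ENNReal.ofReal_ne_top
    rwa [ENNReal.toReal_ofReal (by linarith)] at this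
  have h2 := (hK t u (Lp.memLp u) hup).2 N hN
  have e1 : ‖h.toLp _‖ ^ 2 = ∫ x, ‖κ x • noiseSeq σ₂ t x (u x)‖ ^ 2 := by
    rw [← real_inner_self_eq_norm_sq, L2.inner_def]
    refine integral_congr_ae ?_
    filter_upwards [h.coeFn_toLp] with x hx
    rw [hx, real_inner_self_eq_norm_sq]
  have e2 : ‖u‖ ^ 2 = ∫ x, |u x| ^ 2 := by
    rw [← real_inner_self_eq_norm_sq, L2.inner_def]
    refine integral_congr_ae (Eventually.of_forall fun x => ?_)
    simp only [real_inner_self_eq_norm_sq, Real.norm_eq_abs]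
  rw [noise, dif_pos h]
  have h3 : ‖σ₁ t + h.toLp _‖ ^ 2 ≤ 2 * ‖σ₁ t‖ ^ 2 + 2 * ‖h.toLp _‖ ^ 2 := by
    have := norm_add_le (σ₁ t) (h.toLp _)
    have h4 : ‖σ₁ t + h.toLp _‖ ^ 2 ≤ (‖σ₁ t‖ + ‖h.toLp _‖) ^ 2 := by gcongr
    nlinarith [sq_nonneg (‖σ₁ t‖ - ‖h.toLp _‖)]
  rw [e1] at h3
  rw [e2]
  linarith

/-- Pointwise form of `exists_inner_noise_sub_le`. -/
theorem mul_inner_noiseSeq_sub_le (hp : 2 < p) {lam K A : ℝ} (hlam : 0 < lam) (hK : 0 ≤ K)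
    (hA : A = ∑' k, a k) {t : ℝ} {x : E n} {y z : ℝ} (hκ : |κ x| ≤ K) (v : SeqL2) :
    κ x * ((y - z) * inner ℝ (noiseSeq σ₂ t x y - noiseSeq σ₂ t x z) v)
      ≤ lam * ((|y| ^ (p - 2) + |z| ^ (p - 2)) * |y - z| ^ 2)
        + (3 * lam + (A + 1) * K ^ 2 / lam) * (1 + ‖v‖ ^ 2) * |y - z| ^ 2 := by
  have hA0 : 0 ≤ A := hA ▸ tsum_nonneg fun k => (hσ.a_pos k).le
  obtain ⟨D, hD⟩ : ∃ D, D = noiseSeq σ₂ t x y - noiseSeq σ₂ t x z := ⟨_, rfl⟩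
  obtain ⟨d, hd⟩ : ∃ d, d = |y - z| := ⟨_, rfl⟩
  obtain ⟨P, hP⟩ : ∃ P, P = |y| ^ (p - 2) + |z| ^ (p - 2) := ⟨_, rfl⟩
  have hd0 : 0 ≤ d := hd ▸ abs_nonneg _
  have hP0 : 0 ≤ P := hP ▸ by positivity
  have hD2 : ‖D‖ ^ 2 ≤ A * ((3 + P) * d ^ 2) := by
    rw [hD, hA, hd]
    refine (hσ.norm_noiseSeq_sub_sq_le t x y z).trans ?_
    have q1 := rpow_le_one_add_rpow (r := q - 2) (s := p - 2) (abs_nonneg y)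
      (by linarith [hσ.two_le_q]) (by linarith [hσ.q_le_p hp])
    have q2 := rpow_le_one_add_rpow (r := q - 2) (s := p - 2) (abs_nonneg z)
      (by linarith [hσ.two_le_q]) (by linarith [hσ.q_le_p hp])
    have : 1 + |y| ^ (q - 2) + |z| ^ (q - 2) ≤ 3 + P := by rw [hP]; linarith
    rw [← hA]
    gcongr
  have hle : κ x * ((y - z) * inner ℝ D v) ≤ K * ‖v‖ * (‖D‖ * d) := by
    refine (le_abs_self _).trans ?_
    rw [abs_mul, abs_mul, ← hd]
    have h6 := abs_real_inner_le_norm D v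
    calc |κ x| * (d * |inner ℝ D v|) ≤ K * (d * (‖D‖ * ‖v‖)) := by gcongr
      _ = _ := by ring
  rw [← hD, ← hd, ← hP]
  refine hle.trans ?_
  generalize ‖D‖ = N at *
  generalize ‖v‖ = w at *
  have hA1 : 0 < A + 1 := by linarith
  -- Young's inequality with weight `lam / (A + 1)`, so that `hz` turns the term in `N²` into at
  -- most `lam * (3 + P) * d²`: the part in `P` is the admitted weight and the 3 goes into the
  -- constant. The summand 1 makes division safe when only `0 ≤ A` is known.
  have hy : K * w * (N * d)
      ≤ lam / (A + 1) * N ^ 2 + ((A + 1) * K ^ 2 / lam) * (w ^ 2 * d ^ 2) := by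
    have h7 : 0 ≤ (lam / (A + 1) * N - K * w * d / 2) ^ 2 / (lam / (A + 1)) := by positivity
    have h8 : (lam / (A + 1) * N - K * w * d / 2) ^ 2 / (lam / (A + 1))
        = lam / (A + 1) * N ^ 2 - K * w * (N * d)
          + ((A + 1) * K ^ 2 / lam) * (w ^ 2 * d ^ 2) / 4 := by
      field_simp; ring
    have h9 : 0 ≤ ((A + 1) * K ^ 2 / lam) * (w ^ 2 * d ^ 2) := by positivity
    linarith
  have hz : lam / (A + 1) * N ^ 2 ≤ lam * ((3 + P) * d ^ 2) := by
    have h1 : A * ((3 + P) * d ^ 2) ≤ (A + 1) * ((3 + P) * d ^ 2) := by gcongr; linarith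
    calc lam / (A + 1) * N ^ 2 ≤ lam / (A + 1) * ((A + 1) * ((3 + P) * d ^ 2)) := by
          gcongr
          exact hD2.trans h1
      _ = _ := by field_simp
  have r1 : 0 ≤ (A + 1) * K ^ 2 / lam * d ^ 2 := by positivity
  have r2 : 0 ≤ lam * w ^ 2 * d ^ 2 := by positivity
  linear_combination hy + hz + r1 + 3 * r2

/-- The Lipschitz part of the noise is absorbed by the monotone part of the drift. -/
theorem exists_inner_noise_sub_le (hp : 2 < p) {lam : ℝ} (hlam : 0 < lam) : ∃ C : ℝ, 0 ≤ C ∧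
    ∀ (t : ℝ) (u w : H n), MemLp u (ENNReal.ofReal p) volume →
      MemLp w (ENNReal.ofReal p) volume → ∀ v : SeqL2,
      inner ℝ (noise κ σ₁ σ₂ t u - noise κ σ₁ σ₂ t w) (tensor n (u - w) v)
        ≤ lam * (∫ x, (|u x| ^ (p - 2) + |w x| ^ (p - 2)) * |u x - w x| ^ 2)
          + C * (1 + ‖v‖ ^ 2) * ‖u - w‖ ^ 2 := by
  obtain ⟨K, hK0, hK⟩ := hσ.exists_bound_κ
  have hA : 0 ≤ ∑' k, a k := tsum_nonneg fun k => (hσ.a_pos k).le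
  obtain ⟨A, hAdef⟩ : ∃ A, A = ∑' k, a k := ⟨_, rfl⟩
  rw [← hAdef] at hA
  refine ⟨3 * lam + (A + 1) * K ^ 2 / lam, by positivity, fun t u w hu hw v => ?_⟩
  have hpint : ∀ u : H n, MemLp u (ENNReal.ofReal p) volume → Integrable fun x => |u x| ^ p := by
    intro u hu
    have := hu.integrable_norm_rpow (by simp; linarith) ENNReal.ofReal_ne_top
    rwa [ENNReal.toReal_ofReal (by linarith)] at this
  have hsub : Integrable fun x => |u x - w x| ^ 2 := by
    have := ((Lp.memLp u).sub (Lp.memLp w)).integrable_sq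
    simpa using this
  have hm : AEStronglyMeasurable (fun x => (|u x| ^ (p - 2) + |w x| ^ (p - 2)) * |u x - w x| ^ 2)
      (volume : Measure (E n)) := by
    have h1 := (Lp.aestronglyMeasurable u).aemeasurable
    have h2 := (Lp.aestronglyMeasurable w).aemeasurable
    exact AEMeasurable.aestronglyMeasurable (by fun_prop)
  have hW : Integrable fun x => (|u x| ^ (p - 2) + |w x| ^ (p - 2)) * |u x - w x| ^ 2 := by
    refine (((hpint u hu).add (hpint w hw)).const_mul 8).mono' hm (Eventually.of_forall fun x => ?_)
    rw [Real.norm_of_nonneg (by positivity)]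
    exact weight_le hp _ _
  have e2 : ‖u - w‖ ^ 2 = ∫ x, |u x - w x| ^ 2 := by
    rw [← real_inner_self_eq_norm_sq, L2.inner_def]
    refine integral_congr_ae ?_
    filter_upwards [Lp.coeFn_sub u w] with x hx
    rw [hx, real_inner_self_eq_norm_sq, Real.norm_eq_abs, Pi.sub_apply]
  rw [L2.inner_def, e2, ← integral_const_mul, ← integral_const_mul,
    ← integral_add (hW.const_mul _) (hsub.const_mul _)]
  refine integral_mono_ae (L2.integrable_inner _ _)
    ((hW.const_mul _).add (hsub.const_mul _)) ?_
  filter_upwards [hK, hσ.coeFn_noise hp t hu, hσ.coeFn_noise hp t hw, coeFn_tensor (u - w) v,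
    Lp.coeFn_sub (noise κ σ₁ σ₂ t u) (noise κ σ₁ σ₂ t w), Lp.coeFn_sub u w]
    with x hκ h1 h2 h3 h4 h5
  rw [h4, Pi.sub_apply, h1, h2, h3, h5, Pi.sub_apply, add_sub_add_left_eq_sub, ← smul_sub,
    inner_smul_left, inner_smul_right]
  simp only [conj_trivial]
  exact hσ.mul_inner_noiseSeq_sub_le hp hlam hK0 hAdef hκ v

end NoiseAssumptions

end Noise

end FracRD

namespace FracRD

/-! ### Pairing time-dependent functions with fixed or translated ones -/

section Pairing

variable {X 𝕜 : Type*} [MeasureSpace X] [SFinite (volume : Measure X)] [RCLike 𝕜]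

/-- Pairing the sections of a function of `(s, x)` with a fixed function of `x`. -/
theorem section_pairing {f : ℝ × X → 𝕜} {g : X → 𝕜} {P Q : ℝ} (hPQ : P.HolderConjugate Q)
    (hf : AEStronglyMeasurable f volume) (hg : AEStronglyMeasurable g volume)
    (hfP : Integrable fun z => ‖f z‖ ^ P) (hgQ : Integrable fun x => ‖g x‖ ^ Q)
    {A : Set ℝ} (hA : volume A < ∞) :
    IntegrableOn (fun s => ∫ x, f (s, x) * g x) A ∧ ∀ δ > 0,
      ∫ s in A, ‖∫ x, f (s, x) * g x‖
        ≤ δ ^ P * (∫ s in A, ∫ x, ‖f (s, x)‖ ^ P) + δ⁻¹ ^ Q * (volume A).toReal * ∫ x, ‖g x‖ ^ Q := by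
  have hle : (volume.restrict A).prod (volume : Measure X) ≤ (volume : Measure (ℝ × X)) := by
    rw [Measure.volume_eq_prod]
    exact Measure.prod_mono Measure.restrict_le_self le_rfl
  have : IsFiniteMeasure (volume.restrict A) := ⟨by simpa using hA⟩
  have hfA : Integrable (fun z : ℝ × X => ‖f z‖ ^ P) ((volume.restrict A).prod volume) :=
    hfP.mono_measure hle
  have hgA : Integrable (fun z : ℝ × X => ‖g z.2‖ ^ Q) ((volume.restrict A).prod volume) :=
    hgQ.comp_snd _
  -- Young rather than Hölder: the large factor `δ⁻¹ ^ Q` meets only the fixed function `g` and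
  -- hence the length of `A`, while the mass of `f` is multiplied by a small power of `δ`.
  have hbd : ∀ δ > 0, ∀ z : ℝ × X, ‖f z * g z.2‖ ≤ δ ^ P * ‖f z‖ ^ P + δ⁻¹ ^ Q * ‖g z.2‖ ^ Q :=
    fun δ hδ z => by
      have := abs_mul_le_rpow hPQ hδ ‖f z‖ ‖g z.2‖
      rwa [abs_mul, abs_norm, abs_norm, ← norm_mul] at this
  have hint : Integrable (fun z : ℝ × X => f z * g z.2) ((volume.restrict A).prod volume) := by
    refine ((hfA.const_mul (1 ^ P)).add (hgA.const_mul (1⁻¹ ^ Q))).mono' ?_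
      (Eventually.of_forall fun z => hbd 1 one_pos z)
    exact (hf.mono_measure hle).mul hg.comp_snd
  refine ⟨hint.integral_prod_left, fun δ hδ => ?_⟩
  calc ∫ s in A, ‖∫ x, f (s, x) * g x‖
      ≤ ∫ s in A, ∫ x, ‖f (s, x) * g x‖ :=
        integral_mono hint.integral_prod_left.norm hint.norm.integral_prod_left
          fun s => norm_integral_le_integral_norm _
    _ = ∫ z, ‖f z * g z.2‖ ∂((volume.restrict A).prod volume) :=
        (integral_prod (fun z : ℝ × X => ‖f z * g z.2‖) hint.norm).symm
    _ ≤ ∫ z, (δ ^ P * ‖f z‖ ^ P + δ⁻¹ ^ Q * ‖g z.2‖ ^ Q) ∂((volume.restrict A).prod volume) :=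
        integral_mono hint.norm ((hfA.const_mul _).add (hgA.const_mul _)) (hbd δ hδ)
    _ = _ := by
        rw [integral_add (hfA.const_mul _) (hgA.const_mul _), integral_const_mul,
          integral_const_mul, integral_prod _ hfA, integral_prod _ hgA]
        simp [Measure.real, mul_assoc]

end Pairing

section HilbertPairing

variable {Y : Type*} [NormedAddCommGroup Y] [InnerProductSpace ℝ Y]

/-- The analogue of `translation_pairing` for an integrable and a bounded continuous function. -/
theorem translation_inner {G w : ℝ → Y} (hGm : StronglyMeasurable G) (hG : Integrable G)
    (hw : Continuous w) {M : ℝ} (hM : ∀ s, ‖w s‖ ≤ M) (A : Set ℝ) :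
    Integrable (fun z : ℝ × ℝ => (inner ℝ (G (z.1 - z.2)) (w z.1) : ℝ))
      ((volume.restrict A).prod (volume.restrict (Icc (0 : ℝ) 1))) ∧
    (∀ r, IntegrableOn (fun τ => (inner ℝ (G (τ - r)) (w τ) : ℝ)) A) ∧
    Tendsto (fun r => ∫ τ in A, (inner ℝ (G (τ - r)) (w τ) : ℝ)) (𝓝 0)
      (𝓝 (∫ τ in A, (inner ℝ (G τ) (w τ) : ℝ))) := by
  have hM0 : 0 ≤ M := (norm_nonneg _).trans (hM 0)
  have hwm : StronglyMeasurable w := hw.stronglyMeasurable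
  have hGr : ∀ r, Integrable fun τ => G (τ - r) := fun r => hG.comp_sub_right r
  have hint : ∀ r, Integrable fun τ => (inner ℝ (G (τ - r)) (w τ) : ℝ) := fun r => by
    refine ((hGr r).norm.mul_const M).mono' ?_ (Eventually.of_forall fun τ => ?_)
    · exact ((hGr r).1.inner hwm.aestronglyMeasurable)
    · exact (norm_inner_le_norm _ _).trans (mul_le_mul_of_nonneg_left (hM _) (norm_nonneg _))
  refine ⟨⟨?_, ?_⟩, fun r => (hint r).integrableOn, ?_⟩
  · exact ((hGm.comp_measurable (by fun_prop : Measurable fun z : ℝ × ℝ => z.1 - z.2)).inner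
      (hwm.comp_measurable measurable_fst)).aestronglyMeasurable
  · obtain ⟨C, hC⟩ : ∃ C, C = (∫⁻ s, ‖G s‖ₑ) * ENNReal.ofReal M := ⟨_, rfl⟩
    have hCtop : C < ∞ := hC ▸ ENNReal.mul_lt_top hG.2 ENNReal.ofReal_lt_top
    have hbound : ∀ r, ∫⁻ τ in A, ‖(inner ℝ (G (τ - r)) (w τ) : ℝ)‖ₑ ≤ C := fun r => by
      refine (setLIntegral_le_lintegral A _).trans ?_
      rw [hC, ← lintegral_sub_right_eq_self (fun s => ‖G s‖ₑ) r,
        ← lintegral_mul_const' _ _ ENNReal.ofReal_ne_top]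
      refine lintegral_mono fun τ => ?_
      rw [← ofReal_norm, ← ofReal_norm, ← ENNReal.ofReal_mul (norm_nonneg _)]
      exact ENNReal.ofReal_le_ofReal ((norm_inner_le_norm _ _).trans
        (mul_le_mul_of_nonneg_left (hM _) (norm_nonneg _)))
    have hm : StronglyMeasurable fun z : ℝ × ℝ => (inner ℝ (G (z.1 - z.2)) (w z.1) : ℝ) :=
      (hGm.comp_measurable (by fun_prop : Measurable fun z : ℝ × ℝ => z.1 - z.2)).inner
        (hwm.comp_measurable measurable_fst)
    rw [hasFiniteIntegral_iff_enorm, lintegral_prod_symm _ hm.enorm.aemeasurable]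
    calc _ ≤ ∫⁻ _ in Icc (0 : ℝ) 1, C := by
            refine lintegral_mono ?_
            intro r
            exact hbound r
      _ < ∞ := by
            rw [lintegral_const]
            exact ENNReal.mul_lt_top hCtop (by simp)
  · have e0 : ∫ τ in A, (inner ℝ (G τ) (w τ) : ℝ) = ∫ τ in A, (inner ℝ (G (τ - 0)) (w τ) : ℝ) := by
      simp
    rw [e0, tendsto_iff_edist_tendsto_0]
    have hT := ENNReal.Tendsto.mul_const (tendsto_eLpNorm_translate_sub_real (P := 1) (by simp)
      (memLp_one_iff_integrable.2 hG)) (b := ENNReal.ofReal M) (Or.inr ENNReal.ofReal_ne_top)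
    rw [zero_mul] at hT
    refine tendsto_of_tendsto_of_tendsto_of_le_of_le tendsto_const_nhds hT (fun _ => bot_le)
      fun r => ?_
    simp only [edist_eq_enorm_sub]
    rw [← integral_sub (hint r).integrableOn (hint 0).integrableOn]
    refine (enorm_integral_le_lintegral_enorm _).trans ((setLIntegral_le_lintegral A _).trans ?_)
    rw [eLpNorm_one_eq_lintegral_enorm, ← lintegral_mul_const' _ _ ENNReal.ofReal_ne_top]
    refine lintegral_mono fun τ => ?_
    simp only [sub_zero]
    rw [← inner_sub_left, ← ofReal_norm, ← ofReal_norm, ← ENNReal.ofReal_mul (norm_nonneg _)]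
    exact ENNReal.ofReal_le_ofReal ((norm_inner_le_norm _ _).trans
        (mul_le_mul_of_nonneg_left (hM _) (norm_nonneg _)))

end HilbertPairing

/-! ### Jointly measurable representatives and the energy inequality -/

variable {n : ℕ}

/-- `U` and `Uh` are jointly measurable versions of `(s, x) ↦ u s x` and of the Fourier side of
`(-Δ)^{α/2} u`, extended by zero outside `[0, T]`, with the integrability of
`L^p(0,T; L^p) ∩ L²(0,T; V)`. -/
structure Repr (α p T : ℝ) (u : ℝ → H n) (U : ℝ × E n → ℝ) (Uh : ℝ × E n → ℂ) : Prop where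
  measurable_U : Measurable U
  measurable_Uh : Measurable Uh
  ae_eq : ∀ᵐ s ∂(volume.restrict (Icc 0 T)), (fun x => U (s, x)) =ᵐ[volume] u s ∧
    (fun η => Uh (s, η)) =ᵐ[volume] fracLapFourier (α / 2) (complexify (u s)) ∧
    MemV α (u s) ∧ MemLp (u s) (ENNReal.ofReal p) volume
  memLp_two_section : ∀ s, MemLp (fun x => U (s, x)) 2 volume
  memLp_section : ∀ s, MemLp (fun x => U (s, x)) (ENNReal.ofReal p) volume
  U_zero : ∀ s ∉ Icc 0 T, ∀ x, U (s, x) = 0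
  Uh_zero : ∀ s ∉ Icc 0 T, ∀ x, Uh (s, x) = 0
  memLp_U : MemLp U (ENNReal.ofReal p) volume
  memLp_Uh : MemLp Uh 2 volume

theorem integrable_norm_rpow_ofReal {Y F : Type*} [MeasurableSpace Y] {μ : Measure Y}
    [NormedAddCommGroup F] {f : Y → F} {r : ℝ} (hr : 0 < r) (hf : MemLp f (ENNReal.ofReal r) μ) :
    Integrable (fun y => ‖f y‖ ^ r) μ := by
  have := hf.integrable_norm_rpow (by simpa using hr) ENNReal.ofReal_ne_top
  rwa [ENNReal.toReal_ofReal hr.le] at this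

theorem holderConjugate_conj {p : ℝ} (hp : 2 < p) : (p / (p - 1)).HolderConjugate p := by
  have := Real.HolderConjugate.conjExponent (p := p) (by linarith)
  exact this.symm

theorem holderTriple_ofReal {p : ℝ} (hp : 2 < p) :
    (ENNReal.ofReal (p / (p - 1))).HolderTriple (ENNReal.ofReal p) 1 := by
  have := (holderConjugate_conj hp).ennrealOfReal
  exact this

/-- The integrand of the weak formulation is integrable. -/
theorem weak_integrable {α p T : ℝ} (hp : 2 < p) {Wh : ℝ × E n → ℂ} (hWh : MemLp Wh 2 volume)
    {Φ : ℝ × E n → ℝ} (hΦ : MemLp Φ (ENNReal.ofReal (p / (p - 1))) volume)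
    {G : ℝ → H n} (hG : Integrable G) {ξ : H n} (hξV : MemV α ξ)
    (hξp : MemLp ξ (ENNReal.ofReal p) volume) :
    IntegrableOn (fun s => (∫ η, starRingEnd ℂ (Wh (s, η))
        * fracLapFourier (α / 2) (complexify ξ) η).re) (Icc 0 T) ∧
    IntegrableOn (fun s => ∫ x, Φ (s, x) * ξ x) (Icc 0 T) ∧
    IntegrableOn (fun s => (inner ℝ (G s) ξ : ℝ)) (Icc 0 T) := by
  have hp' := holderConjugate_conj hp
  have hA : volume (Icc 0 T) < ∞ := by simp
  refine ⟨?_, ?_, ?_⟩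
  · have hξV' : MemLp (fracLapFourier (α / 2) (complexify ξ)) 2 (volume : Measure (E n)) := hξV
    have hst : MemLp (fun z => starRingEnd ℂ (Wh z)) 2 volume := hWh.star
    have h := (section_pairing (f := fun z => starRingEnd ℂ (Wh z)) Real.HolderConjugate.two_two
      hst.1 hξV'.1 (integrable_norm_rpow_ofReal two_pos (by simpa using hst))
      (integrable_norm_rpow_ofReal two_pos (by simpa using hξV')) hA).1
    exact h.re
  · exact (section_pairing hp' hΦ.1 hξp.1 (integrable_norm_rpow_ofReal hp'.pos hΦ)
      (integrable_norm_rpow_ofReal (by linarith) hξp) hA).1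
  · exact (hG.inner_const ξ).integrableOn

/-- The energy inequality. -/
theorem energy_ineq {α p T : ℝ} (hT : 0 < T) (hp : 2 < p) {w : ℝ → H n}
    (hw : ContinuousOn w (Icc 0 T)) (hw0 : w 0 = 0) {W : ℝ × E n → ℝ} {Wh : ℝ × E n → ℂ}
    (hW : Repr α p T w W Wh) {Φ : ℝ × E n → ℝ} (hΦm : Measurable Φ)
    (hΦ : MemLp Φ (ENNReal.ofReal (p / (p - 1))) volume) (hΦ0 : ∀ s ∉ Icc 0 T, ∀ x, Φ (s, x) = 0)
    {G : ℝ → H n} (hGm : StronglyMeasurable G) (hG : Integrable G) (hG0 : ∀ s ∉ Icc 0 T, G s = 0)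
    (heq : ∀ t ∈ Icc 0 T, ∀ ξ : H n, MemV α ξ → MemLp ξ (ENNReal.ofReal p) volume →
      inner ℝ (w t) ξ = ∫ s in (0 : ℝ)..t, (-(∫ η, starRingEnd ℂ (Wh (s, η))
        * fracLapFourier (α / 2) (complexify ξ) η).re - (∫ x, Φ (s, x) * ξ x) + inner ℝ (G s) ξ)) :
    ∀ t ∈ Icc 0 T, ‖w t‖ ^ 2 + 2 * (∫ s in Icc 0 t, ∫ η, ‖Wh (s, η)‖ ^ 2)
      + 2 * (∫ s in Icc 0 t, ∫ x, Φ (s, x) * W (s, x)) ≤ 2 * ∫ s in Icc 0 t, inner ℝ (G s) (w s) := by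
  intro t ht
  have hp' := holderConjugate_conj hp
  have htri := holderTriple_ofReal hp
  have hone : Fact (1 ≤ ENNReal.ofReal (p / (p - 1))) :=
    ⟨by rw [← ENNReal.ofReal_one]; exact ENNReal.ofReal_le_ofReal hp'.lt.le⟩
  -- continuous extension in time
  set we : ℝ → H n := IccExtend hT.le ((Icc 0 T).domRestrict w) with hwe
  have hwec : Continuous we := hw.domRestrict.Icc_extend'
  have hwe_eq : ∀ s ∈ Icc 0 T, we s = w s := fun s hs => by
    rw [hwe, IccExtend_of_mem _ _ hs]; rfl
  have hwe_neg : ∀ s ≤ 0, we s = 0 := fun s hs => by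
    rw [hwe, IccExtend_of_le_left _ _ hs]; exact hw0
  obtain ⟨M, hM⟩ : ∃ M, ∀ s, ‖we s‖ ≤ M := by
    obtain ⟨M, hM⟩ := (isCompact_Icc.image_of_continuousOn hw).isBounded.exists_norm_le
    refine ⟨M, fun s => hM _ ?_⟩
    rw [hwe]
    exact ⟨_, (projIcc 0 T hT.le s).2, rfl⟩
  set A := Icc (0 : ℝ) t with hA
  have hAT : A ⊆ Icc 0 T := Icc_subset_Icc_right ht.2
  obtain ⟨i1, c1, l1⟩ := translation_pairing (P := 2) (Q := 2) (by norm_num)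
    (f := fun z => starRingEnd ℂ (Wh z)) (g := Wh) (continuous_star.measurable.comp hW.measurable_Uh)
    hW.measurable_Uh hW.memLp_Uh.star hW.memLp_Uh A
  obtain ⟨i2, c2, l2⟩ := translation_pairing ENNReal.ofReal_ne_top (f := Φ) (g := W) hΦm
    hW.measurable_U hΦ hW.memLp_U A
  obtain ⟨i3, c3, l3⟩ := translation_inner hGm hG hwec hM A
  -- The right-hand side of the equation at time `τ - r`, tested with the solution at time `τ`; the
  -- value at `r = 0` is the energy balance.
  let K : ℝ → ℝ → ℝ := fun τ r => -(∫ η, starRingEnd ℂ (Wh (τ - r, η)) * Wh (τ, η)).re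
    - (∫ x, Φ (τ - r, x) * W (τ, x)) + inner ℝ (G (τ - r)) (we τ)
  have hKint : Integrable (Function.uncurry K)
      ((volume.restrict A).prod (volume.restrict (Icc 0 1))) := (i1.re.neg.sub i2).add i3
  have hJ : Tendsto (fun r => ∫ τ in A, K τ r) (𝓝[>] 0) (𝓝
      (-(∫ τ in A, ∫ η, starRingEnd ℂ (Wh (τ, η)) * Wh (τ, η)).re
        - (∫ τ in A, ∫ x, Φ (τ, x) * W (τ, x)) + ∫ τ in A, inner ℝ (G τ) (we τ))) := by
    have h1 : Tendsto (fun r => (∫ τ in A, ∫ η, starRingEnd ℂ (Wh (τ - r, η)) * Wh (τ, η)).re)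
        (𝓝 0) (𝓝 (∫ τ in A, ∫ η, starRingEnd ℂ (Wh (τ, η)) * Wh (τ, η)).re) :=
      (Complex.continuous_re.tendsto _).comp l1
    refine Tendsto.mono_left (((h1.neg.sub l2).add l3).congr fun r => ?_) nhdsWithin_le_nhds
    have e1 : ∫ τ in A, K τ r = (∫ τ in A, -(∫ η, starRingEnd ℂ (Wh (τ - r, η)) * Wh (τ, η)).re)
        - (∫ τ in A, ∫ x, Φ (τ - r, x) * W (τ, x)) + ∫ τ in A, inner ℝ (G (τ - r)) (we τ) := by
      have a1 : IntegrableOn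
        (fun τ => -(∫ η, starRingEnd ℂ (Wh (τ - r, η)) * Wh (τ, η)).re) A := (c1 r).re.neg
      have a2 : IntegrableOn (fun τ => -(∫ η, starRingEnd ℂ (Wh (τ - r, η)) * Wh (τ, η)).re
        - ∫ x, Φ (τ - r, x) * W (τ, x)) A := a1.sub (c2 r)
      rw [← integral_sub a1 (c2 r), ← integral_add a2 (c3 r)]
    have e2 : ∫ τ in A, (∫ η, starRingEnd ℂ (Wh (τ - r, η)) * Wh (τ, η)).re
        = (∫ τ in A, ∫ η, starRingEnd ℂ (Wh (τ - r, η)) * Wh (τ, η)).re := integral_re (c1 r)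
    rw [e1, integral_neg, e2]
  -- From `‖x‖² - ‖y‖² = 2 (x - y, x) - ‖x - y‖²`, dropping the last square. The state `w τ` is an
  -- admissible test function for almost every `τ` only, hence the a.e. statement.
  have hinc : ∀ h ∈ Ioc (0 : ℝ) 1, ∀ᵐ τ ∂(volume.restrict A),
      ‖we τ‖ ^ 2 - ‖we (τ - h)‖ ^ 2 ≤ 2 * ∫ r in (0 : ℝ)..h, K τ r := by
    intro h hh
    have hae := ae_mono (Measure.restrict_mono hAT le_rfl) hW.ae_eq
    filter_upwards [hae, ae_restrict_mem measurableSet_Icc] with τ ⟨e1, e2, hV, hL⟩ hτ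
    have hτT : τ ∈ Icc 0 T := hAT hτ
    let fξ : ℝ → ℝ := fun s => -(∫ η, starRingEnd ℂ (Wh (s, η))
        * fracLapFourier (α / 2) (complexify (w τ)) η).re - (∫ x, Φ (s, x) * w τ x)
        + inner ℝ (G s) (w τ)
    have hf0 : ∀ s ∉ Icc 0 T, fξ s = 0 := fun s hs => by
      simp [fξ, hW.Uh_zero s hs, hΦ0 s hs, hG0 s hs]
    have hfint : Integrable fξ := by
      obtain ⟨b1, b2, b3⟩ := weak_integrable (T := T) hp hW.memLp_Uh hΦ hG hV hL
      have : IntegrableOn fξ (Icc 0 T) := (b1.neg.sub b2).add b3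
      exact this.integrable_of_forall_notMem_eq_zero hf0
    -- Also valid at negative times, where the extension and the integrand both vanish; this lets `τ
    -- - h` fall below zero.
    have hweq : ∀ s ≤ T, inner ℝ (we s) (w τ) = ∫ r in (0 : ℝ)..s, fξ r := by
      intro s hs
      rcases le_or_gt 0 s with h0 | h0
      · rw [hwe_eq s ⟨h0, hs⟩, heq s ⟨h0, hs⟩ (w τ) hV hL]
      · rw [hwe_neg s h0.le, inner_zero_left, intervalIntegral.integral_symm,
          intervalIntegral.integral_of_le h0.le, integral_Ioc_eq_integral_Ioo, setIntegral_eq_zero_of_forall_eq_zero, neg_zero]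
        intro r hr
        exact hf0 r fun hr' => absurd hr.2 (not_lt.2 hr'.1)
    have hdiff : inner ℝ (we τ - we (τ - h)) (w τ) = ∫ r in (0 : ℝ)..h, fξ (τ - r) := by
      rw [inner_sub_left, hweq τ hτT.2, hweq (τ - h) (by linarith [hτT.2, hh.1]),
        intervalIntegral.integral_interval_sub_left hfint.intervalIntegrable
          hfint.intervalIntegrable, intervalIntegral.integral_comp_sub_left, sub_zero]
    have hKf : ∀ r, K τ r = fξ (τ - r) := by
      intro r
      have g1 : ∫ η, starRingEnd ℂ (Wh (τ - r, η)) * Wh (τ, η)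
          = ∫ η, starRingEnd ℂ (Wh (τ - r, η)) * fracLapFourier (α / 2) (complexify (w τ)) η := by
        refine integral_congr_ae ?_
        filter_upwards [e2] with η hη
        rw [hη]
      have g2 : ∫ x, Φ (τ - r, x) * W (τ, x) = ∫ x, Φ (τ - r, x) * w τ x := by
        refine integral_congr_ae ?_
        filter_upwards [e1] with x hx
        rw [hx]
      simp only [K, fξ, g1, g2, hwe_eq τ hτT]
    simp_rw [hKf]
    rw [← hdiff, ← hwe_eq τ hτT]
    have h1 := real_inner_self_eq_norm_sq (we τ - we (τ - h))
    have h2 : we (τ - h) = we τ - (we τ - we (τ - h)) := by abel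
    have h3 : ‖we (τ - h)‖ ^ 2 = ‖we τ‖ ^ 2 - 2 * inner ℝ (we τ) (we τ - we (τ - h))
        + ‖we τ - we (τ - h)‖ ^ 2 := by
      conv_lhs => rw [h2]
      exact norm_sub_sq_real _ _
    rw [real_inner_comm] at h3
    nlinarith [sq_nonneg ‖we τ - we (τ - h)‖]
  have hmain := le_of_increment_le (φ := fun s => ‖we s‖ ^ 2) ht.1 (hwec.norm.pow 2)
    (fun s hs => by simp [hwe_neg s hs]) hKint hJ hinc
  have r1 : (∫ τ in A, ∫ η, starRingEnd ℂ (Wh (τ, η)) * Wh (τ, η)).re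
      = ∫ τ in A, ∫ η, ‖Wh (τ, η)‖ ^ 2 := by
    have : ∀ z : ℂ, starRingEnd ℂ z * z = ((‖z‖ ^ 2 : ℝ) : ℂ) := fun z => by
      rw [Complex.conj_mul']; push_cast; rfl
    simp_rw [this, integral_complex_ofReal]
    exact Complex.ofReal_re _
  have r3 : ∫ τ in A, inner ℝ (G τ) (we τ) = ∫ τ in A, inner ℝ (G τ) (w τ) :=
    setIntegral_congr_fun measurableSet_Icc fun τ hτ => by simp only [hwe_eq τ (hAT hτ)]
  rw [r1, r3] at hmain
  simp only [hwe_eq t ht] at hmain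
  linarith

end FracRD

namespace FracRD

variable {n : ℕ}

/-! ### Sections of functions of time and space; existence of representatives -/

section Sections

variable {X F : Type*} [MeasureSpace X] [SFinite (volume : Measure X)]
  [NormedAddCommGroup F] [MeasurableSpace F] [BorelSpace F] [SecondCountableTopology F]

theorem ae_memLp_section {f : ℝ × X → F} (hfm : Measurable f) {r : ℝ} (hr : 0 < r)
    (hf : MemLp f (ENNReal.ofReal r) volume) :
    ∀ᵐ s, MemLp (fun x => f (s, x)) (ENNReal.ofReal r) volume := by
  have h := integrable_norm_rpow_ofReal hr hf
  rw [Measure.volume_eq_prod] at h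
  filter_upwards [h.prod_right_ae] with s hs
  have hm : AEStronglyMeasurable (fun x => f (s, x)) volume :=
    (hfm.comp measurable_prodMk_left).aestronglyMeasurable
  rw [← integrable_norm_rpow_iff hm (by simpa using hr) ENNReal.ofReal_ne_top,
    ENNReal.toReal_ofReal hr.le]
  exact hs

theorem memLp_of_lintegral_section {f : ℝ × X → F} (hfm : Measurable f) {r : ℝ} (hr : 0 < r)
    (hf : ∫⁻ s, ∫⁻ x, ‖f (s, x)‖ₑ ^ r < ∞) : MemLp f (ENNReal.ofReal r) volume := by
  refine ⟨hfm.aestronglyMeasurable, ?_⟩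
  rw [eLpNorm_lt_top_iff_lintegral_rpow_enorm_lt_top (by simpa using hr) ENNReal.ofReal_ne_top,
    ENNReal.toReal_ofReal hr.le, Measure.volume_eq_prod,
    lintegral_prod _ (hfm.enorm.pow_const r).aemeasurable]
  exact hf

end Sections

theorem eLpNorm_ofReal_rpow {X F : Type*} [MeasurableSpace X] {μ : Measure X}
    [NormedAddCommGroup F] {f : X → F} {r : ℝ} (hr : 0 < r) :
    eLpNorm f (ENNReal.ofReal r) μ ^ r = ∫⁻ x, ‖f x‖ₑ ^ r ∂μ := by
  rw [eLpNorm_eq_lintegral_rpow_enorm_toReal (by simpa using hr) ENNReal.ofReal_ne_top,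
    ENNReal.toReal_ofReal hr.le, ← ENNReal.rpow_mul, one_div, inv_mul_cancel₀ hr.ne',
    ENNReal.rpow_one]

theorem stronglyMeasurable_indicator_of_continuousOn {Y : Type*} [NormedAddCommGroup Y]
    {A : Set ℝ} (hA : MeasurableSet A) {u : ℝ → Y} (hu : ContinuousOn u A) :
    StronglyMeasurable (A.indicator u) := by
  have h := (MeasurableEmbedding.subtype_coe hA).stronglyMeasurable_extend
    (continuousOn_iff_continuous_domRestrict.1 hu).stronglyMeasurable
    (stronglyMeasurable_zero (β := Y))
  convert h using 1
  funext s
  by_cases hs : s ∈ A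
  · have := Subtype.val_injective.extend_apply (A.domRestrict u) (0 : ℝ → Y) (⟨s, hs⟩ : A)
    rw [indicator_of_mem hs]
    exact this.symm
  · rw [indicator_of_notMem hs, Function.extend_apply']
    · rfl
    · rintro ⟨a, rfl⟩
      exact hs a.2

/-- Continuity into `H` already supplies versions of `u` and of its Fourier transform. Multiplying
the latter by the symbol gives the version of the Fourier side of `(-Δ)^{α/2} u`, so no
measurability into `V` or `L^p` has to be assumed. -/
theorem exists_repr {α p T : ℝ} (hp : 2 < p) {u : ℝ → H n} (hc : ContinuousOn u (Icc 0 T))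
    (hV : ∀ᵐ t ∂(volume.restrict (Icc 0 T)), MemV α (u t))
    (hVi : ∫⁻ t in Icc 0 T, sqNormV α (u t) < ∞)
    (hL : ∀ᵐ t ∂(volume.restrict (Icc 0 T)), MemLp (u t) (ENNReal.ofReal p) volume)
    (hLi : ∫⁻ t in Icc 0 T, (eLpNorm (u t) (ENNReal.ofReal p) volume) ^ p < ∞) :
    ∃ U Uh, Repr α p T u U Uh := by
  have hp0 : 0 < p := by linarith
  have hu1 : StronglyMeasurable ((Icc 0 T).indicator u) :=
    stronglyMeasurable_indicator_of_continuousOn measurableSet_Icc hc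
  have hu2 : StronglyMeasurable fun s => (𝓕 (complexify ((Icc 0 T).indicator u s)) : HC n) :=
    ((Lp.fourierTransformₗᵢ (E n) ℂ).continuous.comp continuous_complexify).comp_stronglyMeasurable
      hu1
  obtain ⟨U₀, hU₀m, hU₀⟩ := exists_measurable_version hu1
  obtain ⟨V₀, hV₀m, hV₀⟩ := exists_measurable_version hu2
  have hU₀' : ∀ s ∈ Icc 0 T, (fun x => U₀ (s, x)) =ᵐ[volume] u s := fun s hs => by
    have := hU₀ s
    rwa [indicator_of_mem hs] at this
  have hm : Measurable fun s => ∫⁻ x, ‖U₀ (s, x)‖ₑ ^ p :=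
    Measurable.lintegral_prod_right' (f := fun z => ‖U₀ z‖ₑ ^ p) (hU₀m.enorm.pow_const p)
  have hsec : ∀ s ∈ Icc 0 T, ∫⁻ x, ‖U₀ (s, x)‖ₑ ^ p = eLpNorm (u s) (ENNReal.ofReal p) volume ^ p := by
    intro s hs
    rw [eLpNorm_ofReal_rpow hp0]
    refine lintegral_congr_ae ?_
    filter_upwards [hU₀' s hs] with x hx
    rw [hx]
  -- The exceptional times of infinite `L^p` norm are discarded, so that every section of the
  -- representative, not merely almost every one, lies in `L^p` and `L²`.
  set 𝒢 : Set ℝ := Icc 0 T ∩ {s | ∫⁻ x, ‖U₀ (s, x)‖ₑ ^ p < ∞} with h𝒢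
  have h𝒢m : MeasurableSet 𝒢 := measurableSet_Icc.inter (hm measurableSet_Iio)
  have hUm : Measurable ((𝒢 ×ˢ univ).indicator U₀) := hU₀m.indicator (h𝒢m.prod .univ)
  have hVm : Measurable ((Icc (0 : ℝ) T ×ˢ univ).indicator
      fun z : ℝ × E n => ((symbol n (α / 2) z.2 : ℝ) : ℂ) * V₀ z) :=
    Measurable.indicator (((Complex.measurable_ofReal.comp
      ((measurable_symbol _).comp measurable_snd))).mul hV₀m) (measurableSet_Icc.prod .univ)
  have hUin : ∀ s ∈ 𝒢, ∀ x, (𝒢 ×ˢ univ).indicator U₀ (s, x) = U₀ (s, x) := fun s hs x =>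
    indicator_of_mem (show (s, x) ∈ 𝒢 ×ˢ univ from ⟨hs, mem_univ _⟩) _
  have hUout : ∀ s ∉ 𝒢, ∀ x, (𝒢 ×ˢ univ).indicator U₀ (s, x) = 0 := fun s hs x =>
    indicator_of_notMem (fun h => hs h.1) _
  have hVin : ∀ s ∈ Icc 0 T, (fun η => (Icc (0 : ℝ) T ×ˢ univ).indicator
      (fun z : ℝ × E n => ((symbol n (α / 2) z.2 : ℝ) : ℂ) * V₀ z) (s, η))
      =ᵐ[volume] fracLapFourier (α / 2) (complexify (u s)) := fun s hs => by
    have h := hV₀ s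
    rw [indicator_of_mem hs] at h
    filter_upwards [h] with η hη
    rw [indicator_of_mem (show (s, η) ∈ Icc (0 : ℝ) T ×ˢ univ from ⟨hs, mem_univ _⟩)]
    simp only [hη, fracLapFourier, symbol]
  have hVout : ∀ s ∉ Icc 0 T, ∀ x, (Icc (0 : ℝ) T ×ˢ univ).indicator
      (fun z : ℝ × E n => ((symbol n (α / 2) z.2 : ℝ) : ℂ) * V₀ z) (s, x) = 0 := fun s hs x =>
    indicator_of_notMem (fun h => hs h.1) _
  have hsecm : ∀ s, AEStronglyMeasurable (fun x => (𝒢 ×ˢ univ).indicator U₀ (s, x)) volume :=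
    fun s => (hUm.comp measurable_prodMk_left).aestronglyMeasurable
  refine ⟨(𝒢 ×ˢ univ).indicator U₀, (Icc (0 : ℝ) T ×ˢ univ).indicator
    fun z : ℝ × E n => ((symbol n (α / 2) z.2 : ℝ) : ℂ) * V₀ z, hUm, hVm, ?_, ?_, ?_, ?_, hVout, ?_, ?_⟩
  · filter_upwards [hV, hL, ae_restrict_mem measurableSet_Icc] with s h1 h2 hs
    have hs𝒢 : s ∈ 𝒢 := by
      refine ⟨hs, ?_⟩
      rw [mem_ofPred_eq, hsec s hs]
      exact ENNReal.rpow_lt_top_of_nonneg hp0.le h2.eLpNorm_ne_top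
    refine ⟨?_, hVin s hs, h1, h2⟩
    simp_rw [hUin s hs𝒢]
    exact hU₀' s hs
  · intro s
    by_cases hs : s ∈ 𝒢
    · simp_rw [hUin s hs]
      exact (Lp.memLp (u s)).ae_eq (hU₀' s hs.1).symm
    · simp_rw [hUout s hs]
      exact MemLp.zero'
  · intro s
    by_cases hs : s ∈ 𝒢
    · refine ⟨hsecm s, ?_⟩
      simp_rw [hUin s hs]
      rw [eLpNorm_lt_top_iff_lintegral_rpow_enorm_lt_top (by simpa using hp0) ENNReal.ofReal_ne_top,
        ENNReal.toReal_ofReal hp0.le]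
      exact hs.2
    · simp_rw [hUout s hs]
      exact MemLp.zero'
  · exact fun s hs => hUout s fun h => hs h.1
  · refine memLp_of_lintegral_section hUm hp0 (lt_of_le_of_lt ?_ hLi)
    rw [← lintegral_indicator measurableSet_Icc]
    refine lintegral_mono fun s => ?_
    by_cases hs : s ∈ 𝒢
    · rw [indicator_of_mem hs.1, ← hsec s hs.1]
      simp_rw [hUin s hs]
      exact le_rfl
    · simp_rw [hUout s hs]
      simp [hp0]
  · have h2 : (2 : ℝ≥0∞) = ENNReal.ofReal 2 := by simp
    have key : ∀ r : ℝ≥0∞, r = ENNReal.ofReal 2 → ∀ f : ℝ × E n → ℂ,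
        MemLp f (ENNReal.ofReal 2) volume → MemLp f r volume := by
      rintro _ rfl f hf
      exact hf
    refine key 2 h2 _ (memLp_of_lintegral_section hVm two_pos (lt_of_le_of_lt ?_ hVi))
    rw [← lintegral_indicator measurableSet_Icc]
    refine lintegral_mono fun s => ?_
    by_cases hs : s ∈ Icc 0 T
    · rw [indicator_of_mem hs, ← eLpNorm_ofReal_rpow two_pos, eLpNorm_congr_ae (hVin s hs), ← h2]
      simp only [sqNormV, ENNReal.rpow_ofNat]
      exact le_add_self
    · simp_rw [hVout s hs]
      simp

namespace Repr

variable {α p T : ℝ} {u w : ℝ → H n} {U W : ℝ × E n → ℝ} {Uh Wh : ℝ × E n → ℂ}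

theorem sub (hU : Repr α p T u U Uh) (hW : Repr α p T w W Wh) :
    Repr α p T (fun s => u s - w s) (fun z => U z - W z) (fun z => Uh z - Wh z) where
  measurable_U := hU.measurable_U.sub hW.measurable_U
  measurable_Uh := hU.measurable_Uh.sub hW.measurable_Uh
  ae_eq := by
    filter_upwards [hU.ae_eq, hW.ae_eq] with s ⟨h1, h2, h3, h4⟩ ⟨k1, k2, k3, k4⟩
    refine ⟨?_, ?_, memV_sub h3 k3, (h4.sub k4).ae_eq (Lp.coeFn_sub _ _).symm⟩
    · filter_upwards [h1, k1, Lp.coeFn_sub (u s) (w s)] with x a b c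
      rw [c, a, b, Pi.sub_apply]
    · filter_upwards [h2, k2, fracLapFourier_sub (α / 2) (u s) (w s)] with x a b c
      rw [c, a, b]
  memLp_two_section s := (hU.memLp_two_section s).sub (hW.memLp_two_section s)
  memLp_section s := (hU.memLp_section s).sub (hW.memLp_section s)
  U_zero s hs x := by rw [hU.U_zero s hs, hW.U_zero s hs, sub_zero]
  Uh_zero s hs x := by rw [hU.Uh_zero s hs, hW.Uh_zero s hs, sub_zero]
  memLp_U := hU.memLp_U.sub hW.memLp_U
  memLp_Uh := hU.memLp_Uh.sub hW.memLp_Uh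

end Repr

/-! ### The drift composed with a representative -/

section Drift

/-- The composition `F(s, x, U(s, x))`, extended by zero outside `[0, T]`. -/
def drift (T : ℝ) (F : ℝ → E n → ℝ → ℝ) (U : ℝ × E n → ℝ) (z : ℝ × E n) : ℝ :=
  (Icc (0 : ℝ) T ×ˢ univ).indicator (fun z => F z.1 z.2 (U z)) z

theorem drift_of_mem {T : ℝ} {F : ℝ → E n → ℝ → ℝ} {U : ℝ × E n → ℝ} {s : ℝ} (hs : s ∈ Icc 0 T)
    (x : E n) : drift T F U (s, x) = F s x (U (s, x)) :=
  indicator_of_mem (show ((s, x) : ℝ × E n) ∈ Icc (0 : ℝ) T ×ˢ univ from ⟨hs, mem_univ _⟩) _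

theorem drift_of_notMem {T : ℝ} {F : ℝ → E n → ℝ → ℝ} {U : ℝ × E n → ℝ} {s : ℝ} (hs : s ∉ Icc 0 T)
    (x : E n) : drift T F U (s, x) = 0 :=
  indicator_of_notMem (fun h : ((s, x) : ℝ × E n) ∈ Icc (0 : ℝ) T ×ˢ univ => hs h.1) _

theorem restrict_prod_volume (A : Set ℝ) :
    (volume.restrict A).prod (volume : Measure (E n))
      = (volume : Measure (ℝ × E n)).restrict (A ×ˢ univ) := by
  rw [Measure.volume_eq_prod, ← Measure.prod_restrict, Measure.restrict_univ]

theorem exists_ae_bound {Y F : Type*} [MeasurableSpace Y] {μ : Measure Y} [NormedAddCommGroup F]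
    {f : Y → F} (hf : MemLp f ∞ μ) : ∃ C : ℝ, 0 ≤ C ∧ ∀ᵐ y ∂μ, ‖f y‖ ≤ C := by
  refine ⟨(eLpNorm f ∞ μ).toReal, ENNReal.toReal_nonneg, ?_⟩
  filter_upwards [ae_le_eLpNormEssSup (f := f) (μ := μ)] with x hx
  rw [← eLpNorm_exponent_top] at hx
  have := ENNReal.toReal_mono hf.eLpNorm_ne_top hx
  simpa using this

variable {p lam₁ lam₂ : ℝ} {ψ₁ ψ₂ ψ₃ ψ₄ : ℝ → E n → ℝ} {F : ℝ → E n → ℝ → ℝ}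

theorem DriftAssumptions.measurable_drift (hF : DriftAssumptions p lam₁ lam₂ ψ₁ ψ₂ ψ₃ ψ₄ F)
    (T : ℝ) {U : ℝ × E n → ℝ} (hU : Measurable U) : Measurable (drift T F U) := by
  refine Measurable.indicator ?_ (measurableSet_Icc.prod .univ)
  exact hF.continuous_F.measurable.comp
    (measurable_fst.prodMk (measurable_snd.prodMk hU) : Measurable fun z => (z.1, z.2, U z))

/-- Growth of order `p - 1` matches the conjugate exponent: `(p - 1) · p/(p - 1) = p`. The constant
depends on `T` but not on `U`. -/
theorem DriftAssumptions.exists_drift_bound (hF : DriftAssumptions p lam₁ lam₂ ψ₁ ψ₂ ψ₃ ψ₄ F)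
    (T : ℝ) : ∃ C : ℝ, 0 ≤ C ∧ ∀ U : ℝ × E n → ℝ, Measurable U → MemLp U (ENNReal.ofReal p) volume →
      MemLp (drift T F U) (ENNReal.ofReal (p / (p - 1))) volume ∧
      ∫ z, ‖drift T F U z‖ ^ (p / (p - 1)) ≤ C * (1 + ∫ z, ‖U z‖ ^ p) := by
  have hp := hF.two_lt_p
  have hpq := holderConjugate_conj hp
  set r := p / (p - 1) with hr
  have hr0 : 0 < r := hpq.pos
  obtain ⟨C₂, hC₂, hψ₂⟩ := exists_ae_bound (hF.mem_ψ₂ 0 T)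
  have hψ₃ := integrable_norm_rpow_ofReal hr0 (hF.mem_ψ₃ 0 T)
  rw [restrict_prod_volume] at hψ₂ hψ₃
  set S : Set (ℝ × E n) := Icc (0 : ℝ) T ×ˢ univ with hS
  have hSm : MeasurableSet S := measurableSet_Icc.prod .univ
  have hψi : 0 ≤ ∫ z in S, ‖ψ₃ z.1 z.2‖ ^ r := integral_nonneg fun z => by positivity
  refine ⟨2 ^ r * (C₂ ^ r + ∫ z in S, ‖ψ₃ z.1 z.2‖ ^ r), by positivity, fun U hUm hU => ?_⟩
  have hUi := integrable_norm_rpow_ofReal (by linarith : 0 < p) hU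
  have hDm := hF.measurable_drift T hUm
  have hbd : ∀ᵐ z ∂(volume.restrict S), ‖drift T F U z‖ ^ r
      ≤ 2 ^ r * (C₂ ^ r * ‖U z‖ ^ p + ‖ψ₃ z.1 z.2‖ ^ r) := by
    filter_upwards [hψ₂, ae_restrict_mem hSm] with z h2 hz
    have e : drift T F U z = F z.1 z.2 (U z) := indicator_of_mem hz _
    rw [e, Real.norm_eq_abs]
    have h3 := hF.growth z.1 z.2 (U z)
    have h4 : ψ₂ z.1 z.2 * |U z| ^ (p - 1) ≤ C₂ * |U z| ^ (p - 1) := by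
      have := (le_abs_self _).trans h2
      gcongr
    have h5 : |F z.1 z.2 (U z)| ≤ |C₂ * |U z| ^ (p - 1) - (-|ψ₃ z.1 z.2|)| := by
      rw [sub_neg_eq_add, abs_of_nonneg (a := C₂ * |U z| ^ (p - 1) + |ψ₃ z.1 z.2|) (by positivity)]
      linarith [le_abs_self (ψ₃ z.1 z.2)]
    have h6 := abs_sub_rpow_le hr0.le (C₂ * |U z| ^ (p - 1)) (-|ψ₃ z.1 z.2|)
    have h7 : |C₂ * |U z| ^ (p - 1)| ^ r = C₂ ^ r * |U z| ^ p := by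
      rw [abs_of_nonneg (a := C₂ * |U z| ^ (p - 1)) (by positivity), Real.mul_rpow hC₂ (by positivity),
        ← Real.rpow_mul (abs_nonneg _)]
      congr 2
      rw [hr]
      have : p - 1 ≠ 0 := by linarith
      field_simp
    rw [h7, abs_neg, abs_abs] at h6
    exact (Real.rpow_le_rpow (abs_nonneg _) h5 hr0.le).trans h6
  have hmaj : IntegrableOn (fun z => 2 ^ r * (C₂ ^ r * ‖U z‖ ^ p + ‖ψ₃ z.1 z.2‖ ^ r)) S :=
    ((hUi.integrableOn.const_mul _).add hψ₃).const_mul _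
  have hpow : Measurable fun z => ‖drift T F U z‖ ^ r := hDm.norm.pow_const r
  have hIS : IntegrableOn (fun z => ‖drift T F U z‖ ^ r) S := by
    refine Integrable.mono' hmaj hpow.aestronglyMeasurable ?_
    filter_upwards [hbd] with z hz
    rwa [Real.norm_of_nonneg (by positivity)]
  have hz0 : ∀ z, z ∉ S → ‖drift T F U z‖ ^ r = 0 := fun z hz => by
    have e : drift T F U z = 0 := indicator_of_notMem hz _
    rw [e, norm_zero, Real.zero_rpow hr0.ne']
  refine ⟨?_, ?_⟩
  · rw [← integrable_norm_rpow_iff hDm.aestronglyMeasurable (by simpa using hr0)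
      ENNReal.ofReal_ne_top, ENNReal.toReal_ofReal hr0.le]
    exact hIS.integrable_of_forall_notMem_eq_zero hz0
  · rw [← setIntegral_eq_integral_of_forall_compl_eq_zero hz0]
    refine (setIntegral_mono_ae_restrict hIS hmaj hbd).trans ?_
    rw [integral_const_mul, integral_add (hUi.integrableOn.const_mul _) hψ₃, integral_const_mul]
    have j1 : ∫ z in S, ‖U z‖ ^ p ≤ ∫ z, ‖U z‖ ^ p :=
      setIntegral_le_integral hUi (Eventually.of_forall fun z => by positivity)
    have j2 : 0 ≤ ∫ z, ‖U z‖ ^ p := integral_nonneg fun z => by positivity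
    have j3 : 0 ≤ C₂ ^ r := by positivity
    rw [mul_assoc]
    refine mul_le_mul_of_nonneg_left ?_ (by positivity)
    nlinarith [mul_le_mul_of_nonneg_left j1 j3, mul_nonneg hψi j2]

end Drift

end FracRD

namespace FracRD

variable {n : ℕ}

/-! ### Contracting `L²(ℝⁿ; l²)` with a sequence -/

section Contract

/-- The function `x ↦ ⟪S x, v⟫` of `L²(ℝⁿ)`, as a continuous bilinear map. -/
def contract (n : ℕ) : HSeq n →L[ℝ] SeqL2 →L[ℝ] H n :=
  LinearMap.mkContinuous₂
    (LinearMap.mk₂ ℝ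
      (fun (S : HSeq n) (v : SeqL2) => (innerSL ℝ v).compLp S)
      (fun S S' v => map_add ((innerSL ℝ v).compLpL 2 volume) S S')
      (fun c S v => map_smul ((innerSL ℝ v).compLpL 2 volume) c S)
      (fun S v v' => by
        rw [map_add, ContinuousLinearMap.add_compLp])
      (fun c S v => by
        rw [map_smul, ContinuousLinearMap.smul_compLp]))
    1 (fun S v => by
      rw [one_mul, mul_comm]
      refine (ContinuousLinearMap.norm_compLp_le _ _).trans ?_
      rw [innerSL_apply_norm])

theorem coeFn_contract (S : HSeq n) (v : SeqL2) :
    contract n S v =ᵐ[volume] fun x => inner ℝ v (S x) :=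
  ContinuousLinearMap.coeFn_compLp' (innerSL ℝ v) S

theorem norm_contract_le (S : HSeq n) (v : SeqL2) : ‖contract n S v‖ ≤ ‖S‖ * ‖v‖ := by
  rw [mul_comm]
  refine (ContinuousLinearMap.norm_compLp_le (innerSL ℝ v) S).trans ?_
  rw [innerSL_apply_norm]

/-- Adjointness of `contract` and `tensor`: the first form is suited to an `H`-valued forcing term,
the second to weak limits in the control. -/
theorem inner_contract (S : HSeq n) (v : SeqL2) (ξ : H n) :
    inner ℝ (contract n S v) ξ = inner ℝ S (tensor n ξ v) := by
  rw [L2.inner_def, L2.inner_def]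
  refine integral_congr_ae ?_
  filter_upwards [coeFn_contract S v, coeFn_tensor ξ v] with x h1 h2
  rw [h1, h2, inner_smul_right, real_inner_comm v]
  simp

end Contract

/-! ### The noise along a trajectory -/

section NoiseTime

variable {α p q T : ℝ} {κ : E n → ℝ} {σ₁ : ℝ → HSeq n} {σ₂ : ℕ → ℝ → E n → ℝ → ℝ} {a b c : ℕ → ℝ}
  {u : ℝ → H n} {U : ℝ × E n → ℝ} {Uh : ℝ × E n → ℂ}

theorem Repr.integrable_section (hU : Repr α p T u U Uh) (hp : 2 < p) (s : ℝ) :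
    Integrable fun x => |U (s, x)| ^ p := by
  simpa using integrable_norm_rpow_ofReal (by linarith) (hU.memLp_section s)

theorem Repr.integrable_rpow (hU : Repr α p T u U Uh) (hp : 2 < p) :
    Integrable fun z => ‖U z‖ ^ p :=
  integrable_norm_rpow_ofReal (by linarith) hU.memLp_U

theorem Repr.integrable_sq (hU : Repr α p T u U Uh) : Integrable fun z => ‖Uh z‖ ^ 2 :=
  (memLp_two_iff_integrable_sq_norm hU.measurable_Uh.aestronglyMeasurable).1 hU.memLp_Uh

/-- Replace `u` and `κ` by measurable versions; the result is jointly measurable with all sections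
in `L²`, so `stronglyMeasurable_toLp` applies. -/
theorem NoiseAssumptions.aestronglyMeasurable_noise (hσ : NoiseAssumptions p q κ σ₁ σ₂ a b c)
    (hp : 2 < p) (hU : Repr α p T u U Uh) :
    AEStronglyMeasurable (fun s => noise κ σ₁ σ₂ s (u s)) (volume.restrict (Icc 0 T)) := by
  obtain ⟨κ', hκ', hκκ'⟩ := hσ.κ_mem_two.1
  obtain ⟨K, -, hK⟩ := hσ.exists_smul_noiseSeq_bound hp
  let f : ℝ → E n → SeqL2 := fun s x => κ' x • noiseSeq σ₂ s x (U (s, x))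
  have hfm : StronglyMeasurable (Function.uncurry f) := by
    have h : Measurable fun z : ℝ × E n => ((z.1, z.2, U z) : ℝ × E n × ℝ) :=
      measurable_fst.prodMk (measurable_snd.prodMk hU.measurable_U)
    have h2 := StronglyMeasurable.comp_measurable
      (f := fun z : ℝ × E n × ℝ => noiseSeq σ₂ z.1 z.2.1 z.2.2)
      (g := fun z : ℝ × E n => ((z.1, z.2, U z) : ℝ × E n × ℝ)) hσ.stronglyMeasurable_noiseSeq h
    exact (hκ'.comp_measurable measurable_snd).smul h2
  have hfp : ∀ s, MemLp (f s) 2 volume := fun s => by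
    refine (hK s (fun x => U (s, x)) (hU.memLp_two_section s)
      (hU.integrable_section hp s)).1.ae_eq ?_
    filter_upwards [hκκ'] with x hx
    simp only [f, hx]
  have h1 := (hσ.mem_σ₁ 0 T).1.add
    (stronglyMeasurable_toLp (by norm_num) hfm hfp).aestronglyMeasurable
  refine h1.congr ?_
  filter_upwards [hU.ae_eq] with s ⟨e1, _, _, hL⟩
  refine Lp.ext ?_
  filter_upwards [hσ.coeFn_noise hp s hL, e1, hκκ', (hfp s).coeFn_toLp,
    Lp.coeFn_add (σ₁ s) ((hfp s).toLp (f s))] with x g1 g2 g3 g4 g5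
  simp only [Pi.add_apply]
  rw [g1, g5, Pi.add_apply, g4, g3]
  simp only [f, g2]

theorem NoiseAssumptions.exists_norm_noise_sq_le_repr (hσ : NoiseAssumptions p q κ σ₁ σ₂ a b c)
    (hp : 2 < p) (T : ℝ) : ∃ K : ℝ, 0 ≤ K ∧ ∀ (α : ℝ) (u : ℝ → H n) (U : ℝ × E n → ℝ)
      (Uh : ℝ × E n → ℂ), Repr α p T u U Uh → ∀ N > 0, ∀ᵐ s ∂(volume.restrict (Icc 0 T)),
      ‖noise κ σ₁ σ₂ s (u s)‖ ^ 2
        ≤ K * (1 + N ^ (q - p) * (∫ x, ‖U (s, x)‖ ^ p) + N ^ (q - 2) * ‖u s‖ ^ 2) := by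
  obtain ⟨C, hC, hC'⟩ := exists_ae_bound (hσ.mem_σ₁ 0 T)
  obtain ⟨K, hK0, hK⟩ := hσ.exists_norm_noise_sq_le hp
  refine ⟨2 * C ^ 2 + K, by positivity, fun α u U Uh hU N hN => ?_⟩
  filter_upwards [hU.ae_eq, hC'] with s ⟨e1, _, _, hL⟩ hs
  have h := hK s (u s) hL N hN
  have e : ∫ x, |u s x| ^ p = ∫ x, ‖U (s, x)‖ ^ p := by
    refine integral_congr_ae ?_
    filter_upwards [e1] with x hx
    rw [hx, Real.norm_eq_abs]
  rw [e] at h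
  have h1 : ‖σ₁ s‖ ^ 2 ≤ C ^ 2 := by gcongr
  have j1 : 0 ≤ ∫ x, ‖U (s, x)‖ ^ p := integral_nonneg fun x => by positivity
  have j2 : 0 ≤ N ^ (q - p) * ∫ x, ‖U (s, x)‖ ^ p := by positivity
  have j3 : 0 ≤ N ^ (q - 2) * ‖u s‖ ^ 2 := by positivity
  nlinarith [mul_nonneg (sq_nonneg C) (add_nonneg j2 j3)]

theorem Repr.integrableOn_section (hU : Repr α p T u U Uh) (hp : 2 < p) :
    Integrable fun s => ∫ x, ‖U (s, x)‖ ^ p := by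
  have := hU.integrable_rpow hp
  rw [Measure.volume_eq_prod] at this
  exact this.integral_prod_left

theorem NoiseAssumptions.memLp_noise (hσ : NoiseAssumptions p q κ σ₁ σ₂ a b c)
    (hp : 2 < p) (hU : Repr α p T u U Uh) (hc : ContinuousOn u (Icc 0 T)) :
    MemLp (fun s => noise κ σ₁ σ₂ s (u s)) 2 (volume.restrict (Icc 0 T)) := by
  have hm := hσ.aestronglyMeasurable_noise hp hU
  obtain ⟨K, hK0, hK⟩ := hσ.exists_norm_noise_sq_le_repr hp T
  rw [memLp_two_iff_integrable_sq_norm hm]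
  refine Integrable.mono' (g := fun s => K * (1 + 1 ^ (q - p) * (∫ x, ‖U (s, x)‖ ^ p)
    + 1 ^ (q - 2) * ‖u s‖ ^ 2)) ?_ (hm.norm.pow 2) ?_
  · refine Integrable.const_mul (Integrable.add (Integrable.add ?_ ?_) ?_) K
    · exact integrable_const _
    · exact (hU.integrableOn_section hp).integrableOn.const_mul _
    · exact Integrable.const_mul ((hc.norm.pow 2).integrableOn_compact isCompact_Icc) _
  · filter_upwards [hK α u U Uh hU 1 one_pos] with s hs
    rwa [Real.norm_of_nonneg (by positivity)]

theorem integrable_contract {S : ℝ → HSeq n} (hS : MemLp S 2 (volume.restrict (Icc 0 T)))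
    (v : Control T) :
    IntegrableOn (fun s => contract n (S s) (v s)) (Icc 0 T) := by
  have hv := Lp.memLp v
  refine Integrable.mono' (hS.norm.integrable_mul hv.norm) ?_
    (Eventually.of_forall fun s => norm_contract_le _ _)
  exact (contract n).aestronglyMeasurable_comp₂ hS.1 hv.1

end NoiseTime

/-! ### The weak equation for a solution and for a difference of solutions -/

section Equation

variable {α p q T : ℝ} {lam₁ lam₂ : ℝ} {ψ₁ ψ₂ ψ₃ ψ₄ : ℝ → E n → ℝ} {F : ℝ → E n → ℝ → ℝ}
  {g : ℝ → H n} {κ : E n → ℝ} {σ₁ : ℝ → HSeq n} {σ₂ : ℕ → ℝ → E n → ℝ → ℝ} {a b c : ℕ → ℝ}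
  {u₀ : H n}

/-- The integrand of the weak formulation, tested with `ξ`. -/
def weakRhs (α : ℝ) (Wh : ℝ × E n → ℂ) (Φ : ℝ × E n → ℝ) (G : ℝ → H n) (ξ : H n) (s : ℝ) : ℝ :=
  -(∫ η, starRingEnd ℂ (Wh (s, η)) * fracLapFourier (α / 2) (complexify ξ) η).re
    - (∫ x, Φ (s, x) * ξ x) + inner ℝ (G s) ξ

theorem IsSolution.exists_repr (hp : 2 < p) {v : Control T} {u : ℝ → H n}
    (hu : IsSolution α p T F g κ σ₁ σ₂ u₀ v u) : ∃ U Uh, Repr α p T u U Uh :=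
  FracRD.exists_repr hp hu.continuousOn hu.ae_memV hu.lintegral_V hu.ae_memLp hu.lintegral_Lp

theorem IsSolution.weak_equation (hF : DriftAssumptions p lam₁ lam₂ ψ₁ ψ₂ ψ₃ ψ₄ F)
    (hσ : NoiseAssumptions p q κ σ₁ σ₂ a b c) {v : Control T} {u : ℝ → H n}
    (hu : IsSolution α p T F g κ σ₁ σ₂ u₀ v u) {U : ℝ × E n → ℝ} {Uh : ℝ × E n → ℂ}
    (hU : Repr α p T u U Uh) {ξ : H n} (hξV : MemV α ξ) (hξp : MemLp ξ (ENNReal.ofReal p) volume) :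
    IntegrableOn (weakRhs α Uh (drift T F U)
      (fun s => contract n (noise κ σ₁ σ₂ s (u s)) (v s)) ξ) (Icc 0 T) ∧
    ∀ t ∈ Icc 0 T, inner ℝ (u t) ξ = inner ℝ u₀ ξ + (∫ s in (0 : ℝ)..t, inner ℝ (g s) ξ)
      + ∫ s in Icc 0 t, weakRhs α Uh (drift T F U)
        (fun s => contract n (noise κ σ₁ σ₂ s (u s)) (v s)) ξ s := by
  have hp := hF.two_lt_p
  obtain ⟨C, -, hC⟩ := hF.exists_drift_bound T
  obtain ⟨hΦ, -⟩ := hC U hU.measurable_U hU.memLp_U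
  have hG := integrable_contract (hσ.memLp_noise hp hU hu.continuousOn) v
  -- The forcing slot is filled with zero: the contracted noise is known to be integrable only on
  -- `[0, T]` and is treated separately in `b3`.
  obtain ⟨b1, b2, -⟩ := weak_integrable (T := T) hp hU.memLp_Uh hΦ (integrable_zero ℝ (H n) volume)
    hξV hξp
  have b3 : IntegrableOn (fun s => (inner ℝ (contract n (noise κ σ₁ σ₂ s (u s)) (v s)) ξ : ℝ))
    (Icc 0 T) := hG.inner_const ξ
  refine ⟨(b1.neg.sub b2).add b3, fun t ht => ?_⟩
  have hsub : Icc 0 t ⊆ Icc 0 T := Icc_subset_Icc_right ht.2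
  have hae := ae_mono (Measure.restrict_mono hsub le_rfl) hU.ae_eq
  have e1 : ∫ s in (0 : ℝ)..t, fracForm α (u s) ξ = ∫ s in Icc 0 t,
      (∫ η, starRingEnd ℂ (Uh (s, η)) * fracLapFourier (α / 2) (complexify ξ) η).re := by
    rw [intervalIntegral.integral_of_le ht.1, ← integral_Icc_eq_integral_Ioc]
    refine integral_congr_ae ?_
    filter_upwards [hae] with s ⟨_, h2, h3, _⟩
    rw [fracForm_eq h3 hξV]
    congr 1
    refine integral_congr_ae ?_
    filter_upwards [h2] with η hη
    rw [hη]
  have e2 : ∫ s in (0 : ℝ)..t, ∫ x, F s x (u s x) * ξ x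
      = ∫ s in Icc 0 t, ∫ x, drift T F U (s, x) * ξ x := by
    rw [intervalIntegral.integral_of_le ht.1, ← integral_Icc_eq_integral_Ioc]
    refine integral_congr_ae ?_
    filter_upwards [hae, ae_restrict_mem measurableSet_Icc] with s ⟨h1, _, _, _⟩ hs
    refine integral_congr_ae ?_
    filter_upwards [h1] with x hx
    rw [drift_of_mem (hsub hs), hx]
  have e3 : ∫ s in (0 : ℝ)..t, ∫ x, diffusion κ σ₁ σ₂ s (u s) (v s) x * ξ x
      = ∫ s in Icc 0 t, inner ℝ (contract n (noise κ σ₁ σ₂ s (u s)) (v s)) ξ := by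
    rw [intervalIntegral.integral_of_le ht.1, ← integral_Icc_eq_integral_Ioc]
    refine integral_congr_ae ?_
    filter_upwards [hae] with s ⟨_, _, _, h4⟩
    rw [hσ.integral_diffusion_mul hp s h4, inner_contract]
  have heq := hu.equation t ht ξ hξV hξp
  rw [e1, e2, e3] at heq
  have b1' := b1.mono_set hsub
  have b2' := b2.mono_set hsub
  have b3' := b3.mono_set hsub
  have b12 : IntegrableOn (fun s => -(∫ η, starRingEnd ℂ (Uh (s, η))
      * fracLapFourier (α / 2) (complexify ξ) η).re - ∫ x, drift T F U (s, x) * ξ x) (Icc 0 t) :=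
    b1'.neg.sub b2'
  have b11 : IntegrableOn (fun s => -(∫ η, starRingEnd ℂ (Uh (s, η))
      * fracLapFourier (α / 2) (complexify ξ) η).re) (Icc 0 t) := b1'.neg
  unfold weakRhs
  rw [integral_add b12 b3', integral_sub b11 b2', integral_neg]
  linarith

theorem weakRhs_sub_ae (hp : 2 < p) {Wh₁ Wh₂ : ℝ × E n → ℂ} {Φ₁ Φ₂ : ℝ × E n → ℝ} {G₁ G₂ G : ℝ → H n}
    (m₁ : Measurable Wh₁) (m₂ : Measurable Wh₂) (n₁ : Measurable Φ₁) (n₂ : Measurable Φ₂)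
    (h₁ : MemLp Wh₁ 2 volume) (h₂ : MemLp Wh₂ 2 volume)
    (k₁ : MemLp Φ₁ (ENNReal.ofReal (p / (p - 1))) volume)
    (k₂ : MemLp Φ₂ (ENNReal.ofReal (p / (p - 1))) volume)
    (hG : ∀ᵐ s ∂(volume.restrict (Icc 0 T)), G s = G₁ s - G₂ s)
    {ξ : H n} (hξV : MemV α ξ) (hξp : MemLp ξ (ENNReal.ofReal p) volume) :
    ∀ᵐ s ∂(volume.restrict (Icc 0 T)),
      weakRhs α (fun z => Wh₁ z - Wh₂ z) (fun z => Φ₁ z - Φ₂ z) G ξ s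
        = weakRhs α Wh₁ Φ₁ G₁ ξ s - weakRhs α Wh₂ Φ₂ G₂ ξ s := by
  have htri := holderTriple_ofReal hp
  have hr0 := (holderConjugate_conj hp).pos
  have hξV' : MemLp (fracLapFourier (α / 2) (complexify ξ)) 2 (volume : Measure (E n)) := hξV
  have s1 := ae_memLp_section m₁ two_pos (by simpa using h₁)
  have s2 := ae_memLp_section m₂ two_pos (by simpa using h₂)
  have s3 := ae_memLp_section n₁ hr0 k₁
  have s4 := ae_memLp_section n₂ hr0 k₂
  filter_upwards [ae_restrict_of_ae s1, ae_restrict_of_ae s2, ae_restrict_of_ae s3,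
    ae_restrict_of_ae s4, hG] with s a1 a2 a3 a4 a5
  simp only [ENNReal.ofReal_ofNat] at a1 a2
  have t1 : MemLp (fun η => starRingEnd ℂ (Wh₁ (s, η))) 2 volume := a1.star
  have t2 : MemLp (fun η => starRingEnd ℂ (Wh₂ (s, η))) 2 volume := a2.star
  have i1 : Integrable (fun η => starRingEnd ℂ (Wh₁ (s, η))
    * fracLapFourier (α / 2) (complexify ξ) η) := MemLp.integrable_mul t1 hξV'
  have i2 : Integrable (fun η => starRingEnd ℂ (Wh₂ (s, η))
    * fracLapFourier (α / 2) (complexify ξ) η) := MemLp.integrable_mul t2 hξV'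
  have i3 : Integrable (fun x => Φ₁ (s, x) * ξ x) := MemLp.integrable_mul a3 hξp
  have i4 : Integrable (fun x => Φ₂ (s, x) * ξ x) := MemLp.integrable_mul a4 hξp
  unfold weakRhs
  simp only [map_sub, sub_mul]
  rw [integral_sub i1 i2, integral_sub i3 i4, a5, inner_sub_left, Complex.sub_re]
  ring

/-- The equation satisfied by the difference of two solutions. -/
theorem IsSolution.exists_difference (hF : DriftAssumptions p lam₁ lam₂ ψ₁ ψ₂ ψ₃ ψ₄ F)
    (hσ : NoiseAssumptions p q κ σ₁ σ₂ a b c) {v v' : Control T} {u u' : ℝ → H n}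
    (hu : IsSolution α p T F g κ σ₁ σ₂ u₀ v u) (hu' : IsSolution α p T F g κ σ₁ σ₂ u₀ v' u')
    {U U' : ℝ × E n → ℝ} {Uh Uh' : ℝ × E n → ℂ}
    (hU : Repr α p T u U Uh) (hU' : Repr α p T u' U' Uh') :
    ∃ G : ℝ → H n, StronglyMeasurable G ∧ Integrable G ∧ (∀ s ∉ Icc 0 T, G s = 0) ∧
      (∀ᵐ s ∂(volume.restrict (Icc 0 T)), G s = contract n (noise κ σ₁ σ₂ s (u s)) (v s)
        - contract n (noise κ σ₁ σ₂ s (u' s)) (v' s)) ∧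
      ∀ t ∈ Icc 0 T, ∀ ξ : H n, MemV α ξ → MemLp ξ (ENNReal.ofReal p) volume →
        inner ℝ (u t - u' t) ξ = ∫ s in (0 : ℝ)..t, weakRhs α (fun z => Uh z - Uh' z)
          (fun z => drift T F U z - drift T F U' z) G ξ s := by
  have hp := hF.two_lt_p
  have hG := (integrable_contract (hσ.memLp_noise hp hU hu.continuousOn) v).sub
    (integrable_contract (hσ.memLp_noise hp hU' hu'.continuousOn) v')
  obtain ⟨G₀, hG₀m, hG₀⟩ := hG.1
  have hGae : ∀ᵐ s ∂(volume.restrict (Icc 0 T)), (Icc 0 T).indicator G₀ s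
      = contract n (noise κ σ₁ σ₂ s (u s)) (v s) - contract n (noise κ σ₁ σ₂ s (u' s)) (v' s) := by
    filter_upwards [hG₀, ae_restrict_mem measurableSet_Icc] with s h1 h2
    rw [indicator_of_mem h2, ← h1]
    rfl
  refine ⟨(Icc 0 T).indicator G₀, hG₀m.indicator measurableSet_Icc, ?_,
    fun s hs => indicator_of_notMem hs _, hGae, fun t ht ξ hξV hξp => ?_⟩
  · rw [integrable_indicator_iff measurableSet_Icc]
    exact hG.congr hG₀
  · obtain ⟨C, -, hC⟩ := hF.exists_drift_bound T
    obtain ⟨i1, e1⟩ := hu.weak_equation hF hσ hU hξV hξp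
    obtain ⟨i2, e2⟩ := hu'.weak_equation hF hσ hU' hξV hξp
    have hsub : Icc 0 t ⊆ Icc 0 T := Icc_subset_Icc_right ht.2
    have hae := weakRhs_sub_ae hp hU.measurable_Uh hU'.measurable_Uh
      (hF.measurable_drift T hU.measurable_U) (hF.measurable_drift T hU'.measurable_U) hU.memLp_Uh
      hU'.memLp_Uh (hC U hU.measurable_U hU.memLp_U).1 (hC U' hU'.measurable_U hU'.memLp_U).1
      hGae hξV hξp
    rw [intervalIntegral.integral_of_le ht.1, ← integral_Icc_eq_integral_Ioc,
      integral_congr_ae (ae_mono (Measure.restrict_mono hsub le_rfl) hae),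
      integral_sub (i1.mono_set hsub) (i2.mono_set hsub), inner_sub_left, e1 t ht, e2 t ht]
    ring

/-- At time zero all integrals vanish, and `V ∩ L^p` is dense in `H`. -/
theorem IsSolution.eq_init (hα : α ∈ Ioo (0 : ℝ) 1) (hT : 0 < T) {v : Control T} {u : ℝ → H n}
    (hu : IsSolution α p T F g κ σ₁ σ₂ u₀ v u) : u 0 = u₀ := by
  refine (dense_memV_memLp hα (ENNReal.ofReal p)).eq_of_inner_left (𝕜 := ℝ) fun ξ hξ => ?_
  have := hu.equation 0 ⟨le_rfl, hT.le⟩ ξ hξ.1 hξ.2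
  simpa using this

end Equation

end FracRD

namespace FracRD

variable {n : ℕ}

/-! ### The weighted distance that measures the strong monotonicity -/

section Weighted

variable {α p T : ℝ} {u u' : ℝ → H n} {U U' : ℝ × E n → ℝ} {Uh Uh' : ℝ × E n → ℂ}

/-- The weighted distance `∫ (|U|^{p-2} + |U'|^{p-2}) |U - U'|²` of two functions at time `s`. -/
def weightDist (p : ℝ) (U U' : ℝ × E n → ℝ) (s : ℝ) : ℝ :=
  ∫ x, (|U (s, x)| ^ (p - 2) + |U' (s, x)| ^ (p - 2)) * |U (s, x) - U' (s, x)| ^ 2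

theorem weightDist_nonneg (p : ℝ) (U U' : ℝ × E n → ℝ) (s : ℝ) : 0 ≤ weightDist p U U' s :=
  integral_nonneg fun x => by positivity

theorem Repr.measurable_weight (hU : Repr α p T u U Uh) (hU' : Repr α p T u' U' Uh') :
    Measurable fun z => (|U z| ^ (p - 2) + |U' z| ^ (p - 2)) * |U z - U' z| ^ 2 := by
  have h1 := hU.measurable_U
  have h2 := hU'.measurable_U
  exact ((h1.abs.pow_const _).add (h2.abs.pow_const _)).mul ((h1.sub h2).abs.pow_const _)

theorem Repr.integrable_weight (hU : Repr α p T u U Uh) (hU' : Repr α p T u' U' Uh')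
    (hp : 2 < p) :
    Integrable fun z => (|U z| ^ (p - 2) + |U' z| ^ (p - 2)) * |U z - U' z| ^ 2 := by
  refine Integrable.mono' (((hU.integrable_rpow hp).add (hU'.integrable_rpow hp)).const_mul 8)
    (hU.measurable_weight hU').aestronglyMeasurable (Eventually.of_forall fun z => ?_)
  rw [Real.norm_of_nonneg (by positivity)]
  exact weight_le hp _ _

theorem Repr.integrable_weight_section (hU : Repr α p T u U Uh) (hU' : Repr α p T u' U' Uh')
    (hp : 2 < p) (s : ℝ) :
    Integrable fun x =>
      (|U (s, x)| ^ (p - 2) + |U' (s, x)| ^ (p - 2)) * |U (s, x) - U' (s, x)| ^ 2 := by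
  refine Integrable.mono' (((hU.integrable_section hp s).add
    (hU'.integrable_section hp s)).const_mul 8)
    ((hU.measurable_weight hU').comp measurable_prodMk_left).aestronglyMeasurable
    (Eventually.of_forall fun z => ?_)
  rw [Real.norm_of_nonneg (by positivity)]
  exact weight_le hp _ _

theorem Repr.integrable_weightDist (hU : Repr α p T u U Uh) (hU' : Repr α p T u' U' Uh')
    (hp : 2 < p) : Integrable (weightDist p U U') := by
  have := hU.integrable_weight hU' hp
  rw [Measure.volume_eq_prod] at this
  exact this.integral_prod_left

end Weighted

theorem integrableOn_inner_mul {T : ℝ} {G w : ℝ → H n} (hG : IntegrableOn G (Icc 0 T))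
    (hw : ContinuousOn w (Icc 0 T)) : IntegrableOn (fun s => (inner ℝ (G s) (w s) : ℝ)) (Icc 0 T) := by
  obtain ⟨M, hM⟩ := (isCompact_Icc.image_of_continuousOn hw).isBounded.exists_norm_le
  refine Integrable.mono' (hG.norm.mul_const M)
    (hG.1.inner (hw.aestronglyMeasurable measurableSet_Icc)) ?_
  filter_upwards [ae_restrict_mem measurableSet_Icc] with s hs
  refine (norm_inner_le_norm _ _).trans ?_
  gcongr
  exact hM _ ⟨s, hs, rfl⟩

/-! ### The basic inequality for two solutions -/

section Basic

variable {α p q T : ℝ} {lam₁ lam₂ : ℝ} {ψ₁ ψ₂ ψ₃ ψ₄ : ℝ → E n → ℝ} {F : ℝ → E n → ℝ → ℝ}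
  {g : ℝ → H n} {κ : E n → ℝ} {σ₁ : ℝ → HSeq n} {σ₂ : ℕ → ℝ → E n → ℝ → ℝ} {a b c : ℕ → ℝ}
  {u₀ : H n}

/-- The monotonicity assumption combined with `rpow_mul_self_monotone`, integrated in space; the
factor 1/2 of the latter produces `lam₂ / 2`. -/
theorem DriftAssumptions.exists_le_integral_drift_mul
    (hF : DriftAssumptions p lam₁ lam₂ ψ₁ ψ₂ ψ₃ ψ₄ F) (T : ℝ) : ∃ C : ℝ, 0 ≤ C ∧
      ∀ (α : ℝ) (u u' : ℝ → H n) (U U' : ℝ × E n → ℝ) (Uh Uh' : ℝ × E n → ℂ),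
      Repr α p T u U Uh → Repr α p T u' U' Uh' → ∀ᵐ s ∂(volume.restrict (Icc 0 T)),
        lam₂ / 2 * weightDist p U U' s - C * ‖u s - u' s‖ ^ 2
          ≤ ∫ x, (drift T F U (s, x) - drift T F U' (s, x)) * (U (s, x) - U' (s, x)) := by
  have hp := hF.two_lt_p
  have hpq := holderConjugate_conj hp
  have htri := holderTriple_ofReal hp
  obtain ⟨C₄, hC₄, hψ₄⟩ := exists_ae_bound (hF.mem_ψ₄ 0 T)
  obtain ⟨C, -, hC⟩ := hF.exists_drift_bound T
  refine ⟨C₄, hC₄, fun α u u' U U' Uh Uh' hU hU' => ?_⟩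
  have d1 := ae_memLp_section (hF.measurable_drift T hU.measurable_U) hpq.pos
    (hC U hU.measurable_U hU.memLp_U).1
  have d2 := ae_memLp_section (hF.measurable_drift T hU'.measurable_U) hpq.pos
    (hC U' hU'.measurable_U hU'.memLp_U).1
  filter_upwards [Measure.ae_ae_of_ae_prod hψ₄, ae_restrict_of_ae d1, ae_restrict_of_ae d2,
    ae_restrict_mem measurableSet_Icc, hU.ae_eq, hU'.ae_eq] with s h4 m1 m2 hs ⟨e1, _⟩ ⟨e2, _⟩
  have i0 := hU.integrable_weight_section hU' hp s
  have l2 : MemLp (fun x => U (s, x) - U' (s, x)) 2 volume :=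
    (hU.memLp_two_section s).sub (hU'.memLp_two_section s)
  have i1 : Integrable fun x => ‖U (s, x) - U' (s, x)‖ ^ 2 :=
    (memLp_two_iff_integrable_sq_norm l2.1).1 l2
  have i2 : Integrable fun x =>
      (drift T F U (s, x) - drift T F U' (s, x)) * (U (s, x) - U' (s, x)) :=
    MemLp.integrable_mul (m1.sub m2) ((hU.memLp_section s).sub (hU'.memLp_section s))
  have hn2 : ‖u s - u' s‖ ^ 2 = ∫ x, ‖U (s, x) - U' (s, x)‖ ^ 2 := by
    rw [← real_inner_self_eq_norm_sq, L2.inner_def]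
    refine integral_congr_ae ?_
    filter_upwards [e1, e2, Lp.coeFn_sub (u s) (u' s)] with x h1 h2 h3
    rw [real_inner_self_eq_norm_sq, h3, Pi.sub_apply, h1, h2]
  rw [hn2, weightDist, ← integral_const_mul, ← integral_const_mul,
    ← integral_sub (i0.const_mul _) (i1.const_mul _)]
  refine integral_mono_ae ((i0.const_mul _).sub (i1.const_mul _)) i2 ?_
  filter_upwards [h4] with x hx
  rw [drift_of_mem hs, drift_of_mem hs]
  have k1 := hF.monotone s x (U (s, x)) (U' (s, x))
  have k2 := rpow_mul_self_monotone hp (U (s, x)) (U' (s, x))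
  have k3 : ψ₄ s x * |U (s, x) - U' (s, x)| ^ 2 ≤ C₄ * |U (s, x) - U' (s, x)| ^ 2 := by
    gcongr
    exact (le_abs_self _).trans hx
  have k4 := mul_le_mul_of_nonneg_left k2 hF.lam₂_pos.le
  simp only [Real.norm_eq_abs]
  linarith

/-- The stochastic-type remainder `⟪σ(s, u') (v - v'), u - u'⟫`. -/
def remainder (κ : E n → ℝ) (σ₁ : ℝ → HSeq n) (σ₂ : ℕ → ℝ → E n → ℝ → ℝ) (u u' : ℝ → H n)
    (v v' : ℝ → SeqL2) (s : ℝ) : ℝ :=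
  inner ℝ (noise κ σ₁ σ₂ s (u' s)) (tensor n (u s - u' s) (v s - v' s))

theorem integrableOn_inner_tensor {S : ℝ → HSeq n} (hS : MemLp S 2 (volume.restrict (Icc 0 T)))
    {w : ℝ → H n} (hw : ContinuousOn w (Icc 0 T)) (v v' : Control T) :
    IntegrableOn (fun s => (inner ℝ (S s) (tensor n (w s) (v s - v' s)) : ℝ)) (Icc 0 T) := by
  have h := integrableOn_inner_mul ((integrable_contract hS v).sub (integrable_contract hS v')) hw
  refine h.congr (Eventually.of_forall fun s => ?_)
  simp only [Pi.sub_apply]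
  rw [← map_sub, inner_contract]

theorem integrableOn_one_add_norm_sq_mul {w : ℝ → H n} (hw : ContinuousOn w (Icc 0 T))
    (v : Control T) : IntegrableOn (fun s => (1 + ‖v s‖ ^ 2) * ‖w s‖ ^ 2) (Icc 0 T) := by
  have hv : IntegrableOn (fun s => 1 + ‖v s‖ ^ 2) (Icc 0 T) :=
    (integrable_const _).add ((memLp_two_iff_integrable_sq_norm (Lp.memLp v).1).1 (Lp.memLp v))
  exact hv.mul_continuousOn (hw.norm.pow 2) isCompact_Icc

set_option maxHeartbeats 1000000 in
-- Energy inequality for the difference, with `σ(u)v - σ(u')v'` written as `(σ(u) - σ(u'))v +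
-- σ(u')(v - v')`. The first part is absorbed by the drift, and the second is `remainder`. The noise
-- is evaluated there at `u'`, which will be the limit and does not vary with `j`.
theorem exists_basic_inequality (hα : α ∈ Ioo (0 : ℝ) 1) (hT : 0 < T)
    (hF : DriftAssumptions p lam₁ lam₂ ψ₁ ψ₂ ψ₃ ψ₄ F)
    (hσ : NoiseAssumptions p q κ σ₁ σ₂ a b c) : ∃ C : ℝ, 0 ≤ C ∧
      ∀ (v v' : Control T) (u u' : ℝ → H n) (U U' : ℝ × E n → ℝ) (Uh Uh' : ℝ × E n → ℂ),
      IsSolution α p T F g κ σ₁ σ₂ u₀ v u → IsSolution α p T F g κ σ₁ σ₂ u₀ v' u' →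
      Repr α p T u U Uh → Repr α p T u' U' Uh' → ∀ t ∈ Icc 0 T,
        ‖u t - u' t‖ ^ 2 + 2 * (∫ s in Icc 0 t, ∫ η, ‖Uh (s, η) - Uh' (s, η)‖ ^ 2)
          + lam₂ / 2 * (∫ s in Icc 0 t, weightDist p U U' s)
        ≤ C * (∫ s in Icc 0 t, (1 + ‖v s‖ ^ 2) * ‖u s - u' s‖ ^ 2)
          + 2 * ∫ s in Icc 0 t, remainder κ σ₁ σ₂ u u' v v' s := by
  have hp := hF.two_lt_p
  have hlam := hF.lam₂_pos
  obtain ⟨C₁, hC₁, hdrift⟩ := hF.exists_le_integral_drift_mul T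
  -- The drift provides `lam₂ / 2` of the weighted distance. The noise uses up half of it, and the
  -- factor 2 of the energy inequality turns the rest into `lam₂ / 2`.
  obtain ⟨C₂, hC₂, hnoise⟩ := hσ.exists_inner_noise_sub_le hp (lam := lam₂ / 4) (by linarith)
  obtain ⟨C₃, -, hdb⟩ := hF.exists_drift_bound T
  refine ⟨2 * (C₁ + C₂), by positivity, fun v v' u u' U U' Uh Uh' hu hu' hU hU' t ht => ?_⟩
  have hw : ContinuousOn (fun s => u s - u' s) (Icc 0 T) := hu.continuousOn.sub hu'.continuousOn
  have hsub : Icc 0 t ⊆ Icc 0 T := Icc_subset_Icc_right ht.2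
  have hle := Measure.restrict_mono hsub (le_refl (volume : Measure ℝ))
  obtain ⟨G, hGm, hG, hG0, hGae, heq⟩ := hu.exists_difference hF hσ hu' hU hU'
  have hm := hF.measurable_drift T hU.measurable_U
  have hm' := hF.measurable_drift T hU'.measurable_U
  have hΦ := (hdb U hU.measurable_U hU.memLp_U).1.sub (hdb U' hU'.measurable_U hU'.memLp_U).1
  have hE := energy_ineq hT hp hw (by simp [hu.eq_init hα hT, hu'.eq_init hα hT]) (hU.sub hU')
    (Φ := fun z => drift T F U z - drift T F U' z) (hm.sub hm') hΦ
    (fun s hs x => by simp [drift_of_notMem hs]) hGm hG hG0 heq t ht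
  have j1 : IntegrableOn (fun s => ∫ x, (drift T F U (s, x) - drift T F U' (s, x))
      * (U (s, x) - U' (s, x))) (Icc 0 t) := by
    have htri := holderTriple_ofReal hp
    have h : Integrable (fun z => (drift T F U z - drift T F U' z) * (U z - U' z)) :=
      MemLp.integrable_mul hΦ (hU.memLp_U.sub hU'.memLp_U)
    rw [Measure.volume_eq_prod] at h
    exact h.integral_prod_left.integrableOn
  have j2 : IntegrableOn (fun s => (inner ℝ (G s) (u s - u' s) : ℝ)) (Icc 0 t) :=
    (integrableOn_inner_mul hG.integrableOn hw).mono_set hsub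
  have j3 := (integrableOn_one_add_norm_sq_mul hw v).mono_set hsub
  have j4 : IntegrableOn (remainder κ σ₁ σ₂ u u' v v') (Icc 0 t) :=
    (integrableOn_inner_tensor (hσ.memLp_noise hp hU' hu'.continuousOn) hw v v').mono_set hsub
  have j5 : IntegrableOn (weightDist p U U') (Icc 0 t) :=
    (hU.integrable_weightDist hU' hp).integrableOn
  have hmain : ∫ s in Icc 0 t, ((inner ℝ (G s) (u s - u' s) : ℝ)
      - ∫ x, (drift T F U (s, x) - drift T F U' (s, x)) * (U (s, x) - U' (s, x)))
      ≤ ∫ s in Icc 0 t, ((C₁ + C₂) * ((1 + ‖v s‖ ^ 2) * ‖u s - u' s‖ ^ 2)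
        + remainder κ σ₁ σ₂ u u' v v' s - lam₂ / 4 * weightDist p U U' s) := by
    refine integral_mono_ae (j2.sub j1) (((j3.const_mul _).add j4).sub (j5.const_mul _)) ?_
    filter_upwards [ae_mono hle (hdrift α u u' U U' Uh Uh' hU hU'), ae_mono hle hGae,
      ae_mono hle hU.ae_eq, ae_mono hle hU'.ae_eq] with s h1 h2 ⟨e1, _, _, m1⟩ ⟨e2, _, _, m2⟩
    have h3 := hnoise s (u s) (u' s) m1 m2 (v s)
    have e3 : ∫ x, (|u s x| ^ (p - 2) + |u' s x| ^ (p - 2)) * |u s x - u' s x| ^ 2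
        = weightDist p U U' s := by
      refine integral_congr_ae ?_
      filter_upwards [e1, e2] with x g1 g2
      simp only [g1, g2]
    rw [e3] at h3
    have e4 : (inner ℝ (G s) (u s - u' s) : ℝ)
        = inner ℝ (noise κ σ₁ σ₂ s (u s) - noise κ σ₁ σ₂ s (u' s)) (tensor n (u s - u' s) (v s))
          + remainder κ σ₁ σ₂ u u' v v' s := by
      rw [h2, inner_sub_left, inner_contract, inner_contract, remainder, map_sub (tensor n (u s - u' s)), inner_sub_right,
        inner_sub_left]
      ring
    have h5 : C₁ * ‖u s - u' s‖ ^ 2 ≤ C₁ * ((1 + ‖v s‖ ^ 2) * ‖u s - u' s‖ ^ 2) := by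
      refine mul_le_mul_of_nonneg_left ?_ hC₁
      nlinarith [mul_nonneg (sq_nonneg ‖v s‖) (sq_nonneg ‖u s - u' s‖)]
    simp only [e4]
    linarith
  have j34 : IntegrableOn (fun s => (C₁ + C₂) * ((1 + ‖v s‖ ^ 2) * ‖u s - u' s‖ ^ 2)
      + remainder κ σ₁ σ₂ u u' v v' s) (Icc 0 t) := (j3.const_mul _).add j4
  rw [integral_sub j2 j1, integral_sub j34 (j5.const_mul _),
    integral_add (j3.const_mul _) j4, integral_const_mul, integral_const_mul] at hmain
  linarith

end Basic

end FracRD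

namespace FracRD

variable {n : ℕ}

/-! ### Grönwall with dissipation, stability and a priori bounds -/

theorem gronwall_dissipation {T B : ℝ} (hT : 0 < T) (hB : 0 ≤ B) : ∃ K : ℝ, 0 ≤ K ∧
    ∀ (φ D b : ℝ → ℝ) (ρ : ℝ), 0 ≤ ρ → ContinuousOn φ (Icc 0 T) → (∀ t ∈ Icc 0 T, 0 ≤ φ t) →
    (∀ t ∈ Icc 0 T, 0 ≤ D t) → IntegrableOn b (Icc 0 T) → (∀ t, 0 ≤ b t) →
    ∫ s in Icc 0 T, b s ≤ B →
    (∀ t ∈ Icc 0 T, φ t + D t ≤ ρ + ∫ s in Icc 0 t, b s * φ s) →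
    (∀ t ∈ Icc 0 T, φ t ≤ K * ρ) ∧ D T ≤ K * ρ := by
  obtain ⟨C, hC, h⟩ := gronwall_integrable (T := T) (B := B)
  refine ⟨1 + C + C * B, by positivity, fun φ D b ρ hρ hφ hφ0 hD hb hb0 hbB hle => ?_⟩
  have h1 := h φ b ρ hρ hφ hφ0 hb hb0 hbB fun t ht => by linarith [hle t ht, hD t ht]
  have hTT : T ∈ Icc 0 T := ⟨hT.le, le_rfl⟩
  have h2 : ∫ s in Icc 0 T, b s * φ s ≤ B * (C * ρ) := by
    calc ∫ s in Icc 0 T, b s * φ s ≤ ∫ s in Icc 0 T, b s * (C * ρ) := by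
          refine setIntegral_mono_on (hb.mul_continuousOn hφ isCompact_Icc)
            (hb.mul_const _) measurableSet_Icc fun s hs => ?_
          exact mul_le_mul_of_nonneg_left (h1 s hs) (hb0 s)
      _ = (∫ s in Icc 0 T, b s) * (C * ρ) := integral_mul_const _ _
      _ ≤ B * (C * ρ) := by gcongr
  have p1 : 0 ≤ C * ρ := by positivity
  have p2 : 0 ≤ C * B * ρ := by positivity
  refine ⟨fun t ht => (h1 t ht).trans (by nlinarith), ?_⟩
  have := hle T hTT
  have := hφ0 T hTT
  nlinarith

theorem integral_eq_setIntegral_time {T : ℝ} {f : ℝ × E n → ℝ} (hf : Integrable f)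
    (h0 : ∀ s ∉ Icc 0 T, ∀ x, f (s, x) = 0) :
    ∫ z, f z = ∫ s in Icc 0 T, ∫ x, f (s, x) := by
  rw [Measure.volume_eq_prod] at hf ⊢
  rw [integral_prod _ hf, setIntegral_eq_integral_of_forall_compl_eq_zero]
  intro s hs
  simp [h0 s hs]

theorem setIntegral_section_le {f : ℝ × E n → ℝ} (hf : Integrable f) (h0 : ∀ z, 0 ≤ f z)
    (A : Set ℝ) : ∫ s in A, ∫ x, f (s, x) ≤ ∫ z, f z := by
  rw [Measure.volume_eq_prod] at hf ⊢
  rw [integral_prod _ hf]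
  exact setIntegral_le_integral hf.integral_prod_left
    (Eventually.of_forall fun s => integral_nonneg fun x => h0 _)

theorem norm_control_sq {T : ℝ} (z : Control T) : ∫ s in Icc 0 T, ‖z s‖ ^ 2 = ‖z‖ ^ 2 := by
  rw [← real_inner_self_eq_norm_sq z, L2.inner_def]
  refine integral_congr_ae (Eventually.of_forall fun s => ?_)
  simp only [real_inner_self_eq_norm_sq]

theorem integrableOn_control_sq {T : ℝ} (z : Control T) :
    IntegrableOn (fun s => ‖z s‖ ^ 2) (Icc 0 T) :=
  (memLp_two_iff_integrable_sq_norm (Lp.memLp z).1).1 (Lp.memLp z)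

theorem norm_control_sub_sq_ae {T : ℝ} (v v' : Control T) :
    ∀ᵐ s ∂(volume.restrict (Icc 0 T)), ‖v s - v' s‖ ^ 2 = ‖(v - v') s‖ ^ 2 := by
  filter_upwards [Lp.coeFn_sub v v'] with s hs
  rw [hs, Pi.sub_apply]

section Apriori

variable {α p q T : ℝ} {lam₁ lam₂ : ℝ} {ψ₁ ψ₂ ψ₃ ψ₄ : ℝ → E n → ℝ} {F : ℝ → E n → ℝ → ℝ}
  {g : ℝ → H n} {κ : E n → ℝ} {σ₁ : ℝ → HSeq n} {σ₂ : ℕ → ℝ → E n → ℝ → ℝ} {a b c : ℕ → ℝ}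
  {u₀ : H n}

theorem Repr.integral_weightDist {u u' : ℝ → H n} {U U' : ℝ × E n → ℝ} {Uh Uh' : ℝ × E n → ℂ}
    (hp : 2 < p) (hU : Repr α p T u U Uh) (hU' : Repr α p T u' U' Uh') :
    ∫ z, ‖U z - U' z‖ ^ p ≤ 2 ^ (p - 2) * ∫ s in Icc 0 T, weightDist p U U' s := by
  have hw := hU.integrable_weight hU' hp
  have h1 : ∫ z, (|U z| ^ (p - 2) + |U' z| ^ (p - 2)) * |U z - U' z| ^ 2
      = ∫ s in Icc 0 T, weightDist p U U' s :=
    integral_eq_setIntegral_time hw fun s hs x => by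
      simp [hU.U_zero s hs, hU'.U_zero s hs]
  rw [← h1, ← integral_const_mul]
  refine integral_mono ((hU.sub hU').integrable_rpow hp) (hw.const_mul _) fun z => ?_
  exact abs_sub_rpow_le_weight hp _ _

theorem Repr.integral_hat_sub {u u' : ℝ → H n} {U U' : ℝ × E n → ℝ} {Uh Uh' : ℝ × E n → ℂ}
    (hU : Repr α p T u U Uh) (hU' : Repr α p T u' U' Uh') :
    ∫ z, ‖Uh z - Uh' z‖ ^ 2 = ∫ s in Icc 0 T, ∫ η, ‖Uh (s, η) - Uh' (s, η)‖ ^ 2 :=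
  integral_eq_setIntegral_time (hU.sub hU').integrable_sq fun s hs x => by
    simp [hU.Uh_zero s hs, hU'.Uh_zero s hs]

/-- Stability: closeness of two solutions is controlled by a bound for the remainder of the form
`ρ + ∫ b |u - u'|²`. -/
theorem exists_stability (hα : α ∈ Ioo (0 : ℝ) 1) (hT : 0 < T)
    (hF : DriftAssumptions p lam₁ lam₂ ψ₁ ψ₂ ψ₃ ψ₄ F)
    (hσ : NoiseAssumptions p q κ σ₁ σ₂ a b c) {B : ℝ} (hB : 0 ≤ B) : ∃ K : ℝ, 0 ≤ K ∧
      ∀ (v v' : Control T) (u u' : ℝ → H n) (U U' : ℝ × E n → ℝ) (Uh Uh' : ℝ × E n → ℂ),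
      ‖v‖ ^ 2 ≤ B → IsSolution α p T F g κ σ₁ σ₂ u₀ v u → IsSolution α p T F g κ σ₁ σ₂ u₀ v' u' →
      Repr α p T u U Uh → Repr α p T u' U' Uh' → ∀ (θ : ℝ → ℝ) (ρ : ℝ), 0 ≤ ρ → (∀ s, 0 ≤ θ s) →
        IntegrableOn θ (Icc 0 T) → ∫ s in Icc 0 T, θ s ≤ B →
        (∀ t ∈ Icc 0 T, 2 * ∫ s in Icc 0 t, remainder κ σ₁ σ₂ u u' v v' s
          ≤ ρ + ∫ s in Icc 0 t, θ s * ‖u s - u' s‖ ^ 2) →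
        (∀ t ∈ Icc 0 T, ‖u t - u' t‖ ^ 2 ≤ K * ρ) ∧ ∫ z, ‖Uh z - Uh' z‖ ^ 2 ≤ K * ρ ∧
          ∫ z, ‖U z - U' z‖ ^ p ≤ K * ρ := by
  have hp := hF.two_lt_p
  have hlam := hF.lam₂_pos
  obtain ⟨C, hC, hbasic⟩ := exists_basic_inequality (g := g) (u₀ := u₀) hα hT hF hσ
  -- This bounds the integral of the Grönwall coefficient `C (1 + ‖v‖²) + θ`.
  obtain ⟨K, hK, hgron⟩ := gronwall_dissipation (B := C * (T + B) + B) hT (by positivity)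
  have hc2 : (0 : ℝ) ≤ 2 ^ (p - 2) := by positivity
  refine ⟨K + 2 ^ (p - 2) * (2 / lam₂) * K, by positivity,
    fun v v' u u' U U' Uh Uh' hv hu hu' hU hU' θ ρ hρ hθ0 hθ hθB hrem => ?_⟩
  have hw : ContinuousOn (fun s => u s - u' s) (Icc 0 T) := hu.continuousOn.sub hu'.continuousOn
  have i1 := integrableOn_control_sq v
  have i2 : IntegrableOn (fun s => 1 + ‖v s‖ ^ 2) (Icc 0 T) := (integrable_const _).add i1
  have i3 : IntegrableOn (fun s => C * (1 + ‖v s‖ ^ 2)) (Icc 0 T) := i2.const_mul C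
  have hD1 : ∀ t, 0 ≤ ∫ s in Icc 0 t, ∫ η, ‖Uh (s, η) - Uh' (s, η)‖ ^ 2 := fun t =>
    integral_nonneg fun s => integral_nonneg fun η => by positivity
  have hD2 : ∀ t, 0 ≤ ∫ s in Icc 0 t, weightDist p U U' s := fun t =>
    integral_nonneg fun s => weightDist_nonneg _ _ _ _
  obtain ⟨k1, k2⟩ := hgron (fun t => ‖u t - u' t‖ ^ 2)
    (fun t => 2 * (∫ s in Icc 0 t, ∫ η, ‖Uh (s, η) - Uh' (s, η)‖ ^ 2)
      + lam₂ / 2 * (∫ s in Icc 0 t, weightDist p U U' s))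
    (fun s => C * (1 + ‖v s‖ ^ 2) + θ s) ρ hρ (hw.norm.pow 2) (fun t _ => by positivity)
    (fun t _ => by have := hD1 t; have := hD2 t; positivity) (i3.add hθ)
    (fun s => by have := hθ0 s; positivity) (by
      rw [integral_add i3 hθ, integral_const_mul, integral_add (integrable_const _) i1,
        norm_control_sq, setIntegral_const, measureReal_def, Real.volume_Icc, sub_zero,
        ENNReal.toReal_ofReal hT.le, smul_eq_mul, mul_one]
      gcongr) fun t ht => by
      have hsub : Icc 0 t ⊆ Icc 0 T := Icc_subset_Icc_right ht.2
      have h1 := hbasic v v' u u' U U' Uh Uh' hu hu' hU hU' t ht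
      have h2 := hrem t ht
      have e : ∫ s in Icc 0 t, (C * (1 + ‖v s‖ ^ 2) + θ s) * ‖u s - u' s‖ ^ 2
          = C * (∫ s in Icc 0 t, (1 + ‖v s‖ ^ 2) * ‖u s - u' s‖ ^ 2)
            + ∫ s in Icc 0 t, θ s * ‖u s - u' s‖ ^ 2 := by
        rw [← integral_const_mul, ← integral_add]
        · exact integral_congr_ae (Eventually.of_forall fun s => by ring)
        · exact ((integrableOn_one_add_norm_sq_mul hw v).mono_set hsub).const_mul _
        · exact (hθ.mul_continuousOn (hw.norm.pow 2) isCompact_Icc).mono_set hsub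
      rw [e]
      linarith
  have hKρ : 0 ≤ K * ρ := by positivity
  have e1 := hD1 T
  have e2 := hD2 T
  have e3 : 0 ≤ 2 ^ (p - 2) * (2 / lam₂) * (K * ρ) := by positivity
  refine ⟨fun t ht => (k1 t ht).trans (by nlinarith), ?_, ?_⟩
  · rw [hU.integral_hat_sub hU']
    nlinarith [mul_nonneg hlam.le e2]
  · refine (hU.integral_weightDist hp hU').trans ?_
    have h3 : ∫ s in Icc 0 T, weightDist p U U' s ≤ 2 / lam₂ * (K * ρ) := by
      rw [div_mul_eq_mul_div, le_div_iff₀ hlam]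
      linarith
    have h4 := mul_le_mul_of_nonneg_left h3 hc2
    nlinarith

theorem abs_remainder_le (u u' : ℝ → H n) (v v' : ℝ → SeqL2) (s : ℝ) :
    |remainder κ σ₁ σ₂ u u' v v' s|
      ≤ ‖noise κ σ₁ σ₂ s (u' s)‖ * (‖u s - u' s‖ * ‖v s - v' s‖) :=
  abs_inner_tensor_le _ _ _

/-- Stability with respect to one known solution already yields bounds: by Young, twice the
remainder is at most `‖v - v'‖² + ‖σ(u')‖² ‖u - u'‖²`. The second term is a Grönwall term with `θ =
‖σ(u')‖²`, whose integral is the same for all `v`. -/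
theorem exists_apriori_bound (hα : α ∈ Ioo (0 : ℝ) 1) (hT : 0 < T)
    (hF : DriftAssumptions p lam₁ lam₂ ψ₁ ψ₂ ψ₃ ψ₄ F)
    (hσ : NoiseAssumptions p q κ σ₁ σ₂ a b c) {v' : Control T} {u' : ℝ → H n}
    {U' : ℝ × E n → ℝ} {Uh' : ℝ × E n → ℂ} (hu' : IsSolution α p T F g κ σ₁ σ₂ u₀ v' u')
    (hU' : Repr α p T u' U' Uh') (B : ℝ) : ∃ M : ℝ, 0 ≤ M ∧
      ∀ (v : Control T) (u : ℝ → H n) (U : ℝ × E n → ℝ) (Uh : ℝ × E n → ℂ), ‖v‖ ≤ B →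
      IsSolution α p T F g κ σ₁ σ₂ u₀ v u → Repr α p T u U Uh →
      (∀ t ∈ Icc 0 T, ‖u t‖ ≤ M) ∧ ∫ z, ‖Uh z‖ ^ 2 ≤ M ∧ ∫ z, ‖U z‖ ^ p ≤ M := by
  have hp := hF.two_lt_p
  have hS := hσ.memLp_noise hp hU' hu'.continuousOn
  have hθ : IntegrableOn (fun s => ‖noise κ σ₁ σ₂ s (u' s)‖ ^ 2) (Icc 0 T) :=
    (memLp_two_iff_integrable_sq_norm hS.1).1 hS
  have hθ0 : 0 ≤ ∫ s in Icc 0 T, ‖noise κ σ₁ σ₂ s (u' s)‖ ^ 2 :=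
    integral_nonneg fun s => by positivity
  obtain ⟨K, hK, hstab⟩ := exists_stability (g := g) (u₀ := u₀) hα hT hF hσ
    (B := B ^ 2 + ∫ s in Icc 0 T, ‖noise κ σ₁ σ₂ s (u' s)‖ ^ 2) (by positivity)
  obtain ⟨M', hM'⟩ := (isCompact_Icc.image_of_continuousOn hu'.continuousOn).isBounded.exists_norm_le
  set ρ := (|B| + ‖v'‖) ^ 2 with hρ
  have hρ0 : 0 ≤ ρ := by positivity
  have y1 : 0 ≤ ∫ z, ‖Uh' z‖ ^ 2 := integral_nonneg fun z => by positivity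
  have y2 : 0 ≤ ∫ z, ‖U' z‖ ^ p := integral_nonneg fun z => by positivity
  have c1 : (0 : ℝ) ≤ 2 ^ p := by positivity
  refine ⟨(K * ρ + 1 + |M'|) + 2 * (K * ρ + ∫ z, ‖Uh' z‖ ^ 2)
    + 2 ^ p * (K * ρ + ∫ z, ‖U' z‖ ^ p), by positivity, fun v u U Uh hv hu hU => ?_⟩
  have hw : ContinuousOn (fun s => u s - u' s) (Icc 0 T) := hu.continuousOn.sub hu'.continuousOn
  have hvv : ‖v - v'‖ ^ 2 ≤ ρ := by
    have h1 := norm_sub_le v v'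
    have h2 := le_abs_self B
    rw [hρ]
    gcongr
    linarith
  have hB2 : ‖v‖ ^ 2 ≤ B ^ 2 := by gcongr
  obtain ⟨k1, k2, k3⟩ := hstab v v' u u' U U' Uh Uh' (by linarith) hu hu' hU hU' _ ρ hρ0
    (fun s => sq_nonneg ‖noise κ σ₁ σ₂ s (u' s)‖) hθ (by nlinarith [sq_nonneg B]) fun t ht => by
      have hsub : Icc 0 t ⊆ Icc 0 T := Icc_subset_Icc_right ht.2
      have j1 : IntegrableOn (fun s => ‖(v - v') s‖ ^ 2) (Icc 0 T) := integrableOn_control_sq _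
      have j2 : IntegrableOn (fun s => ‖noise κ σ₁ σ₂ s (u' s)‖ ^ 2 * ‖u s - u' s‖ ^ 2) (Icc 0 t) :=
        (hθ.mul_continuousOn (hw.norm.pow 2) isCompact_Icc).mono_set hsub
      have j3 : IntegrableOn (remainder κ σ₁ σ₂ u u' v v') (Icc 0 t) :=
        (integrableOn_inner_tensor hS hw v v').mono_set hsub
      rw [← integral_const_mul]
      calc ∫ s in Icc 0 t, 2 * remainder κ σ₁ σ₂ u u' v v' s
          ≤ ∫ s in Icc 0 t, (‖(v - v') s‖ ^ 2
            + ‖noise κ σ₁ σ₂ s (u' s)‖ ^ 2 * ‖u s - u' s‖ ^ 2) := by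
            refine integral_mono_ae (j3.const_mul 2) ((j1.mono_set hsub).add j2) ?_
            filter_upwards [ae_mono (Measure.restrict_mono hsub le_rfl)
              (norm_control_sub_sq_ae v v')] with s hs
            rw [← hs]
            have h1 := (le_abs_self _).trans (abs_remainder_le (κ := κ) (σ₁ := σ₁) (σ₂ := σ₂)
              u u' v v' s)
            nlinarith [sq_nonneg (‖noise κ σ₁ σ₂ s (u' s)‖ * ‖u s - u' s‖ - ‖v s - v' s‖)]
        _ = (∫ s in Icc 0 t, ‖(v - v') s‖ ^ 2)
            + ∫ s in Icc 0 t, ‖noise κ σ₁ σ₂ s (u' s)‖ ^ 2 * ‖u s - u' s‖ ^ 2 :=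
            integral_add (j1.mono_set hsub) j2
        _ ≤ _ := by
            have h1 := setIntegral_mono_set j1 (Eventually.of_forall fun s => by positivity)
              hsub.eventuallyLE
            rw [norm_control_sq] at h1
            linarith
  have hKρ : 0 ≤ K * ρ := by positivity
  have z1 := abs_nonneg M'
  have z2 : 0 ≤ 2 ^ p * (K * ρ + ∫ z, ‖U' z‖ ^ p) := by positivity
  refine ⟨fun t ht => ?_, ?_, ?_⟩
  · have h1 := k1 t ht
    have h2 : ‖u' t‖ ≤ M' := hM' _ ⟨t, ht, rfl⟩
    have h3 : ‖u t‖ ≤ ‖u t - u' t‖ + ‖u' t‖ := by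
      simpa using norm_add_le (u t - u' t) (u' t)
    have h4 : ‖u t - u' t‖ ≤ K * ρ + 1 := by nlinarith [sq_nonneg (‖u t - u' t‖ - 1)]
    linarith [le_abs_self M']
  · have h1 : ∫ z, ‖Uh z‖ ^ 2 ≤ ∫ z, 2 * (‖Uh z - Uh' z‖ ^ 2 + ‖Uh' z‖ ^ 2) := by
      refine integral_mono hU.integrable_sq
        (((hU.sub hU').integrable_sq.add hU'.integrable_sq).const_mul 2) fun z => ?_
      have h3 : ‖Uh z‖ ≤ ‖Uh z - Uh' z‖ + ‖Uh' z‖ := by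
        simpa using norm_add_le (Uh z - Uh' z) (Uh' z)
      have : ‖Uh z‖ ^ 2 ≤ (‖Uh z - Uh' z‖ + ‖Uh' z‖) ^ 2 := by gcongr
      simp only
      nlinarith [sq_nonneg (‖Uh z - Uh' z‖ - ‖Uh' z‖)]
    rw [integral_const_mul, integral_add (hU.sub hU').integrable_sq hU'.integrable_sq] at h1
    linarith
  · have h1 : ∫ z, ‖U z‖ ^ p ≤ ∫ z, 2 ^ p * (‖U z - U' z‖ ^ p + ‖U' z‖ ^ p) := by
      refine integral_mono (hU.integrable_rpow hp)
        ((((hU.sub hU').integrable_rpow hp).add (hU'.integrable_rpow hp)).const_mul _) fun z => ?_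
      have := abs_sub_rpow_le (r := p) (by linarith) (U z - U' z) (-U' z)
      rw [sub_neg_eq_add, sub_add_cancel, abs_neg] at this
      exact this
    rw [integral_const_mul, integral_add ((hU.sub hU').integrable_rpow hp)
      (hU'.integrable_rpow hp)] at h1
    have : 2 ^ p * ((∫ z, ‖U z - U' z‖ ^ p) + ∫ z, ‖U' z‖ ^ p)
      ≤ 2 ^ p * (K * ρ + ∫ z, ‖U' z‖ ^ p) := by gcongr
    linarith

end Apriori

end FracRD

namespace FracRD

variable {n : ℕ}

/-! ### Equicontinuous sequences against weakly null ones -/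

theorem isClosed_setOf_tendsto_zero {X : Type*} [SeminormedAddCommGroup X] {L : ℕ → X → ℝ} {K : ℝ}
    (h : ∀ j x y, |L j x - L j y| ≤ K * ‖x - y‖) :
    IsClosed {x | Tendsto (fun j => L j x) atTop (𝓝 0)} := by
  have hK0 : 0 ≤ |K| + 1 := by positivity
  refine isClosed_iff_clusterPt.2 fun x hx => ?_
  rw [← mem_closure_iff_clusterPt, Metric.mem_closure_iff] at hx
  refine Metric.tendsto_atTop.2 fun ε hε => ?_
  obtain ⟨y, hy, hxy⟩ := hx (ε / (2 * (|K| + 1))) (by positivity)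
  obtain ⟨N, hN⟩ := Metric.tendsto_atTop.1 hy (ε / 2) (by positivity)
  refine ⟨N, fun j hj => ?_⟩
  have h1 := hN j hj
  have h2 := h j x y
  rw [dist_eq_norm, lt_div_iff₀ (by positivity)] at hxy
  rw [Real.dist_0_eq_abs] at h1 ⊢
  have h3 : |L j x| ≤ |L j x - L j y| + |L j y| := by
    simpa using abs_add_le (L j x - L j y) (L j y)
  have h4 : K * ‖x - y‖ ≤ (|K| + 1) * ‖x - y‖ := by
    gcongr
    linarith [le_abs_self K]
  nlinarith

/-- Uniform equicontinuity on `[0, T]` of a sequence of real functions. -/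
def EquicontSeq (T : ℝ) (y : ℕ → ℝ → ℝ) : Prop :=
  ∀ ε > 0, ∃ η > 0, ∀ j, ∀ t ∈ Icc 0 T, ∀ t' ∈ Icc 0 T, |t - t'| ≤ η → |y j t - y j t'| ≤ ε

/-- Pointwise convergence on a finite grid of mesh `η`, and equicontinuity between the grid points.
-/
theorem EquicontSeq.eventually_abs_le {T : ℝ} {y : ℕ → ℝ → ℝ} (hy : EquicontSeq T y)
    (h0 : ∀ t ∈ Icc 0 T, Tendsto (fun j => y j t) atTop (𝓝 0)) {ε : ℝ} (hε : 0 < ε) :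
    ∀ᶠ j in atTop, ∀ t ∈ Icc 0 T, |y j t| ≤ ε := by
  obtain ⟨η, hη, hyη⟩ := hy (ε / 2) (by positivity)
  have hgrid : ∀ᶠ j in atTop, ∀ i ∈ Finset.range (⌊T / η⌋₊ + 1), (i * η ∈ Icc 0 T →
      |y j (i * η)| ≤ ε / 2) := by
    rw [Finset.eventually_all]
    intro i _
    by_cases hi : i * η ∈ Icc 0 T
    · have := (h0 _ hi).abs
      rw [abs_zero] at this
      filter_upwards [this.eventually_le_const (half_pos hε)] with j hj _ using hj
    · exact Eventually.of_forall fun j h => absurd h hi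
  filter_upwards [hgrid] with j hj t ht
  have h1 : (⌊t / η⌋₊ : ℝ) ≤ t / η := Nat.floor_le (div_nonneg ht.1 hη.le)
  have h2 := (Nat.lt_floor_add_one (t / η)).le
  rw [le_div_iff₀ hη] at h1
  rw [div_le_iff₀ hη] at h2
  have hm : (⌊t / η⌋₊ : ℝ) * η ∈ Icc 0 T := ⟨by positivity, h1.trans ht.2⟩
  have h3 := hj ⌊t / η⌋₊ (Finset.mem_range.2 (Nat.lt_succ_of_le (Nat.floor_le_floor (by
    have := ht.2; gcongr)))) hm
  have h4 := hyη j t ht _ hm (by rw [abs_of_nonneg (by linarith)]; linarith)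
  have h5 : |y j t| ≤ |y j t - y j (⌊t / η⌋₊ * η)| + |y j (⌊t / η⌋₊ * η)| := by
    simpa using abs_add_le (y j t - y j (⌊t / η⌋₊ * η)) (y j (⌊t / η⌋₊ * η))
  linarith

/-- Replace `y j` by a step function on a grid fixed in advance for all `j`. The error is controlled
by the `L¹` bound of `f j`; what remains is a finite sum of bounded coefficients times integrals
tending to zero. Convergence of `y j` is not needed. -/
theorem tendsto_integral_mul_equicont {T : ℝ} {f y : ℕ → ℝ → ℝ} {M : ℝ}
    (hy : EquicontSeq T y) (hyc : ∀ j, ContinuousOn (y j) (Icc 0 T))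
    (hyM : ∀ j, ∀ t ∈ Icc 0 T, |y j t| ≤ M)
    (hf : ∀ j, IntegrableOn (f j) (Icc 0 T)) (hfM : ∀ j, ∫ s in Icc 0 T, |f j s| ≤ M)
    (hw : ∀ A : Set ℝ, MeasurableSet A →
      Tendsto (fun j => ∫ s in A, f j s ∂(volume.restrict (Icc 0 T))) atTop (𝓝 0)) :
    Tendsto (fun j => ∫ s in Icc 0 T, f j s * y j s) atTop (𝓝 0) := by
  have hM : 0 ≤ M := (integral_nonneg fun s => abs_nonneg (f 0 s)).trans (hfM 0)
  refine Metric.tendsto_atTop.2 fun ε hε => ?_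
  obtain ⟨η, hη, hyη⟩ := hy (ε / (2 * (M + 1))) (by positivity)
  let I : ℕ → Set ℝ := fun i => {s | ⌊s / η⌋₊ = i}
  have hI : ∀ i, MeasurableSet (I i) := fun i =>
    (Nat.measurable_floor.comp (measurable_id.div_const η)) (measurableSet_singleton i)
  let N := ⌊T / η⌋₊ + 1
  have hfl : ∀ s ∈ Icc 0 T, (⌊s / η⌋₊ : ℝ) * η ∈ Icc 0 T ∧ |s - ⌊s / η⌋₊ * η| ≤ η
      ∧ ⌊s / η⌋₊ ∈ Finset.range N := fun s hs => by
    have h1 : (⌊s / η⌋₊ : ℝ) ≤ s / η := Nat.floor_le (div_nonneg hs.1 hη.le)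
    have h2 := (Nat.lt_floor_add_one (s / η)).le
    rw [le_div_iff₀ hη] at h1
    rw [div_le_iff₀ hη] at h2
    refine ⟨⟨by positivity, h1.trans hs.2⟩, by rw [abs_of_nonneg (by linarith)]; linarith, ?_⟩
    refine Finset.mem_range.2 (Nat.lt_succ_of_le (Nat.floor_le_floor ?_))
    have := hs.2
    gcongr
  -- The value zero off `[0, T]` keeps the coefficients bounded; the grid point used for a time in
  -- `[0, T]` always lies in `[0, T]`.
  let Y : ℕ → ℕ → ℝ := fun j i => if i * η ∈ Icc 0 T then y j (i * η) else 0
  have hYM : ∀ j i, |Y j i| ≤ M := fun j i => by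
    by_cases h : i * η ∈ Icc 0 T
    · simp only [Y, if_pos h]; exact hyM j _ h
    · simp only [Y, if_neg h, abs_zero]; exact hM
  have hsum : Tendsto (fun j => ∑ i ∈ Finset.range N,
      Y j i * ∫ s in I i, f j s ∂(volume.restrict (Icc 0 T))) atTop (𝓝 0) := by
    have hz : 𝓝 (∑ _i ∈ Finset.range N, (0 : ℝ)) = 𝓝 0 := by rw [Finset.sum_const_zero]
    refine (tendsto_finsetSum (a := fun _ => (0 : ℝ)) _ fun i _ => ?_).trans_eq hz
    refine squeeze_zero_norm (a := fun j => M * |∫ s in I i, f j s ∂(volume.restrict (Icc 0 T))|)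
      (fun j => ?_) ?_
    · rw [norm_mul, Real.norm_eq_abs, Real.norm_eq_abs]
      exact mul_le_mul_of_nonneg_right (hYM j i) (abs_nonneg _)
    · have := ((hw (I i) (hI i)).abs).const_mul M
      simpa using this
  obtain ⟨J, hJ⟩ := Metric.tendsto_atTop.1 hsum (ε / 2) (by positivity)
  refine ⟨J, fun j hj => ?_⟩
  have h1 := hJ j hj
  rw [Real.dist_0_eq_abs] at h1 ⊢
  have e1 : ∑ i ∈ Finset.range N, Y j i * ∫ s in I i, f j s ∂(volume.restrict (Icc 0 T))
      = ∫ s in Icc 0 T, ∑ i ∈ Finset.range N, Y j i * (I i).indicator (f j) s := by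
    rw [integral_finsetSum]
    · refine Finset.sum_congr rfl fun i _ => ?_
      rw [integral_const_mul, integral_indicator (hI i)]
    · intro i _
      exact ((hf j).indicator (hI i)).const_mul _
  have hint : IntegrableOn (fun s => ∑ i ∈ Finset.range N, Y j i * (I i).indicator (f j) s)
      (Icc 0 T) := integrable_finsetSum _ fun i _ => ((hf j).indicator (hI i)).const_mul _
  have hint2 : IntegrableOn (fun s => f j s * y j s) (Icc 0 T) :=
    (hf j).mul_continuousOn (hyc j) isCompact_Icc
  have hdiff : |(∫ s in Icc 0 T, f j s * y j s)
      - ∫ s in Icc 0 T, ∑ i ∈ Finset.range N, Y j i * (I i).indicator (f j) s|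
      ≤ ε / (2 * (M + 1)) * M := by
    rw [← integral_sub hint2 hint]
    rw [← Real.norm_eq_abs]
    calc _ ≤ ∫ s in Icc 0 T, ε / (2 * (M + 1)) * |f j s| := by
          refine norm_integral_le_of_norm_le (((hf j).abs).const_mul _) ?_
          filter_upwards [ae_restrict_mem measurableSet_Icc] with s hs
          obtain ⟨m1, m2, m3⟩ := hfl s hs
          have e2 : ∑ i ∈ Finset.range N, Y j i * (I i).indicator (f j) s
              = y j (⌊s / η⌋₊ * η) * f j s := by
            rw [Finset.sum_eq_single_of_mem _ m3]
            · rw [indicator_of_mem (show s ∈ I ⌊s / η⌋₊ from rfl)]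
              simp only [Y, if_pos m1]
            · intro i _ hi
              rw [indicator_of_notMem (show s ∉ I i from fun h => hi h.symm), mul_zero]
          rw [e2, mul_comm (f j s), ← sub_mul, norm_mul]
          exact mul_le_mul_of_nonneg_right (hyη j s hs _ m1 m2) (norm_nonneg _)
      _ = ε / (2 * (M + 1)) * ∫ s in Icc 0 T, |f j s| := integral_const_mul _ _
      _ ≤ _ := by
          have := hfM j
          gcongr
  have h2 : ε / (2 * (M + 1)) * M < ε / 2 := by
    rw [div_mul_eq_mul_div, div_lt_div_iff₀ (by positivity) two_pos]
    nlinarith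
  rw [e1] at h1
  have h3 := abs_add_le ((∫ s in Icc 0 T, f j s * y j s)
      - ∫ s in Icc 0 T, ∑ i ∈ Finset.range N, Y j i * (I i).indicator (f j) s)
      (∫ s in Icc 0 T, ∑ i ∈ Finset.range N, Y j i * (I i).indicator (f j) s)
  rw [sub_add_cancel] at h3
  linarith

/-! ### Weak convergence to zero of tensor products -/

section Weak

/-- For a bounded sequence the admissible test elements form a closed subspace, so indicators with
constant vectors suffice. Used twice: in time with values in `L²(ℝⁿ; l²)`, then in space with values
in `l²`. -/
theorem tendsto_inner_zero_of_indicator {X Y : Type*} [MeasurableSpace X] {μ : Measure X}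
    [NormedAddCommGroup Y] [InnerProductSpace ℝ Y] {x : ℕ → Lp Y 2 μ} {K : ℝ}
    (hx : ∀ j, ‖x j‖ ≤ K)
    (h : ∀ (A : Set X) (hA : MeasurableSet A) (hμ : μ A ≠ ∞) (c : Y),
      Tendsto (fun j => (inner ℝ (indicatorConstLp 2 hA hμ c) (x j) : ℝ)) atTop (𝓝 0)) (S : Lp Y 2 μ) :
    Tendsto (fun j => (inner ℝ S (x j) : ℝ)) atTop (𝓝 0) := by
  refine Lp.induction (by norm_num)
    (motive := fun S => Tendsto (fun j => (inner ℝ S (x j) : ℝ)) atTop (𝓝 0)) ?_ ?_ ?_ S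
  · intro c A hA hμ
    rw [Lp.simpleFunc.coe_indicatorConst]
    exact h A hA hμ.ne c
  · intro f g hf hg _ h1 h2
    have := h1.add h2
    rw [add_zero] at this
    refine this.congr fun j => ?_
    rw [inner_add_left]
  · refine isClosed_setOf_tendsto_zero (K := K) fun j y z => ?_
    rw [← inner_sub_left, mul_comm]
    refine (abs_real_inner_le_norm _ _).trans ?_
    gcongr
    exact hx j

theorem inner_indicatorConstLp_tensor {B : Set (E n)} (hB : MeasurableSet B)
    (hμ : volume B ≠ ∞) (c : SeqL2) (ξ : H n) (z : SeqL2) :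
    (inner ℝ (indicatorConstLp 2 hB hμ c) (tensor n ξ z) : ℝ)
      = inner ℝ c z * inner ℝ (indicatorConstLp 2 hB hμ (1 : ℝ)) ξ := by
  rw [L2.inner_indicatorConstLp_eq_setIntegral_inner,
    L2.inner_indicatorConstLp_eq_setIntegral_inner, ← integral_const_mul]
  refine integral_congr_ae ?_
  filter_upwards [ae_restrict_of_ae (coeFn_tensor ξ z)] with x hx
  rw [hx, inner_smul_right]
  simp [mul_comm]

variable {T : ℝ} {w : ℕ → ℝ → H n} {Z : ℕ → Control T} {M : ℝ}

theorem tendsto_setIntegral_inner_control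
    (hZ : ∀ φ : Control T →L[ℝ] ℝ, Tendsto (fun j => φ (Z j)) atTop (𝓝 0)) {A : Set ℝ}
    (hA : MeasurableSet A) (c : SeqL2) :
    Tendsto (fun j => ∫ s in A, (inner ℝ c (Z j s) : ℝ) ∂(volume.restrict (Icc 0 T))) atTop
      (𝓝 0) := by
  have hμ : (volume.restrict (Icc 0 T)) A ≠ ∞ := measure_ne_top _ _
  refine (hZ (innerSL ℝ (indicatorConstLp 2 hA hμ c))).congr fun j => ?_
  rw [innerSL_apply_apply, L2.inner_indicatorConstLp_eq_setIntegral_inner]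

theorem integral_abs_inner_control_le (hT : 0 ≤ T) (c : SeqL2) (z : Control T) :
    ∫ s in Icc 0 T, |(inner ℝ c (z s) : ℝ)| ≤ ‖c‖ * (T + ‖z‖ ^ 2) := by
  have h1 := integrableOn_control_sq z
  have h2 : IntegrableOn (fun s => 1 + ‖z s‖ ^ 2) (Icc 0 T) := (integrable_const _).add h1
  calc ∫ s in Icc 0 T, |(inner ℝ c (z s) : ℝ)| ≤ ∫ s in Icc 0 T, ‖c‖ * (1 + ‖z s‖ ^ 2) := by
        refine integral_mono_of_nonneg (Eventually.of_forall fun s => abs_nonneg _)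
          (h2.const_mul _) (Eventually.of_forall fun s => ?_)
        refine (abs_real_inner_le_norm _ _).trans ?_
        refine mul_le_mul_of_nonneg_left ?_ (norm_nonneg _)
        nlinarith [sq_nonneg (‖z s‖ - 1)]
    _ = ‖c‖ * (T + ‖z‖ ^ 2) := by
        rw [integral_const_mul, integral_add (integrable_const _) h1, norm_control_sq,
          setIntegral_const, measureReal_def, Real.volume_Icc, sub_zero,
          ENNReal.toReal_ofReal hT, smul_eq_mul, mul_one]

/-- A product of a weakly equicontinuous sequence and a weakly null sequence is weakly null. -/
theorem tendsto_integral_inner_tensor (hT : 0 ≤ T)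
    (hw : ∀ j, ContinuousOn (w j) (Icc 0 T)) (hwM : ∀ j, ∀ t ∈ Icc 0 T, ‖w j t‖ ≤ M)
    (heq : ∀ ξ : H n, EquicontSeq T fun j t => inner ℝ ξ (w j t))
    (hZ : ∀ φ : Control T →L[ℝ] ℝ, Tendsto (fun j => φ (Z j)) atTop (𝓝 0))
    {S : ℝ → HSeq n} (hS : MemLp S 2 (volume.restrict (Icc 0 T))) :
    Tendsto (fun j => ∫ s in Icc 0 T, (inner ℝ (S s) (tensor n (w j s) (Z j s)) : ℝ)) atTop
      (𝓝 0) := by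
  obtain ⟨B, hB, hZB⟩ := exists_norm_le_of_weak (x := Z) (x₀ := 0) (by simpa using hZ)
  have hM : 0 ≤ M := (norm_nonneg _).trans (hwM 0 0 ⟨le_rfl, hT⟩)
  have hle : ∀ j, ∀ᵐ s ∂(volume.restrict (Icc 0 T)), ‖tensor n (w j s) (Z j s)‖ ≤ M * ‖Z j s‖ := by
    intro j
    filter_upwards [ae_restrict_mem measurableSet_Icc] with s hs
    refine (norm_tensor_le _ _).trans ?_
    gcongr
    exact hwM j s hs
  have hX : ∀ j, MemLp (fun s => tensor n (w j s) (Z j s)) 2 (volume.restrict (Icc 0 T)) := fun j =>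
    MemLp.of_le_mul (Lp.memLp (Z j)) ((tensor n).aestronglyMeasurable_comp₂
      ((hw j).aestronglyMeasurable measurableSet_Icc) (Lp.memLp (Z j)).1) (hle j)
  let X : ℕ → Lp (HSeq n) 2 (volume.restrict (Icc 0 T)) := fun j => (hX j).toLp _
  have hXM : ∀ j, ‖X j‖ ≤ M * B := fun j => by
    refine (Lp.norm_le_mul_norm_of_ae_le_mul (g := Z j) (c := M) ?_).trans ?_
    · filter_upwards [hle j, (hX j).coeFn_toLp] with s h1 h2
      rwa [h2]
    · have := hZB j
      gcongr
  have key : ∀ (A : Set ℝ) (hA : MeasurableSet A) (hμ : (volume.restrict (Icc 0 T)) A ≠ ∞)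
      (S₀ : HSeq n),
      Tendsto (fun j => (inner ℝ (indicatorConstLp 2 hA hμ S₀) (X j) : ℝ)) atTop (𝓝 0) := by
    intro A hA hμ S₀
    -- Cauchy–Schwarz by duality: the integral `y` is tested against itself through the indicator
    -- function of `A` with value `y`.
    have hbound : ∀ j, ‖∫ s in A, X j s ∂(volume.restrict (Icc 0 T))‖
        ≤ (volume.restrict (Icc 0 T)).real A ^ (1 / (2 : ℝ≥0∞).toReal) * (M * B) := fun j => by
      set y := ∫ s in A, X j s ∂(volume.restrict (Icc 0 T)) with hy
      rcases (norm_nonneg y).eq_or_lt with h0 | h0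
      · rw [← h0]; positivity
      have h1 : ‖y‖ * ‖y‖ = inner ℝ (indicatorConstLp 2 hA hμ y) (X j) := by
        rw [L2.inner_indicatorConstLp_eq_inner_setIntegral, ← hy, real_inner_self_eq_norm_mul_norm]
      have h2 := real_inner_le_norm (indicatorConstLp 2 hA hμ y) (X j)
      rw [← h1, norm_indicatorConstLp (by norm_num) (by norm_num), mul_assoc] at h2
      refine (le_of_mul_le_mul_left h2 h0).trans ?_
      have := hXM j
      gcongr
    refine (tendsto_inner_zero_of_indicator hbound ?_ S₀).congr fun j => by
      rw [L2.inner_indicatorConstLp_eq_inner_setIntegral]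
    intro D hD hμD c
    -- Against `1_A ⊗ 1_D ⊗ c` the tensor product factorises into a weakly null and an
    -- equicontinuous scalar function of time.
    have hind : ∀ j, (inner ℝ (indicatorConstLp 2 hD hμD c)
        (∫ s in A, X j s ∂(volume.restrict (Icc 0 T))) : ℝ)
        = ∫ s in Icc 0 T, A.indicator (fun s => (inner ℝ c (Z j s) : ℝ)) s
          * inner ℝ (indicatorConstLp 2 hD hμD (1 : ℝ)) (w j s) := fun j => by
      rw [← L2.inner_indicatorConstLp_eq_inner_setIntegral ℝ hA hμ,
        L2.inner_indicatorConstLp_eq_setIntegral_inner, ← integral_indicator hA]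
      refine integral_congr_ae ?_
      filter_upwards [(hX j).coeFn_toLp] with s hs
      by_cases hsA : s ∈ A
      · rw [indicator_of_mem hsA, indicator_of_mem hsA]
        simp only [X]
        rw [hs, inner_indicatorConstLp_tensor]
      · rw [indicator_of_notMem hsA, indicator_of_notMem hsA, zero_mul]
    simp_rw [hind]
    have hint : ∀ j, IntegrableOn (fun s => (inner ℝ c (Z j s) : ℝ)) (Icc 0 T) := fun j =>
      ((Lp.memLp (Z j)).integrable (by norm_num)).const_inner c
    refine tendsto_integral_mul_equicont (heq _)
      (M := ‖indicatorConstLp 2 hD hμD (1 : ℝ)‖ * M + ‖c‖ * (T + B ^ 2))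
      (fun j => continuousOn_const.inner (𝕜 := ℝ) (hw j))
      (fun j t ht => ?_) (fun j => (hint j).indicator hA) (fun j => ?_) fun A' hA' => ?_
    · have h1 : 0 ≤ ‖c‖ * (T + B ^ 2) := by positivity
      have h2 := (abs_real_inner_le_norm (indicatorConstLp 2 hD hμD (1 : ℝ)) (w j t))
      have h3 := mul_le_mul_of_nonneg_left (hwM j t ht)
        (norm_nonneg (indicatorConstLp 2 hD hμD (1 : ℝ)))
      linarith
    · have h1 : 0 ≤ ‖indicatorConstLp 2 hD hμD (1 : ℝ)‖ * M := by positivity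
      have h2 := integral_abs_inner_control_le hT c (Z j)
      have h3 : ‖c‖ * (T + ‖Z j‖ ^ 2) ≤ ‖c‖ * (T + B ^ 2) := by
        have := hZB j
        gcongr
      have h4 : ∫ s in Icc 0 T, |A.indicator (fun s => (inner ℝ c (Z j s) : ℝ)) s|
          ≤ ∫ s in Icc 0 T, |(inner ℝ c (Z j s) : ℝ)| := by
        refine integral_mono ((hint j).indicator hA).abs (hint j).abs fun s => ?_
        by_cases hsA : s ∈ A
        · simp [indicator_of_mem hsA]
        · simp [indicator_of_notMem hsA]
      linarith
    · refine (tendsto_setIntegral_inner_control hZ (hA'.inter hA) c).congr fun j => ?_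
      rw [setIntegral_indicator hA]
  refine (tendsto_inner_zero_of_indicator hXM key (hS.toLp S)).congr fun j => ?_
  rw [L2.inner_def]
  refine integral_congr_ae ?_
  filter_upwards [hS.coeFn_toLp, (hX j).coeFn_toLp] with s h1 h2
  simp only [X]
  rw [h1, h2]

end Weak

end FracRD

namespace FracRD

variable {n : ℕ}

/-! ### Criteria for equicontinuity -/

section Equicontinuity

variable {T : ℝ} {y : ℕ → ℝ → ℝ}

theorem EquicontSeq.congr (hy : EquicontSeq T y) {y' : ℕ → ℝ → ℝ}
    (h : ∀ j, ∀ t ∈ Icc 0 T, y' j t = y j t) : EquicontSeq T y' := fun ε hε => by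
  obtain ⟨η, hη, H⟩ := hy ε hε
  exact ⟨η, hη, fun j t ht t' ht' htt => by rw [h j t ht, h j t' ht']; exact H j t ht t' ht' htt⟩

theorem EquicontSeq.add_continuousOn (hy : EquicontSeq T y) {f : ℝ → ℝ}
    (hf : ContinuousOn f (Icc 0 T)) : EquicontSeq T fun j t => y j t + f t := fun ε hε => by
  obtain ⟨η, hη, H⟩ := hy (ε / 2) (half_pos hε)
  obtain ⟨η', hη', H'⟩ := Metric.uniformContinuousOn_iff.1
    (isCompact_Icc.uniformContinuousOn_of_continuous hf) (ε / 2) (half_pos hε)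
  refine ⟨min η (η' / 2), by positivity, fun j t ht t' ht' htt => ?_⟩
  have h1 := H j t ht t' ht' (htt.trans (min_le_left _ _))
  have h2 := H' t ht t' ht' (by
    rw [Real.dist_eq]
    linarith [htt.trans (min_le_right _ _)])
  rw [Real.dist_eq] at h2
  have h3 := abs_add_le (y j t - y j t') (f t - f t')
  rw [show y j t + f t - (y j t' + f t') = (y j t - y j t') + (f t - f t') by ring]
  linarith

theorem equicontSeq_primitive {f : ℕ → ℝ → ℝ} (hf : ∀ j, IntegrableOn (f j) (Icc 0 T))
    (h : ∀ ε > 0, ∃ η > 0, ∀ j, ∀ t' ∈ Icc 0 T, ∀ t ∈ Icc 0 T, t' ≤ t → t - t' ≤ η →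
      ∫ s in Ioc t' t, |f j s| ≤ ε) : EquicontSeq T fun j t => ∫ s in Icc 0 t, f j s := by
  intro ε hε
  obtain ⟨η, hη, H⟩ := h ε hε
  have key : ∀ j, ∀ t' ∈ Icc 0 T, ∀ t ∈ Icc 0 T, t' ≤ t → t - t' ≤ η →
      |(∫ s in Icc 0 t, f j s) - ∫ s in Icc 0 t', f j s| ≤ ε := by
    intro j t' ht' t ht htt hd
    have e : (∫ s in Icc 0 t, f j s) = (∫ s in Icc 0 t', f j s) + ∫ s in Ioc t' t, f j s := by
      rw [← setIntegral_union _ measurableSet_Ioc ((hf j).mono_set (Icc_subset_Icc_right ht'.2))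
        ((hf j).mono_set fun s hs => ⟨ht'.1.trans hs.1.le, hs.2.trans ht.2⟩),
        Icc_union_Ioc_eq_Icc ht'.1 htt]
      exact disjoint_left.2 fun s h1 h2 => absurd h1.2 (not_le.2 h2.1)
    rw [e, add_sub_cancel_left]
    exact (abs_integral_le_integral_abs (f := f j)).trans (H j t' ht' t ht htt hd)
  refine ⟨η, hη, fun j t ht t' ht' hd => ?_⟩
  rcases le_total t' t with htt | htt
  · exact key j t' ht' t ht htt ((le_abs_self _).trans hd)
  · rw [abs_sub_comm]
    exact key j t ht t' ht' htt ((neg_sub t t' ▸ neg_le_abs (t - t')).trans hd)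

/-- Records the order of choices: first the Young parameter `δ`, then the truncation level `N`, and
last the interval length `h`, so that the possibly huge `c δ N` is harmless. -/
theorem exists_modulus {a : ℝ → ℝ} (ha : Tendsto a (𝓝[>] 0) (𝓝 0)) {b : ℝ → ℝ → ℝ}
    (hb : ∀ δ > 0, Tendsto (b δ) atTop (𝓝 0)) (c : ℝ → ℝ → ℝ) {ε : ℝ} (hε : 0 < ε) :
    ∃ η > 0, ∀ x h : ℝ, 0 ≤ h → h ≤ η →
      (∀ δ > 0, ∀ N > 0, x ≤ a δ + b δ N + c δ N * h) → x ≤ ε := by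
  obtain ⟨δ, h1, hδ⟩ := ((ha.eventually_le_const (show 0 < ε / 3 by positivity)).and
    self_mem_nhdsWithin).exists
  obtain ⟨N, h2, hN⟩ := (((hb δ hδ).eventually_le_const (show 0 < ε / 3 by positivity)).and
    (eventually_gt_atTop 0)).exists
  refine ⟨ε / (3 * (|c δ N| + 1)), by positivity, fun x h hh0 hh H => ?_⟩
  have h3 := H δ hδ N hN
  have h4 : c δ N * h ≤ ε / 3 := by
    calc c δ N * h ≤ (|c δ N| + 1) * (ε / (3 * (|c δ N| + 1))) := by
          gcongr
          linarith [le_abs_self (c δ N)]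
      _ = ε / 3 := by field_simp
  linarith

/-- The equation may only be tested with `V ∩ L^p`, whereas the indicator functions needed later are
general elements of `H`; the uniform bound bridges the gap. -/
theorem equicontSeq_inner_of_dense {w : ℕ → ℝ → H n} {M : ℝ} (hM : ∀ j, ∀ t ∈ Icc 0 T, ‖w j t‖ ≤ M)
    {D : Set (H n)} (hD : Dense D) (h : ∀ ξ ∈ D, EquicontSeq T fun j t => inner ℝ ξ (w j t))
    (ξ : H n) : EquicontSeq T fun j t => inner ℝ ξ (w j t) := by
  intro ε hε
  obtain ⟨ζ, hζ, hd⟩ := hD.exists_dist_lt ξ (show 0 < ε / (4 * (|M| + 1)) by positivity)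
  obtain ⟨η, hη, H⟩ := h ζ hζ (ε / 2) (half_pos hε)
  refine ⟨η, hη, fun j t ht t' ht' htt => ?_⟩
  have h1 := H j t ht t' ht' htt
  simp only at h1 ⊢
  rw [← inner_sub_right] at h1 ⊢
  have h2 := abs_real_inner_le_norm (ξ - ζ) (w j t - w j t')
  have h3 : ‖w j t - w j t'‖ ≤ 2 * (|M| + 1) := by
    have := norm_sub_le (w j t) (w j t')
    linarith [hM j t ht, hM j t' ht', le_abs_self M]
  rw [dist_eq_norm, lt_div_iff₀ (by positivity)] at hd
  have h4 : ‖ξ - ζ‖ * ‖w j t - w j t'‖ ≤ ‖ξ - ζ‖ * (2 * (|M| + 1)) := by gcongr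
  have h5 := abs_add_le (inner ℝ (ξ - ζ) (w j t - w j t')) (inner ℝ ζ (w j t - w j t'))
  rw [← inner_add_left, sub_add_cancel] at h5
  linarith

end Equicontinuity

/-! ### Equicontinuity of solutions and of the remainder -/

section Solutions

variable {α p q T : ℝ} {lam₁ lam₂ : ℝ} {ψ₁ ψ₂ ψ₃ ψ₄ : ℝ → E n → ℝ} {F : ℝ → E n → ℝ → ℝ}
  {g : ℝ → H n} {κ : E n → ℝ} {σ₁ : ℝ → HSeq n} {σ₂ : ℕ → ℝ → E n → ℝ → ℝ} {a b c : ℕ → ℝ}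
  {u₀ : H n}

theorem setIntegral_control_sq_le (v : Control T) {A : Set ℝ} (hA : A ⊆ Icc 0 T) :
    ∫ s in A, ‖v s‖ ^ 2 ≤ ‖v‖ ^ 2 := by
  rw [← norm_control_sq]
  exact setIntegral_mono_set (integrableOn_control_sq v)
    (Eventually.of_forall fun s => by positivity) hA.eventuallyLE

/-- Uniform integrability in time: as `q < p`, a large `N` makes the first term small uniformly over
trajectories with the bound `M`, and a short interval then makes the second term small. -/
theorem NoiseAssumptions.exists_setIntegral_noise_sq_le
    (hσ : NoiseAssumptions p q κ σ₁ σ₂ a b c) (hp : 2 < p) (T : ℝ) : ∃ K : ℝ, 0 ≤ K ∧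
      ∀ (α : ℝ) (u : ℝ → H n) (U : ℝ × E n → ℝ) (Uh : ℝ × E n → ℂ) (M : ℝ), Repr α p T u U Uh →
      ContinuousOn u (Icc 0 T) → (∀ t ∈ Icc 0 T, ‖u t‖ ≤ M) → ∫ z, ‖U z‖ ^ p ≤ M →
      ∀ t' ∈ Icc 0 T, ∀ t ∈ Icc 0 T, t' ≤ t → ∀ N > 0,
        ∫ s in Ioc t' t, ‖noise κ σ₁ σ₂ s (u s)‖ ^ 2
          ≤ K * (N ^ (q - p) * M) + K * (1 + N ^ (q - 2) * M ^ 2) * (t - t') := by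
  obtain ⟨K, hK0, hK⟩ := hσ.exists_norm_noise_sq_le_repr hp T
  refine ⟨K, hK0, fun α u U Uh M hU hc hM hMU t' ht' t ht htt N hN => ?_⟩
  have hsub : Ioc t' t ⊆ Icc 0 T := fun s hs => ⟨ht'.1.trans hs.1.le, hs.2.trans ht.2⟩
  have hS := hσ.memLp_noise hp hU hc
  have i1 : IntegrableOn (fun s => ‖noise κ σ₁ σ₂ s (u s)‖ ^ 2) (Ioc t' t) :=
    ((memLp_two_iff_integrable_sq_norm hS.1).1 hS).mono_measure (Measure.restrict_mono hsub le_rfl)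
  have i2 := hU.integrableOn_section hp
  have i2' : IntegrableOn (fun s => K * N ^ (q - p) * ∫ x, ‖U (s, x)‖ ^ p) (Ioc t' t) :=
    i2.integrableOn.const_mul _
  have i3 : IntegrableOn (fun _ => K * (1 + N ^ (q - 2) * M ^ 2)) (Ioc t' t) := integrable_const _
  calc ∫ s in Ioc t' t, ‖noise κ σ₁ σ₂ s (u s)‖ ^ 2
      ≤ ∫ s in Ioc t' t, (K * N ^ (q - p) * (∫ x, ‖U (s, x)‖ ^ p)
        + K * (1 + N ^ (q - 2) * M ^ 2)) := by
        refine integral_mono_ae i1 (i2'.add i3) ?_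
        filter_upwards [ae_mono (Measure.restrict_mono hsub le_rfl) (hK α u U Uh hU N hN),
          ae_restrict_mem measurableSet_Ioc] with s h1 hs
        refine h1.trans ?_
        have h2 : N ^ (q - 2) * ‖u s‖ ^ 2 ≤ N ^ (q - 2) * M ^ 2 := by
          have := hM s (hsub hs)
          gcongr
        have h3 := mul_le_mul_of_nonneg_left h2 hK0
        linarith
    _ = K * N ^ (q - p) * (∫ s in Ioc t' t, ∫ x, ‖U (s, x)‖ ^ p)
        + K * (1 + N ^ (q - 2) * M ^ 2) * (t - t') := by
        rw [integral_add i2' i3, integral_const_mul, setIntegral_const, measureReal_def,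
          Real.volume_Ioc, ENNReal.toReal_ofReal (by linarith), smul_eq_mul]
        ring
    _ ≤ _ := by
        have h1 := setIntegral_section_le (hU.integrable_rpow hp) (fun z => by positivity)
          (Ioc t' t)
        have h2 : K * N ^ (q - p) * (∫ s in Ioc t' t, ∫ x, ‖U (s, x)‖ ^ p)
            ≤ K * N ^ (q - p) * M := by
          have : ∫ s in Ioc t' t, ∫ x, ‖U (s, x)‖ ^ p ≤ M := h1.trans hMU
          gcongr
        linarith

theorem tendsto_const_mul_sq_nhdsGT (C : ℝ) : Tendsto (fun δ : ℝ => C * δ ^ 2) (𝓝[>] 0) (𝓝 0) := by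
  have h : Tendsto (fun δ : ℝ => C * δ ^ 2) (𝓝 0) (𝓝 (C * 0 ^ 2)) :=
    (by fun_prop : Continuous fun δ : ℝ => C * δ ^ 2).tendsto 0
  simpa using h.mono_left nhdsWithin_le_nhds

theorem NoiseAssumptions.tendsto_rpow_atTop (hσ : NoiseAssumptions p q κ σ₁ σ₂ a b c) (hp : 2 < p)
    (C M : ℝ) : Tendsto (fun N : ℝ => C * (N ^ (q - p) * M)) atTop (𝓝 0) := by
  have h := tendsto_rpow_neg_atTop (y := p - q) (by linarith [hσ.q_le])
  rw [neg_sub] at h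
  simpa using (h.mul_const M).const_mul C

set_option maxHeartbeats 1000000 in
theorem exists_setIntegral_weakRhs_le (hF : DriftAssumptions p lam₁ lam₂ ψ₁ ψ₂ ψ₃ ψ₄ F)
    (hσ : NoiseAssumptions p q κ σ₁ σ₂ a b c) {ξ : H n} (hξV : MemV α ξ)
    (hξp : MemLp ξ (ENNReal.ofReal p) volume) (M B : ℝ) {ε : ℝ} (hε : 0 < ε) :
    ∃ η > 0, ∀ (v : Control T) (u : ℝ → H n) (U : ℝ × E n → ℝ) (Uh : ℝ × E n → ℂ), ‖v‖ ≤ B →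
      IsSolution α p T F g κ σ₁ σ₂ u₀ v u → Repr α p T u U Uh → (∀ t ∈ Icc 0 T, ‖u t‖ ≤ M) →
      ∫ z, ‖Uh z‖ ^ 2 ≤ M → ∫ z, ‖U z‖ ^ p ≤ M →
      ∀ t' ∈ Icc 0 T, ∀ t ∈ Icc 0 T, t' ≤ t → t - t' ≤ η →
        ∫ s in Ioc t' t, |weakRhs α Uh (drift T F U)
          (fun s => contract n (noise κ σ₁ σ₂ s (u s)) (v s)) ξ s| ≤ ε := by
  have hp := hF.two_lt_p
  have hr := holderConjugate_conj hp
  set r := p / (p - 1) with hrdef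
  obtain ⟨K, hK0, hK⟩ := hσ.exists_setIntegral_noise_sq_le hp T
  obtain ⟨C, hC0, hC⟩ := hF.exists_drift_bound T
  have hξV' : MemLp (fracLapFourier (α / 2) (complexify ξ)) 2 (volume : Measure (E n)) := hξV
  set cV := ∫ η, ‖fracLapFourier (α / 2) (complexify ξ) η‖ ^ 2 with hcV
  set cF := ∫ x, ‖ξ x‖ ^ p with hcF
  -- The three summands of `a` belong to the fractional Laplacian, the drift and the control; `b` is
  -- the tail of the noise, and the last function collects everything proportional to the interval
  -- length.
  obtain ⟨η, hη, H⟩ := exists_modulus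
    (a := fun δ => M * δ ^ 2 + (δ ^ r * (C * (1 + M))) + (‖ξ‖ * B) ^ 2 * δ ^ 2)
    (by
      have h : Tendsto (fun δ : ℝ => δ ^ r * (C * (1 + M))) (𝓝[>] 0) (𝓝 0) := by
        have h1 := ((Real.continuousAt_rpow_const 0 r (Or.inr hr.pos.le)).tendsto.mul_const
          (C * (1 + M))).mono_left (nhdsWithin_le_nhds (s := Ioi 0))
        rwa [Real.zero_rpow hr.pos.ne', zero_mul] at h1
      simpa using ((tendsto_const_mul_sq_nhdsGT M).add h).add
        (tendsto_const_mul_sq_nhdsGT ((‖ξ‖ * B) ^ 2)))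
    (b := fun δ N => (δ⁻¹ ^ 2 * K) * (N ^ (q - p) * M))
    (fun δ _ => hσ.tendsto_rpow_atTop hp _ _)
    (fun δ N => δ⁻¹ ^ 2 * cV + δ⁻¹ ^ p * cF + δ⁻¹ ^ 2 * (K * (1 + N ^ (q - 2) * M ^ 2))) hε
  refine ⟨η, hη, fun v u U Uh hv hu hU hM hMh hMU t' ht' t ht htt hd => ?_⟩
  refine H _ (t - t') (by linarith) hd fun δ hδ N hN => ?_
  have hsub : Ioc t' t ⊆ Icc 0 T := fun s hs => ⟨ht'.1.trans hs.1.le, hs.2.trans ht.2⟩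
  have hvol : (volume (Ioc t' t)).toReal = t - t' := by
    rw [Real.volume_Ioc, ENNReal.toReal_ofReal (by linarith)]
  have hfin : volume (Ioc t' t) < ∞ := by simp
  obtain ⟨hΦ, hΦb⟩ := hC U hU.measurable_U hU.memLp_U
  have hst : MemLp (fun z => starRingEnd ℂ (Uh z)) 2 volume := hU.memLp_Uh.star
  obtain ⟨i1, b1⟩ := section_pairing (f := fun z => starRingEnd ℂ (Uh z)) Real.HolderConjugate.two_two
    hst.1 hξV'.1 (integrable_norm_rpow_ofReal two_pos (by simpa using hst))
    (integrable_norm_rpow_ofReal two_pos (by simpa using hξV')) hfin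
  obtain ⟨i2, b2⟩ := section_pairing hr hΦ.1 hξp.1 (integrable_norm_rpow_ofReal hr.pos hΦ)
    (integrable_norm_rpow_ofReal (by linarith) hξp) hfin
  have hS := hσ.memLp_noise hp hU hu.continuousOn
  have iS : IntegrableOn (fun s => ‖noise κ σ₁ σ₂ s (u s)‖ ^ 2) (Ioc t' t) :=
    ((memLp_two_iff_integrable_sq_norm hS.1).1 hS).mono_measure (Measure.restrict_mono hsub le_rfl)
  have iv := (integrableOn_control_sq v).mono_set hsub
  have ivS : IntegrableOn (fun s => δ ^ 2 * ‖ξ‖ ^ 2 * ‖v s‖ ^ 2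
      + δ⁻¹ ^ 2 * ‖noise κ σ₁ σ₂ s (u s)‖ ^ 2) (Ioc t' t) := (iv.const_mul _).add (iS.const_mul _)
  have i1' := i1.norm
  have i2' := i2.norm
  have b1' := b1 δ hδ
  have b2' := b2 δ hδ
  have b3' := hK α u U Uh M hU hu.continuousOn hM hMU t' ht' t ht htt N hN
  have b4' := (setIntegral_control_sq_le v hsub).trans (by gcongr : ‖v‖ ^ 2 ≤ B ^ 2)
  have hmono : ∫ s in Ioc t' t, |weakRhs α Uh (drift T F U)
        (fun s => contract n (noise κ σ₁ σ₂ s (u s)) (v s)) ξ s|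
      ≤ ∫ s in Ioc t' t, (‖∫ η, starRingEnd ℂ (Uh (s, η))
          * fracLapFourier (α / 2) (complexify ξ) η‖ + ‖∫ x, drift T F U (s, x) * ξ x‖
          + (δ ^ 2 * ‖ξ‖ ^ 2 * ‖v s‖ ^ 2 + δ⁻¹ ^ 2 * ‖noise κ σ₁ σ₂ s (u s)‖ ^ 2)) := by
    refine integral_mono_of_nonneg (Eventually.of_forall fun s => abs_nonneg _)
      ((i1'.add i2').add ivS) (Eventually.of_forall fun s => ?_)
    have e1 := Complex.abs_re_le_norm (∫ η, starRingEnd ℂ (Uh (s, η))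
          * fracLapFourier (α / 2) (complexify ξ) η)
    have e3 := abs_inner_tensor_le (noise κ σ₁ σ₂ s (u s)) ξ (v s)
    have e4 : ‖noise κ σ₁ σ₂ s (u s)‖ * (‖ξ‖ * ‖v s‖)
        ≤ δ ^ 2 * ‖ξ‖ ^ 2 * ‖v s‖ ^ 2 + δ⁻¹ ^ 2 * ‖noise κ σ₁ σ₂ s (u s)‖ ^ 2 := by
      have h1 : δ * δ⁻¹ = 1 := mul_inv_cancel₀ hδ.ne'
      have h2 : ‖noise κ σ₁ σ₂ s (u s)‖ * (‖ξ‖ * ‖v s‖)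
          = (δ * (‖ξ‖ * ‖v s‖)) * (δ⁻¹ * ‖noise κ σ₁ σ₂ s (u s)‖) := by
        linear_combination (-(‖noise κ σ₁ σ₂ s (u s)‖ * (‖ξ‖ * ‖v s‖))) * h1
      rw [h2]
      nlinarith [sq_nonneg (δ * (‖ξ‖ * ‖v s‖) - δ⁻¹ * ‖noise κ σ₁ σ₂ s (u s)‖),
        sq_nonneg (δ * (‖ξ‖ * ‖v s‖)), sq_nonneg (δ⁻¹ * ‖noise κ σ₁ σ₂ s (u s)‖)]
    simp only [weakRhs]
    rw [inner_contract]
    refine (abs_add_le _ _).trans (add_le_add ((abs_sub _ _).trans ?_) (e3.trans e4))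
    rw [abs_neg]
    exact add_le_add e1 le_rfl
  have i12 : IntegrableOn (fun s => ‖∫ η, starRingEnd ℂ (Uh (s, η))
      * fracLapFourier (α / 2) (complexify ξ) η‖ + ‖∫ x, drift T F U (s, x) * ξ x‖) (Ioc t' t) :=
    i1'.add i2'
  rw [integral_add i12 ivS, integral_add i1' i2', integral_add (iv.const_mul _) (iS.const_mul _),
    integral_const_mul, integral_const_mul] at hmono
  have d1 : ∫ s in Ioc t' t, ∫ η, ‖starRingEnd ℂ (Uh (s, η))‖ ^ (2 : ℝ) ≤ M := by
    simp only [RCLike.norm_conj, Real.rpow_two]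
    exact (setIntegral_section_le hU.integrable_sq (fun z => by positivity) _).trans hMh
  have d2 : ∫ s in Ioc t' t, ∫ x, ‖drift T F U (s, x)‖ ^ r ≤ C * (1 + M) := by
    refine (setIntegral_section_le (integrable_norm_rpow_ofReal hr.pos hΦ)
      (fun z => by positivity) _).trans (hΦb.trans ?_)
    gcongr
  simp only [Real.rpow_two] at d1 b1'
  rw [hvol] at b1' b2'
  have f1 := mul_le_mul_of_nonneg_left d1 (sq_nonneg δ)
  have f2 := mul_le_mul_of_nonneg_left d2 (Real.rpow_nonneg hδ.le r)
  have f3 := mul_le_mul_of_nonneg_left b3' (sq_nonneg δ⁻¹)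
  have f4 := mul_le_mul_of_nonneg_left b4' (by positivity : 0 ≤ δ ^ 2 * ‖ξ‖ ^ 2)
  rw [← hcV] at b1'
  rw [← hcF] at b2'
  linarith

/-- The terms of the equation that vary with `j` are primitives with a uniform modulus; `u₀` and `g`
contribute one continuous function common to all `j`. -/
theorem equicontSeq_inner_solution (hα : α ∈ Ioo (0 : ℝ) 1)
    (hF : DriftAssumptions p lam₁ lam₂ ψ₁ ψ₂ ψ₃ ψ₄ F)
    (hσ : NoiseAssumptions p q κ σ₁ σ₂ a b c) (hg : MemLp g 2 (volume.restrict (Icc 0 T)))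
    {vv : ℕ → Control T} {uu : ℕ → ℝ → H n} {UU : ℕ → ℝ × E n → ℝ} {UUh : ℕ → ℝ × E n → ℂ}
    {B M : ℝ} (hv : ∀ j, ‖vv j‖ ≤ B) (hu : ∀ j, IsSolution α p T F g κ σ₁ σ₂ u₀ (vv j) (uu j))
    (hU : ∀ j, Repr α p T (uu j) (UU j) (UUh j)) (hM : ∀ j, ∀ t ∈ Icc 0 T, ‖uu j t‖ ≤ M)
    (hMh : ∀ j, ∫ z, ‖UUh j z‖ ^ 2 ≤ M) (hMU : ∀ j, ∫ z, ‖UU j z‖ ^ p ≤ M) (ξ : H n) :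
    EquicontSeq T fun j t => inner ℝ ξ (uu j t) := by
  refine equicontSeq_inner_of_dense hM (dense_memV_memLp hα (ENNReal.ofReal p)) ?_ ξ
  rintro ξ ⟨hξV, hξp⟩
  have hgξ : IntegrableOn (fun s => (inner ℝ (g s) ξ : ℝ)) (Icc 0 T) :=
    (hg.integrable (by norm_num)).inner_const ξ
  have hc : ContinuousOn (fun t => inner ℝ u₀ ξ + ∫ s in Icc 0 t, (inner ℝ (g s) ξ : ℝ)) (Icc 0 T) :=
    continuousOn_const.add (intervalIntegral.continuousOn_primitive_Icc hgξ)
  have h := equicontSeq_primitive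
    (fun j => ((hu j).weak_equation hF hσ (hU j) hξV hξp).1) fun ε hε => by
      obtain ⟨η, hη, H⟩ := exists_setIntegral_weakRhs_le (T := T) (g := g) (u₀ := u₀) hF hσ hξV hξp
        M B hε
      exact ⟨η, hη, fun j => H (vv j) (uu j) (UU j) (UUh j) (hv j) (hu j) (hU j) (hM j) (hMh j)
        (hMU j)⟩
  refine (h.add_continuousOn hc).congr fun j t ht => ?_
  rw [real_inner_comm, ((hu j).weak_equation hF hσ (hU j) hξV hξp).2 t ht,
    intervalIntegral.integral_of_le ht.1, ← integral_Icc_eq_integral_Ioc]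
  ring

/-- What upgrades the convergence of the remainder from fixed `t` to uniform in `t`, as Grönwall
requires. -/
theorem equicontSeq_remainder (hσ : NoiseAssumptions p q κ σ₁ σ₂ a b c) (hp : 2 < p)
    {u : ℝ → H n} {U : ℝ × E n → ℝ} {Uh : ℝ × E n → ℂ} (hU : Repr α p T u U Uh)
    (hu : ContinuousOn u (Icc 0 T)) {vv : ℕ → Control T} {v : Control T} {uu : ℕ → ℝ → H n}
    (huu : ∀ j, ContinuousOn (uu j) (Icc 0 T)) {B M : ℝ} (hv : ∀ j, ‖vv j - v‖ ≤ B)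
    (hM : ∀ j, ∀ t ∈ Icc 0 T, ‖uu j t - u t‖ ≤ M) (hMu : ∀ t ∈ Icc 0 T, ‖u t‖ ≤ M)
    (hMU : ∫ z, ‖U z‖ ^ p ≤ M) :
    EquicontSeq T fun j t => ∫ s in Icc 0 t, remainder κ σ₁ σ₂ (uu j) u (vv j) v s := by
  obtain ⟨K, hK0, hK⟩ := hσ.exists_setIntegral_noise_sq_le hp T
  have hS := hσ.memLp_noise hp hU hu
  refine equicontSeq_primitive (fun j => integrableOn_inner_tensor hS ((huu j).sub hu) _ _)
    fun ε hε => ?_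
  obtain ⟨η, hη, H⟩ := exists_modulus (a := fun δ => (M * B) ^ 2 * δ ^ 2)
    (tendsto_const_mul_sq_nhdsGT _) (b := fun δ N => (δ⁻¹ ^ 2 * K) * (N ^ (q - p) * M))
    (fun δ _ => hσ.tendsto_rpow_atTop hp _ _)
    (fun δ N => δ⁻¹ ^ 2 * (K * (1 + N ^ (q - 2) * M ^ 2))) hε
  refine ⟨η, hη, fun j t' ht' t ht htt hd => H _ (t - t') (by linarith) hd fun δ hδ N hN => ?_⟩
  have hsub : Ioc t' t ⊆ Icc 0 T := fun s hs => ⟨ht'.1.trans hs.1.le, hs.2.trans ht.2⟩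
  have iS : IntegrableOn (fun s => ‖noise κ σ₁ σ₂ s (u s)‖ ^ 2) (Ioc t' t) :=
    ((memLp_two_iff_integrable_sq_norm hS.1).1 hS).mono_measure (Measure.restrict_mono hsub le_rfl)
  have iv := (integrableOn_control_sq (vv j - v)).mono_set hsub
  have b3 := hK α u U Uh M hU hu hMu hMU t' ht' t ht htt N hN
  have b4 := (setIntegral_control_sq_le (vv j - v) hsub).trans
    (by have := hv j; gcongr : ‖vv j - v‖ ^ 2 ≤ B ^ 2)
  have hmono : ∫ s in Ioc t' t, |remainder κ σ₁ σ₂ (uu j) u (vv j) v s|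
      ≤ ∫ s in Ioc t' t, (M ^ 2 * δ ^ 2 * ‖(vv j - v) s‖ ^ 2
        + δ⁻¹ ^ 2 * ‖noise κ σ₁ σ₂ s (u s)‖ ^ 2) := by
    refine integral_mono_of_nonneg (Eventually.of_forall fun s => abs_nonneg _)
      ((iv.const_mul _).add (iS.const_mul _)) ?_
    filter_upwards [ae_mono (Measure.restrict_mono hsub le_rfl) (norm_control_sub_sq_ae (vv j) v),
      ae_restrict_mem measurableSet_Ioc] with s h1 hs
    rw [← h1]
    refine (abs_remainder_le _ _ _ _ _).trans ?_
    have h2 := hM j s (hsub hs)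
    have h3 : ‖noise κ σ₁ σ₂ s (u s)‖ * (‖uu j s - u s‖ * ‖vv j s - v s‖)
        ≤ ‖noise κ σ₁ σ₂ s (u s)‖ * (M * ‖vv j s - v s‖) := by gcongr
    refine h3.trans ?_
    have h4 : δ * δ⁻¹ = 1 := mul_inv_cancel₀ hδ.ne'
    have h5 : ‖noise κ σ₁ σ₂ s (u s)‖ * (M * ‖vv j s - v s‖)
        = (δ * (M * ‖vv j s - v s‖)) * (δ⁻¹ * ‖noise κ σ₁ σ₂ s (u s)‖) := by
      linear_combination (-(‖noise κ σ₁ σ₂ s (u s)‖ * (M * ‖vv j s - v s‖))) * h4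
    rw [h5]
    nlinarith [sq_nonneg (δ * (M * ‖vv j s - v s‖) - δ⁻¹ * ‖noise κ σ₁ σ₂ s (u s)‖),
      sq_nonneg (δ * (M * ‖vv j s - v s‖)), sq_nonneg (δ⁻¹ * ‖noise κ σ₁ σ₂ s (u s)‖)]
  rw [integral_add (iv.const_mul _) (iS.const_mul _), integral_const_mul,
    integral_const_mul] at hmono
  have f3 := mul_le_mul_of_nonneg_left b3 (sq_nonneg δ⁻¹)
  have f4 := mul_le_mul_of_nonneg_left b4 (by positivity : 0 ≤ M ^ 2 * δ ^ 2)
  linarith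

end Solutions

end FracRD

namespace FracRD

variable {n : ℕ}

/-! ### Strong convergence -/

section Convergence

variable {α p q T : ℝ} {lam₁ lam₂ : ℝ} {ψ₁ ψ₂ ψ₃ ψ₄ : ℝ → E n → ℝ} {F : ℝ → E n → ℝ → ℝ}
  {g : ℝ → H n} {κ : E n → ℝ} {σ₁ : ℝ → HSeq n} {σ₂ : ℕ → ℝ → E n → ℝ → ℝ} {a b c : ℕ → ℝ}
  {u₀ : H n}

theorem tendsto_integral_remainder (hT : 0 ≤ T) {S : ℝ → HSeq n}
    (hS : MemLp S 2 (volume.restrict (Icc 0 T))) {w : ℕ → ℝ → H n}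
    (hw : ∀ j, ContinuousOn (w j) (Icc 0 T)) {M : ℝ} (hwM : ∀ j, ∀ t ∈ Icc 0 T, ‖w j t‖ ≤ M)
    (heq : ∀ ξ : H n, EquicontSeq T fun j t => inner ℝ ξ (w j t))
    {vv : ℕ → Control T} {v : Control T}
    (hv : ∀ φ : Control T →L[ℝ] ℝ, Tendsto (fun j => φ (vv j)) atTop (𝓝 (φ v)))
    {t : ℝ} (ht : t ∈ Icc 0 T) :
    Tendsto (fun j => ∫ s in Icc 0 t, (inner ℝ (S s) (tensor n (w j s) (vv j s - v s)) : ℝ)) atTop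
      (𝓝 0) := by
  have hsub : Icc 0 t ⊆ Icc 0 T := Icc_subset_Icc_right ht.2
  -- The upper limit `t` is encoded by cutting `S` off to `[0, t]`, so the result on the full
  -- interval applies.
  have h := tendsto_integral_inner_tensor (Z := fun j => vv j - v) hT hw hwM heq (fun φ => by
    simpa using (hv φ).sub_const (φ v)) (hS.indicator (measurableSet_Icc (a := 0) (b := t)))
  refine h.congr fun j => ?_
  have e : ∀ s, (inner ℝ ((Icc 0 t).indicator S s) (tensor n (w j s) ((vv j - v) s)) : ℝ)
      = (Icc 0 t).indicator (fun s => inner ℝ (S s) (tensor n (w j s) ((vv j - v) s))) s := by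
    intro s
    by_cases hs : s ∈ Icc 0 t
    · rw [indicator_of_mem hs, indicator_of_mem hs]
    · rw [indicator_of_notMem hs, indicator_of_notMem hs, inner_zero_left]
  simp_rw [e]
  rw [setIntegral_indicator measurableSet_Icc, inter_eq_right.2 hsub]
  refine integral_congr_ae ?_
  filter_upwards [ae_mono (Measure.restrict_mono hsub le_rfl) (Lp.coeFn_sub (vv j) v)] with s hs
  rw [hs, Pi.sub_apply]

theorem eventually_close (hα : α ∈ Ioo (0 : ℝ) 1) (hT : 0 < T)
    (hF : DriftAssumptions p lam₁ lam₂ ψ₁ ψ₂ ψ₃ ψ₄ F)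
    (hσ : NoiseAssumptions p q κ σ₁ σ₂ a b c) (hg : MemLp g 2 (volume.restrict (Icc 0 T)))
    {vv : ℕ → Control T} {v : Control T}
    (hv : ∀ φ : Control T →L[ℝ] ℝ, Tendsto (fun j => φ (vv j)) atTop (𝓝 (φ v)))
    {uu : ℕ → ℝ → H n} {u : ℝ → H n}
    (huu : ∀ j, IsSolution α p T F g κ σ₁ σ₂ u₀ (vv j) (uu j))
    (hu : IsSolution α p T F g κ σ₁ σ₂ u₀ v u)
    {UU : ℕ → ℝ × E n → ℝ} {UUh : ℕ → ℝ × E n → ℂ} (hUU : ∀ j, Repr α p T (uu j) (UU j) (UUh j))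
    {U : ℝ × E n → ℝ} {Uh : ℝ × E n → ℂ} (hU : Repr α p T u U Uh) {ε : ℝ} (hε : 0 < ε) :
    ∀ᶠ j in atTop, (∀ t ∈ Icc 0 T, ‖uu j t - u t‖ ^ 2 ≤ ε) ∧
      ∫ z, ‖UUh j z - Uh z‖ ^ 2 ≤ ε ∧ ∫ z, ‖UU j z - U z‖ ^ p ≤ ε := by
  have hp := hF.two_lt_p
  obtain ⟨B, hB, hvB⟩ := exists_norm_le_of_weak hv
  -- The maximum lets one constant bound the sequence and the limit solution alike.
  obtain ⟨M, hM, hbd⟩ := exists_apriori_bound hα hT hF hσ hu hU (max B ‖v‖)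
  have hbdj := fun j => hbd (vv j) (uu j) (UU j) (UUh j) ((hvB j).trans (le_max_left _ _)) (huu j)
    (hUU j)
  obtain ⟨m1, -, m3⟩ := hbd v u U Uh (le_max_right _ _) hu hU
  have hw : ∀ j, ContinuousOn (fun t => uu j t - u t) (Icc 0 T) := fun j =>
    (huu j).continuousOn.sub hu.continuousOn
  have hwM : ∀ j, ∀ t ∈ Icc 0 T, ‖uu j t - u t‖ ≤ 2 * M := fun j t ht => by
    have := norm_sub_le (uu j t) (u t)
    linarith [(hbdj j).1 t ht, m1 t ht]
  have heq : ∀ ξ : H n, EquicontSeq T fun j t => inner ℝ ξ (uu j t - u t) := fun ξ => by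
    have h := equicontSeq_inner_solution hα hF hσ hg hvB huu hUU (fun j => (hbdj j).1)
      (fun j => (hbdj j).2.1) (fun j => (hbdj j).2.2) ξ
    have hc : ContinuousOn (fun t => -(inner ℝ ξ (u t) : ℝ)) (Icc 0 T) :=
      (continuousOn_const.inner (𝕜 := ℝ) hu.continuousOn).neg
    refine (h.add_continuousOn hc).congr fun j t _ => ?_
    rw [inner_sub_right, sub_eq_add_neg]
  have hR : EquicontSeq T fun j t => ∫ s in Icc 0 t, remainder κ σ₁ σ₂ (uu j) u (vv j) v s :=
    equicontSeq_remainder (B := B + ‖v‖) (M := 2 * M) hσ hp hU hu.continuousOn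
      (fun j => (huu j).continuousOn) (fun j => (norm_sub_le _ _).trans (by gcongr; exact hvB j)) hwM
      (fun t ht => (m1 t ht).trans (by linarith)) (m3.trans (by linarith))
  have hR0 : ∀ t ∈ Icc 0 T, Tendsto (fun j => ∫ s in Icc 0 t,
      remainder κ σ₁ σ₂ (uu j) u (vv j) v s) atTop (𝓝 0) := fun t ht =>
    tendsto_integral_remainder hT.le (hσ.memLp_noise hp hU hu.continuousOn) hw hwM heq hv ht
  obtain ⟨K, hK, hstab⟩ := exists_stability (g := g) (u₀ := u₀) hα hT hF hσ (B := B ^ 2)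
    (by positivity)
  -- The 2 compensates the factor in front of the remainder and `K + 1` the stability constant. The
  -- remainder is now small outright, so `θ = 0`.
  filter_upwards [hR.eventually_abs_le hR0 (show 0 < ε / (2 * (K + 1)) by positivity)] with j hj
  obtain ⟨k1, k2, k3⟩ := hstab (vv j) v (uu j) u (UU j) U (UUh j) Uh
    (by have := hvB j; gcongr) (huu j) hu (hUU j) hU (fun _ => 0) (2 * (ε / (2 * (K + 1))))
    (by positivity) (fun _ => le_rfl) integrableOn_zero (by simp; positivity) fun t ht => by
      have := (le_abs_self _).trans (hj t ht)
      simp only [zero_mul, integral_zero, add_zero]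
      linarith
  have hle : K * (2 * (ε / (2 * (K + 1)))) ≤ ε := by
    have : K * (2 * (ε / (2 * (K + 1)))) = K / (K + 1) * ε := by field_simp
    rw [this]
    have h2 : K / (K + 1) ≤ 1 := by rw [div_le_one (by positivity)]; linarith
    nlinarith
  exact ⟨fun t ht => (k1 t ht).trans hle, k2.trans hle, k3.trans hle⟩

theorem Repr.lintegral_sqNormV_le {w : ℝ → H n} {W : ℝ × E n → ℝ} {Wh : ℝ × E n → ℂ}
    (hW : Repr α p T w W Wh) (hT : 0 ≤ T) {ε : ℝ} (hw : ∀ t ∈ Icc 0 T, ‖w t‖ ^ 2 ≤ ε)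
    (hWh : ∫ z, ‖Wh z‖ ^ 2 ≤ ε) :
    ∫⁻ t in Icc 0 T, sqNormV α (w t) ≤ ENNReal.ofReal (ε * T + ε) := by
  have hε : 0 ≤ ε := (sq_nonneg _).trans (hw 0 ⟨le_rfl, hT⟩)
  have h1 : ∀ᵐ t ∂(volume.restrict (Icc 0 T)), sqNormV α (w t)
      ≤ ENNReal.ofReal ε + ∫⁻ η, ‖Wh (t, η)‖ₑ ^ (2 : ℝ) := by
    filter_upwards [hW.ae_eq, ae_restrict_mem measurableSet_Icc] with t ⟨_, h2, _, _⟩ ht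
    unfold sqNormV
    refine add_le_add ?_ ?_
    · rw [← ofReal_norm, ← ENNReal.ofReal_pow (norm_nonneg _)]
      exact ENNReal.ofReal_le_ofReal (hw t ht)
    · rw [← eLpNorm_ofReal_rpow two_pos, eLpNorm_congr_ae h2.symm]
      simp
  refine (lintegral_mono_ae h1).trans ?_
  rw [lintegral_add_left measurable_const, setLIntegral_const, Real.volume_Icc, sub_zero,
    ← ENNReal.ofReal_mul hε, ENNReal.ofReal_add (by positivity) hε]
  refine add_le_add le_rfl ((setLIntegral_le_lintegral _ _).trans ?_)
  have hm : Measurable fun z : ℝ × E n => ‖Wh z‖ₑ ^ (2 : ℝ) :=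
    hW.measurable_Uh.enorm.pow_const _
  rw [← lintegral_prod (fun z : ℝ × E n => ‖Wh z‖ₑ ^ (2 : ℝ)) hm.aemeasurable,
    ← Measure.volume_eq_prod]
  refine le_trans ?_ (ENNReal.ofReal_le_ofReal hWh)
  rw [ofReal_integral_eq_lintegral_ofReal hW.integrable_sq
    (Eventually.of_forall fun z => by positivity)]
  refine lintegral_mono ?_
  intro z
  simp only [ENNReal.rpow_two]
  rw [ENNReal.ofReal_pow (norm_nonneg _), ofReal_norm]

theorem Repr.lintegral_eLpNorm_le {w : ℝ → H n} {W : ℝ × E n → ℝ} {Wh : ℝ × E n → ℂ}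
    (hp : 2 < p) (hW : Repr α p T w W Wh) {ε : ℝ} (hε : ∫ z, ‖W z‖ ^ p ≤ ε) :
    ∫⁻ t in Icc 0 T, eLpNorm (w t) (ENNReal.ofReal p) volume ^ p ≤ ENNReal.ofReal ε := by
  have h1 : ∀ᵐ t ∂(volume.restrict (Icc 0 T)), eLpNorm (w t) (ENNReal.ofReal p) volume ^ p
      ≤ ∫⁻ x, ‖W (t, x)‖ₑ ^ p := by
    filter_upwards [hW.ae_eq] with t ⟨h2, _⟩
    rw [← eLpNorm_ofReal_rpow (by linarith), eLpNorm_congr_ae h2.symm]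
  refine (lintegral_mono_ae h1).trans ((setLIntegral_le_lintegral _ _).trans ?_)
  have hm : Measurable fun z : ℝ × E n => ‖W z‖ₑ ^ p := hW.measurable_U.enorm.pow_const _
  rw [← lintegral_prod (fun z : ℝ × E n => ‖W z‖ₑ ^ p) hm.aemeasurable, ← Measure.volume_eq_prod]
  refine le_trans ?_ (ENNReal.ofReal_le_ofReal hε)
  rw [ofReal_integral_eq_lintegral_ofReal (hW.integrable_rpow hp)
    (Eventually.of_forall fun z => by positivity)]
  refine lintegral_mono ?_
  intro z
  simp only
  rw [← ENNReal.ofReal_rpow_of_nonneg (norm_nonneg _) (by linarith), ofReal_norm]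

end Convergence

end FracRD

end

theorem lemma4p4 {n : ℕ} (hn : 1 ≤ n) (α : ℝ) (hα : α ∈ Ioo (0 : ℝ) 1)
    (p lam₁ lam₂ : ℝ) (ψ₁ ψ₂ ψ₃ ψ₄ : ℝ → FracRD.E n → ℝ) (F : ℝ → FracRD.E n → ℝ → ℝ)
    (hF : FracRD.DriftAssumptions p lam₁ lam₂ ψ₁ ψ₂ ψ₃ ψ₄ F)
    (q : ℝ) (κ : FracRD.E n → ℝ) (σ₁ : ℝ → FracRD.HSeq n)
    (σ₂ : ℕ → ℝ → FracRD.E n → ℝ → ℝ) (a b c : ℕ → ℝ)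
    (hσ : FracRD.NoiseAssumptions p q κ σ₁ σ₂ a b c)
    (g : ℝ → FracRD.H n) (hg : ∀ r s : ℝ, MemLp g 2 (volume.restrict (Icc r s)))
    (T : ℝ) (hT : 0 < T) (u₀ : FracRD.H n)
    (vv : ℕ → FracRD.Control T) (v : FracRD.Control T)
    (hv : ∀ φ : FracRD.Control T →L[ℝ] ℝ, Tendsto (fun j => φ (vv j)) atTop (𝓝 (φ v)))
    (uu : ℕ → ℝ → FracRD.H n) (u : ℝ → FracRD.H n)
    (huu : ∀ j, FracRD.IsSolution α p T F g κ σ₁ σ₂ u₀ (vv j) (uu j))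
    (hu : FracRD.IsSolution α p T F g κ σ₁ σ₂ u₀ v u) :
    FracRD.StrongConvergence α p T uu u := by
  have hp := hF.two_lt_p
  choose UU UUh hUU using fun j => (huu j).exists_repr hp
  obtain ⟨U, Uh, hU⟩ := hu.exists_repr hp
  have key := fun (ε : ℝ) (hε : 0 < ε) =>
    FracRD.eventually_close hα hT hF hσ (hg 0 T) hv huu hu hUU hU hε
  refine ⟨Metric.tendstoUniformlyOn_iff.2 fun ε hε => ?_, ?_, ?_⟩
  -- Half of `ε` turns the non-strict bound into the strict one required here.
  · filter_upwards [key ((ε / 2) ^ 2) (by positivity)] with j hj t ht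
    have h := (le_abs_self _).trans (abs_le_of_sq_le_sq (hj.1 t ht) (by positivity))
    rw [dist_comm, dist_eq_norm]
    linarith
  · refine ENNReal.tendsto_nhds_zero.2 fun ε hε => ?_
    have hlim : Tendsto (fun δ : ℝ => ENNReal.ofReal (δ * T + δ)) (𝓝[>] 0) (𝓝 0) := by
      have h : Tendsto (fun δ : ℝ => ENNReal.ofReal (δ * T + δ)) (𝓝 0)
          (𝓝 (ENNReal.ofReal (0 * T + 0))) :=
        (ENNReal.continuous_ofReal.comp (by fun_prop : Continuous fun δ : ℝ => δ * T + δ)).tendsto 0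
      simpa using h.mono_left nhdsWithin_le_nhds
    obtain ⟨δ, hδε, hδ⟩ := ((ENNReal.tendsto_nhds_zero.1 hlim ε hε).and self_mem_nhdsWithin).exists
    filter_upwards [key δ hδ] with j hj
    exact (((hUU j).sub hU).lintegral_sqNormV_le hT.le hj.1 hj.2.1).trans hδε
  · refine ENNReal.tendsto_nhds_zero.2 fun ε hε => ?_
    have hlim : Tendsto (fun δ : ℝ => ENNReal.ofReal δ) (𝓝[>] 0) (𝓝 0) := by
      simpa using (ENNReal.continuous_ofReal.tendsto 0).mono_left nhdsWithin_le_nhds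
    obtain ⟨δ, hδε, hδ⟩ := ((ENNReal.tendsto_nhds_zero.1 hlim ε hε).and self_mem_nhdsWithin).exists
    filter_upwards [key δ hδ] with j hj
    exact (FracRD.Repr.lintegral_eLpNorm_le hp ((hUU j).sub hU) hj.2.2).trans hδε
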